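/- In the $(1,\varepsilon)$-restricted assignment problem there are a set $M$ of $m\ge 1$ machines, heavy jobs $J_H$ of size $1$ and light jobs $J_L$ of size $\varepsilon\in(0,1]$; each job $j\in J=J_H\cup J_L$ may only be assigned to a machine of a given set $M_j\subseteq M$. A schedule assigns each job to an allowed machine; its makespan is the largest total size of the jobs on one machine. For $\rho,\delta$, a feasible solution of $\mathsf{LP}(\rho,\delta)$ consists of numbers $x_{i,j}\ge 0$ ($j\in J$, $i\in M_j$) and $z_i\ge 0$ ($i\in M$) with $$\sum_{i\in M_j}x_{i,j}=1\ (j\in J),\quad \sum_{j\in J_H:\,i\in M_j}x_{i,j}=z_i\le 1\ (i\in M),\quad z_i+\varepsilon\sum_{j\in J_L:\,i\in M_j}x_{i,j}\le 1+\rho\delta\ (i\in M),$$ $$(1-\rho)z_i+x_{i,j}\le 1\ (j\in J_L,\ i\in M_j).$$ A canonical instance on $M$ is a triple $(\{M'_j\}_{j\in J'},w,z)$, where the sets $M'_j\subseteq M$ of the finitely many (heavy) jobs $j\in J'$ are pairwise disjoint; $w\in\mathbb R_{\ge0}^{M\times M}$, with $w_{h,k}=0$ if $z_k=0$ and $h\ne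 k$, and $w_{h,h}=0$ if $z_h>0$; and $z:M\to[0,0.4]$, with $z_i=0$ if and only if $i\notin\bigcup_j M'_j$. For $p,q\ge1$ and $\theta\in[0,0.2)$ it is $(p,q,\theta)$-canonical if 1. $z_i=0$ or $z_i\ge 1/p$ for all $i\in M$; 2. $w_{h,k}=0$ or $w_{h,k}\ge 1/q$ for all $h,k\in M$; 3. $\sum_{i\in M'_j}z_i\ge 0.2-\theta$ for all $j\in J'$; 4. $z_h+\sum_k w_{k,h}(1-z_h)+\sum_k w_{h,k}z_k\le 1+\theta$ for all $h\in M$. For $\delta'\in(0,1)$, a map $f:J'\to M$ with $f(j)\in M'_j$ for all $j$ is a $\delta'$-good assignment if each light load $w_{h,k}$ can be split fractionally between the machines $h$ and $k$ such that every machine has total load at most $2-\delta'$, where each heavy job $j$ puts load $1$ on $f(j)$. **Theorem.** Let $\rho=0.6$ and $\delta>0$ with $\rho\delta<0.2$. Given an instance $\mathsf I$ of the $(1,\varepsilon)$-restricted assignment problem, with $m\geq 1$ machines and $0<\varepsilon\le 1$, and a feasible solution $(x,z)$ of $\mathsf{LP}(\rho,\delta)$ for $\mathsf I$, there is an $\left(\frac{m}{\rho\delta},\frac1\varepsilon,\rho\delta\right)$-canonical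 instance $\mathsf I'$ on the same machines such that, for every $\delta'\in(0,1)$, the existence of a $\delta'$-good assignment for $\mathsf I'$ implies that $\mathsf I$ has a schedule of makespan at most $2-\delta'+2\varepsilon$. Moreover, there is an algorithm that, for all rational data $\mathsf I$ (with its $\varepsilon$), $\delta$ and $(x,z)$ as above, computes such an $\mathsf I'$ in time polynomial in the length of the input in bits (on a random access machine with logarithmic cost). -/

import Mathlib

noncomputable section

namespace RestrictedAssignment

/-! ## Instances, schedules and the linear program -/

/-- An instance of the `(1, ε)`-restricted assignment problem with machines `Fin m`, heavy jobs
`Fin nH` (of size `1`) and light jobs `Fin nL` (of size `eps`); `heavyMach j` and `lightMach j`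
are the sets of machines to which a job can be assigned. -/
structure Instance (K : Type) (m nH nL : ℕ) where
  eps : K
  heavyMach : Fin nH → Finset (Fin m)
  lightMach : Fin nL → Finset (Fin m)

/-- Values for the variables `x` (split into heavy and light jobs) and `z` of the linear program.
Only the values `x i j` with `i` in the machine set of `j` matter. -/
structure LPPoint (K : Type) (m nH nL : ℕ) where
  xH : Fin m → Fin nH → K
  xL : Fin m → Fin nL → K
  z : Fin m → K

/-- A rational instance seen as a real one. -/
def Instance.toReal {m nH nL : ℕ} (I : Instance ℚ m nH nL) : Instance ℝ m nH nL where
  eps := (I.eps : ℝ)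
  heavyMach := I.heavyMach
  lightMach := I.lightMach

/-- A rational point seen as a real one. -/
def LPPoint.toReal {m nH nL : ℕ} (s : LPPoint ℚ m nH nL) : LPPoint ℝ m nH nL where
  xH := fun i j => (s.xH i j : ℝ)
  xL := fun i j => (s.xL i j : ℝ)
  z := fun i => (s.z i : ℝ)

/-- `s` is a feasible solution of `LP(ρ, δ)` for the instance `I`. -/
structure LPFeasible {m nH nL : ℕ} (I : Instance ℝ m nH nL) (ρ δ : ℝ)
    (s : LPPoint ℝ m nH nL) : Prop where
  heavy_covered : ∀ j, ∑ i ∈ I.heavyMach j, s.xH i j = 1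
  light_covered : ∀ j, ∑ i ∈ I.lightMach j, s.xL i j = 1
  heavy_load : ∀ i, ∑ j with i ∈ I.heavyMach j, s.xH i j = s.z i
  z_le_one : ∀ i, s.z i ≤ 1
  total_load : ∀ i, s.z i + I.eps * ∑ j with i ∈ I.lightMach j, s.xL i j ≤ 1 + ρ * δ
  compact : ∀ j, ∀ i ∈ I.lightMach j, (1 - ρ) * s.z i + s.xL i j ≤ 1
  xH_nonneg : ∀ j, ∀ i ∈ I.heavyMach j, 0 ≤ s.xH i j
  xL_nonneg : ∀ j, ∀ i ∈ I.lightMach j, 0 ≤ s.xL i j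
  z_nonneg : ∀ i, 0 ≤ s.z i

/-- A schedule assigns every job to one of the machines that it can be assigned to. -/
structure Schedule {m nH nL : ℕ} (I : Instance ℝ m nH nL) where
  heavy : Fin nH → Fin m
  light : Fin nL → Fin m
  heavy_mem : ∀ j, heavy j ∈ I.heavyMach j
  light_mem : ∀ j, light j ∈ I.lightMach j

/-- The load of a machine in a schedule. -/
def Schedule.load {m nH nL : ℕ} {I : Instance ℝ m nH nL} (σ : Schedule I) (i : Fin m) : ℝ :=
  (∑ j, if σ.heavy j = i then 1 else 0) + ∑ j, if σ.light j = i then I.eps else 0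

/-- The makespan: the largest load of a machine. -/
def Schedule.makespan {m nH nL : ℕ} {I : Instance ℝ m nH nL} (σ : Schedule I) : ℝ :=
  ⨆ i, σ.load i

/-! ## Canonical instances -/

/-- A canonical instance with machines `Fin m` and heavy jobs `Fin k`; `w h k` is the light load
of type `(h, k)`. -/
structure CanonicalInstance (m k : ℕ) where
  mach : Fin k → Finset (Fin m)
  w : Fin m → Fin m → ℝ
  z : Fin m → ℝ
  mach_disjoint : ∀ j j', j ≠ j' → Disjoint (mach j) (mach j')
  w_nonneg : ∀ h k, 0 ≤ w h k
  w_eq_zero : ∀ h k, z k = 0 → h ≠ k → w h k = 0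
  w_diag : ∀ h, 0 < z h → w h h = 0
  z_nonneg : ∀ i, 0 ≤ z i
  z_le : ∀ i, z i ≤ 0.4
  z_eq_zero_iff : ∀ i, z i = 0 ↔ ∀ j, i ∉ mach j

/-- `C` is a `(p, q, θ)`-canonical instance. -/
structure CanonicalInstance.IsCanonical {m k : ℕ} (C : CanonicalInstance m k) (p q θ : ℝ) :
    Prop where
  one_le_p : 1 ≤ p
  one_le_q : 1 ≤ q
  theta_nonneg : 0 ≤ θ
  theta_lt : θ < 0.2
  z_large : ∀ i, C.z i = 0 ∨ 1 / p ≤ C.z i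
  w_large : ∀ h k, C.w h k = 0 ∨ 1 / q ≤ C.w h k
  heavy_covered : ∀ j, 0.2 - θ ≤ ∑ i ∈ C.mach j, C.z i
  load_le : ∀ h, C.z h + ∑ k, C.w k h * (1 - C.z h) + ∑ k, C.w h k * C.z k ≤ 1 + θ

/-- The assignment `f` of the heavy jobs is valid and `δ`-good: all light load can be split
fractionally so that each machine has total load at most `2 - δ`. Of the light load of type
`(h, k)`, the amount `φ h k` goes to `h` and the rest goes to `k`. -/
def CanonicalInstance.IsGood {m k : ℕ} (C : CanonicalInstance m k) (δ : ℝ)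
    (f : Fin k → Fin m) : Prop :=
  (∀ j, f j ∈ C.mach j) ∧
    ∃ φ : Fin m → Fin m → ℝ, (∀ h k, 0 ≤ φ h k ∧ φ h k ≤ C.w h k) ∧
      ∀ i, (∑ j, if f j = i then (1 : ℝ) else 0) + ∑ k, φ i k + ∑ h, (C.w h i - φ h i) ≤ 2 - δ

/-- `C` is an `(m/(ρδ), 1/ε, ρδ)`-canonical instance, and for all `δ' ∈ (0, 1)` any `δ'`-good
assignment for `C` implies a schedule of makespan at most `2 - δ' + 2ε` for `I`. -/
def IsCanonicalReduction {m nH nL k : ℕ} (I : Instance ℝ m nH nL) (ρ δ : ℝ)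
    (C : CanonicalInstance m k) : Prop :=
  C.IsCanonical (m / (ρ * δ)) (1 / I.eps) (ρ * δ) ∧
    ∀ δ' : ℝ, 0 < δ' → δ' < 1 → ∀ f : Fin k → Fin m, C.IsGood δ' f →
      ∃ σ : Schedule I, σ.makespan ≤ 2 - δ' + 2 * I.eps

/-! ## The machine model

A random access machine with logarithmic (bit) cost. Its memory consists of two-dimensional
arrays, numbered by the natural numbers, whose cells hold rational numbers; a program mentions
only finitely many arrays. Every operation is charged the bit length of the number it produces,
in addition to the bit lengths of its operands, so that running times are the same as those of
Turing machines up to a polynomial. -/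

/-- The number of bits used to write down a rational number (with one bit for the sign). -/
def bitSize (q : ℚ) : ℕ := Nat.size q.num.natAbs + Nat.size q.den + 1

/-- Memory contents: `μ a r c` is the cell of the array `a` in row `r` and column `c`. -/
abbrev Store : Type := ℕ → ℕ → ℕ → ℚ

/-- Arithmetic expressions; `read a r c` is the cell of the array `a` at the computed position. -/
inductive Expr : Type
  | lit (q : ℚ)
  | read (a : ℕ) (r c : Expr)
  | add (e₁ e₂ : Expr)
  | sub (e₁ e₂ : Expr)
  | mul (e₁ e₂ : Expr)
  | div (e₁ e₂ : Expr)

/-- The value of an expression. Computed positions are rounded down to natural numbers, and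
`x / 0 = 0`. -/
def Expr.eval (μ : Store) : Expr → ℚ
  | .lit q => q
  | .read a r c => μ a ⌊r.eval μ⌋₊ ⌊c.eval μ⌋₊
  | .add e₁ e₂ => e₁.eval μ + e₂.eval μ
  | .sub e₁ e₂ => e₁.eval μ - e₂.eval μ
  | .mul e₁ e₂ => e₁.eval μ * e₂.eval μ
  | .div e₁ e₂ => e₁.eval μ / e₂.eval μ

/-- The bit cost of the evaluation of an expression. -/
def Expr.cost (μ : Store) : Expr → ℕ
  | .lit q => bitSize q
  | .read a r c => r.cost μ + c.cost μ + bitSize (μ a ⌊r.eval μ⌋₊ ⌊c.eval μ⌋₊)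
  | .add e₁ e₂ => e₁.cost μ + e₂.cost μ + bitSize (e₁.eval μ + e₂.eval μ)
  | .sub e₁ e₂ => e₁.cost μ + e₂.cost μ + bitSize (e₁.eval μ - e₂.eval μ)
  | .mul e₁ e₂ => e₁.cost μ + e₂.cost μ + bitSize (e₁.eval μ * e₂.eval μ)
  | .div e₁ e₂ => e₁.cost μ + e₂.cost μ + bitSize (e₁.eval μ / e₂.eval μ)

/-- The memory after the value `v` has been written into a cell. -/
def Store.write (μ : Store) (a r c : ℕ) (v : ℚ) : Store :=
  fun a' r' c' => if a' = a ∧ r' = r ∧ c' = c then v else μ a' r' c'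

/-- Programs. The tests of `ite` and `loop` (a while loop) are of the form `e₁ ≤ e₂`. -/
inductive Program : Type
  | skip
  | assign (a : ℕ) (r c e : Expr)
  | seq (P Q : Program)
  | ite (e₁ e₂ : Expr) (P Q : Program)
  | loop (e₁ e₂ : Expr) (P : Program)

/-- `Runs P μ μ' t`: started with the memory `μ`, the program `P` halts with the memory `μ'`,
and the total bit cost of its run is `t`. -/
inductive Runs : Program → Store → Store → ℕ → Prop
  | skip (μ : Store) : Runs .skip μ μ 1
  | assign (μ : Store) (a : ℕ) (r c e : Expr) :
      Runs (.assign a r c e) μ (μ.write a ⌊r.eval μ⌋₊ ⌊c.eval μ⌋₊ (e.eval μ))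
        (r.cost μ + c.cost μ + e.cost μ + 1)
  | seq {P Q : Program} {μ μ' μ'' : Store} {t t' : ℕ} (hP : Runs P μ μ' t)
      (hQ : Runs Q μ' μ'' t') : Runs (.seq P Q) μ μ'' (t + t')
  | ite_true {e₁ e₂ : Expr} {P Q : Program} {μ μ' : Store} {t : ℕ}
      (h : e₁.eval μ ≤ e₂.eval μ) (hP : Runs P μ μ' t) :
      Runs (.ite e₁ e₂ P Q) μ μ' (e₁.cost μ + e₂.cost μ + 1 + t)
  | ite_false {e₁ e₂ : Expr} {P Q : Program} {μ μ' : Store} {t : ℕ}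
      (h : ¬ e₁.eval μ ≤ e₂.eval μ) (hQ : Runs Q μ μ' t) :
      Runs (.ite e₁ e₂ P Q) μ μ' (e₁.cost μ + e₂.cost μ + 1 + t)
  | loop_done {e₁ e₂ : Expr} {P : Program} {μ : Store} (h : ¬ e₁.eval μ ≤ e₂.eval μ) :
      Runs (.loop e₁ e₂ P) μ μ (e₁.cost μ + e₂.cost μ + 1)
  | loop_step {e₁ e₂ : Expr} {P : Program} {μ μ' μ'' : Store} {t t' : ℕ}
      (h : e₁.eval μ ≤ e₂.eval μ) (hP : Runs P μ μ' t)
      (hL : Runs (.loop e₁ e₂ P) μ' μ'' t') :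
      Runs (.loop e₁ e₂ P) μ μ'' (e₁.cost μ + e₂.cost μ + 1 + t + t')

/-! ## Input and output -/

/-- The initial memory: array `0` holds the numbers `m, nH, nL, ε, δ`, arrays `1` and `2` hold
the incidence matrices of the machine sets of the heavy and of the light jobs (a row for each
job), arrays `3` and `4` the values `x` of the heavy and of the light jobs, and array `5` the
vector `z`. All other cells are `0`. -/
def encodeInput {m nH nL : ℕ} (I : Instance ℚ m nH nL) (δ : ℚ) (s : LPPoint ℚ m nH nL) : Store
  | 0, 0, 0 => m
  | 0, 0, 1 => nH
  | 0, 0, 2 => nL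
  | 0, 0, 3 => I.eps
  | 0, 0, 4 => δ
  | 1, r, c => if h : r < nH ∧ c < m then
      (if (⟨c, h.2⟩ : Fin m) ∈ I.heavyMach ⟨r, h.1⟩ then 1 else 0) else 0
  | 2, r, c => if h : r < nL ∧ c < m then
      (if (⟨c, h.2⟩ : Fin m) ∈ I.lightMach ⟨r, h.1⟩ then 1 else 0) else 0
  | 3, r, c => if h : r < nH ∧ c < m then s.xH ⟨c, h.2⟩ ⟨r, h.1⟩ else 0
  | 4, r, c => if h : r < nL ∧ c < m then s.xL ⟨c, h.2⟩ ⟨r, h.1⟩ else 0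
  | 5, 0, c => if h : c < m then s.z ⟨c, h⟩ else 0
  | _, _, _ => 0

/-- The length of the input: the number of machines and jobs, of entries of the incidence
matrices, and of bits of all the rational numbers that are given. -/
def inputSize {m nH nL : ℕ} (I : Instance ℚ m nH nL) (δ : ℚ) (s : LPPoint ℚ m nH nL) : ℕ :=
  m + nH + nL + m * nH + m * nL + bitSize I.eps + bitSize δ +
    (∑ i, ∑ j, bitSize (s.xH i j)) + (∑ i, ∑ j, bitSize (s.xL i j)) + ∑ i, bitSize (s.z i)

/-- The final memory `μ` holds the canonical instance `C`: the number of its heavy jobs in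
array `6`, the incidence matrix of their machine sets in array `7` (a row for each job), the
matrix `w` in array `8` and the vector `z` in array `9`. -/
structure HoldsOutput {m k : ℕ} (μ : Store) (C : CanonicalInstance m k) : Prop where
  count : μ 6 0 0 = k
  mach : ∀ (j : Fin k) (i : Fin m), μ 7 j i = if i ∈ C.mach j then 1 else 0
  w : ∀ h l : Fin m, (μ 8 h l : ℝ) = C.w h l
  z : ∀ i : Fin m, (μ 9 0 i : ℝ) = C.z i

end RestrictedAssignment

end

/-!
The canonical instance is read off from solutions of the linear program with acyclic support.

*Acyclic solutions.* A fractional assignment of jobs to machines with upper bounds on its values is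
described by its residual capacities `y a b`, which live on the pairs of a job and a machine. A pair
is free if `0 < y a b` and `0 < y b a`, that is, if the value is strictly between its bounds. Pushing
flow around a cycle of free pairs preserves the total amounts of all jobs and machines; with the
bottleneck capacity it destroys a free pair. So the free pairs can be made a forest
(`exists_isForest`), which is rooted by a parent function.

*Heavy jobs.* Here the upper bound is `2`, so that all pairs with a positive value are free. A job is
linked if more than one half of it is assigned to its parent machine; since `z ≤ 1`, a machine is the
parent of at most one linked job. Following linked jobs to the parents of their parent machines
splits the jobs into clusters, each with a top, which is not linked. A linked job becomes a canonical
job that may only use its parent machine, and the top becomes a canonical job for all unclaimed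
machines below its cluster. Counting the assignment of a cluster shows that the latter machines have
total `z` at least `1 / 2` (`AcyclicAssignment.half_le_sum`), and this remains nearly true after
discarding those with tiny `z`. Multiplying by `0.4` gives the vector `ζ` of the canonical instance
(`canonicalZ`). Conversely, the machine used by the top of a cluster hangs below some job of the
cluster, and shifting the jobs along the path from there to the top gives an assignment of the
original heavy jobs that uses the same machines (`AcyclicAssignment.exists_rearrangement`).

*Light jobs.* By the last inequality of the linear program, the light jobs obey the upper bounds
`1 - ζ i`. In an acyclic assignment with these bounds, a job with at most one free pair is assigned
to one machine `k` up to the bound, and the rest, which is `ζ k`, to at most one further machine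
`h`: it has the type `(h, k)`, and `w h k` is `ε` times the number of such jobs. All other jobs are
parents of machines, and they can be assigned injectively to children. The split of the light
loads in a good assignment is a fractional assignment of the jobs with a type, which Hall's theorem
rounds at the cost of one job per machine (`exists_rounding`). So each machine gets at most `2 * ε`
more than its load in the good assignment (`AcyclicAssignment.exists_light_schedule`).

*Running time.* The search for cycles extends a path of free pairs until it closes a cycle, which is
cancelled, or ends in a leaf, which is removed; `searchMeasure` bounds the number of steps. All
residual capacities are multiples of the inverse of one common denominator of the input and lie
between `0` and `2`, hence their bit lengths are linear in the length of the input. `Exec` is a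
program logic that combines correctness with the running time: if all cells keep at most `B` bits
and no loop has more than `N` iterations, a program runs in time `P.timePoly.eval N * B`.
-/

noncomputable section

namespace RestrictedAssignment

/-! ### Cancelling cycles in a residual graph -/

section Forest

set_option linter.unusedSectionVars false

variable {K : Type} [Field K] [LinearOrder K] [IsStrictOrderedRing K]

/-- A pair of vertices is free if flow can still be pushed along it in both directions; `y a b` is
the amount that can be pushed from `a` to `b`. -/
def Free (y : ℕ → ℕ → K) (a b : ℕ) : Prop := 0 < y a b ∧ 0 < y b a

theorem Free.symm {y : ℕ → ℕ → K} {a b : ℕ} (h : Free y a b) : Free y b a := ⟨h.2, h.1⟩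

/-- `y` arises from the residual capacities `y₀` on the vertices `0, …, V - 1` by pushing a
circulation, with all values in the subgroup `A`. -/
structure Circulated (V : ℕ) (A : AddSubgroup K) (y₀ y : ℕ → ℕ → K) : Prop where
  mem : ∀ a b, y a b ∈ A
  nonneg : ∀ a b, 0 ≤ y a b
  pair : ∀ a b, y a b + y b a = y₀ a b + y₀ b a
  row : ∀ a, ∑ b ∈ Finset.range V, y a b = ∑ b ∈ Finset.range V, y₀ a b

/-- `y₀` describes a loopless graph with vertices `0, …, V - 1`. -/
def Supported (V : ℕ) (y₀ : ℕ → ℕ → K) : Prop :=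
  ∀ a b, V ≤ a ∨ a = b → y₀ a b = 0 ∧ y₀ b a = 0

theorem Circulated.eq_zero {V : ℕ} {A : AddSubgroup K} {y₀ y : ℕ → ℕ → K}
    (h : Circulated V A y₀ y) {a b : ℕ} (h1 : y₀ a b = 0) (h2 : y₀ b a = 0) : y a b = 0 := by
  have := h.pair a b
  have := h.nonneg a b
  have := h.nonneg b a
  linarith

theorem Circulated.free_lt {V : ℕ} {A : AddSubgroup K} {y₀ y : ℕ → ℕ → K}
    (h : Circulated V A y₀ y) (hs : Supported V y₀) {a b : ℕ} (hf : Free y a b) :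
    a < V ∧ b < V ∧ a ≠ b := by
  refine ⟨?_, ?_, ?_⟩
  · by_contra hc
    have := hs a b (Or.inl (not_lt.mp hc))
    exact hf.1.ne' (h.eq_zero this.1 this.2)
  · by_contra hc
    have := hs b a (Or.inl (not_lt.mp hc))
    exact hf.1.ne' (h.eq_zero this.2 this.1)
  · intro hc
    have := hs a b (Or.inr hc)
    exact hf.1.ne' (h.eq_zero this.1 this.2)

/-- The free pairs form a forest, rooted by `par`: `rk` strictly increases from parents to
children, the only free neighbour of smaller rank is the parent, and `par a = V` at the roots. -/
structure IsForest (V : ℕ) (y : ℕ → ℕ → K) (rk par : ℕ → ℕ) : Prop where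
  rk_ne : ∀ a b, Free y a b → rk a ≠ rk b
  par_eq : ∀ a b, Free y a b → rk b < rk a → par a = b
  par_root : ∀ a < V, par a = V ∨ (par a < V ∧ Free y a (par a) ∧ rk (par a) < rk a)
  rk_le : ∀ a < V, rk a ≤ V
  par_top : par V = V

/-- The state of the search for cycles. Vertices of rank `0` are unprocessed, and `cnt` is their
number; `P 1, …, P len` is a path of free pairs of unprocessed vertices. The processed vertices
satisfy the conditions of `IsForest`. -/
structure SearchState (V : ℕ) (y : ℕ → ℕ → K) (rk par P : ℕ → ℕ) (len cnt : ℕ) : Prop where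
  rk_eq : ∀ a b, Free y a b → rk a = rk b → rk a = 0
  par_eq : ∀ a b, Free y a b → rk b < rk a → par a = b
  par_root : ∀ a < V, 0 < rk a →
    par a = V ∨ (par a < V ∧ Free y a (par a) ∧ rk (par a) < rk a)
  rk_gt : ∀ a < V, 0 < rk a → cnt < rk a ∧ rk a ≤ V
  par_top : par V = V
  cnt_eq : cnt = ((Finset.range V).filter fun a => rk a = 0).card
  path_zero : P 0 = V
  path_lt : ∀ r, 1 ≤ r → r ≤ len → P r < V
  path_rk : ∀ r, 1 ≤ r → r ≤ len → rk (P r) = 0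
  path_inj : ∀ r s, 1 ≤ r → r < s → s ≤ len → P r ≠ P s
  path_free : ∀ r, 1 ≤ r → r < len → Free y (P r) (P (r + 1))

/-- The number of ordered free pairs. -/
def freeCount (V : ℕ) (y : ℕ → ℕ → K) : ℕ := by
  classical
  exact ((Finset.range V ×ˢ Finset.range V).filter fun p => Free y p.1 p.2).card

/-- A bound on the number of the remaining steps of the search: each step lengthens the path,
processes a vertex, or cancels a cycle and thereby destroys a free pair. -/
def searchMeasure (V : ℕ) (y : ℕ → ℕ → K) (len cnt : ℕ) : ℕ :=
  (V + 1) * (freeCount V y + cnt) + (V - len)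

theorem freeCount_le (V : ℕ) (y : ℕ → ℕ → K) : freeCount V y ≤ V * V := by
  classical
  unfold freeCount
  refine (Finset.card_filter_le _ _).trans ?_
  simp

theorem SearchState.len_le {V : ℕ} {y : ℕ → ℕ → K} {rk par P : ℕ → ℕ} {len cnt : ℕ}
    (h : SearchState V y rk par P len cnt) : len ≤ cnt := by
  classical
  rw [h.cnt_eq]
  have : ((Finset.Icc 1 len).image P).card = len := by
    rw [Finset.card_image_of_injOn]
    · simp
    · intro r hr s hs hrs
      simp only [Finset.coe_Icc, Set.mem_Icc] at hr hs
      rcases lt_trichotomy r s with h1 | h1 | h1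
      · exact absurd hrs (h.path_inj r s hr.1 h1 hs.2)
      · exact h1
      · exact absurd hrs.symm (h.path_inj s r hs.1 h1 hr.2)
  rw [← this]
  apply Finset.card_le_card
  intro v hv
  simp only [Finset.mem_image, Finset.mem_Icc] at hv
  obtain ⟨r, hr, rfl⟩ := hv
  simp [h.path_lt r hr.1 hr.2, h.path_rk r hr.1 hr.2]

theorem SearchState.cnt_le {V : ℕ} {y : ℕ → ℕ → K} {rk par P : ℕ → ℕ} {len cnt : ℕ}
    (h : SearchState V y rk par P len cnt) : cnt ≤ V := by
  rw [h.cnt_eq]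
  exact (Finset.card_filter_le _ _).trans (by simp)

theorem SearchState.congr_path {V : ℕ} {y : ℕ → ℕ → K} {rk par P P' : ℕ → ℕ} {len cnt : ℕ}
    (h : SearchState V y rk par P len cnt) (hP : ∀ r, r ≤ len → P' r = P r) :
    SearchState V y rk par P' len cnt where
  rk_eq := h.rk_eq
  par_eq := h.par_eq
  par_root := h.par_root
  rk_gt := h.rk_gt
  par_top := h.par_top
  cnt_eq := h.cnt_eq
  path_zero := by rw [hP 0 (by omega)]; exact h.path_zero
  path_lt := fun r h1 h2 => by rw [hP r h2]; exact h.path_lt r h1 h2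
  path_rk := fun r h1 h2 => by rw [hP r h2]; exact h.path_rk r h1 h2
  path_inj := fun r s h1 h2 h3 => by
    rw [hP r (by omega), hP s h3]; exact h.path_inj r s h1 h2 h3
  path_free := fun r h1 h2 => by
    rw [hP r (by omega), hP _ h2]; exact h.path_free r h1 h2

theorem SearchState.init (V : ℕ) (y : ℕ → ℕ → K) (rk par P : ℕ → ℕ) (hrk : ∀ a, rk a = 0)
    (hp : par V = V) (hP : P 0 = V) : SearchState V y rk par P 0 V where
  rk_eq := fun a _ _ _ => hrk a
  par_eq := fun a b _ h => by simp [hrk] at h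
  par_root := fun a _ h => by simp [hrk] at h
  rk_gt := fun a _ h => by simp [hrk] at h
  par_top := hp
  cnt_eq := by simp [hrk]
  path_zero := hP
  path_lt := fun r h1 h2 => by omega
  path_rk := fun r h1 h2 => by omega
  path_inj := fun r s h1 h2 h3 => by omega
  path_free := fun r h1 h2 => by omega

theorem SearchState.isForest {V : ℕ} {A : AddSubgroup K} {y₀ y : ℕ → ℕ → K} {rk par P : ℕ → ℕ}
    {len : ℕ} (h : SearchState V y rk par P len 0) (hc : Circulated V A y₀ y)
    (hs : Supported V y₀) : IsForest V y rk par := by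
  have hpos : ∀ a < V, 0 < rk a := by
    intro a ha
    by_contra hc
    have h0 := h.cnt_eq.symm
    rw [Finset.card_eq_zero, Finset.filter_eq_empty_iff] at h0
    exact h0 (Finset.mem_range.mpr ha) (by omega)
  exact {
    rk_ne := fun a b hf he => (hpos a (hc.free_lt hs hf).1).ne' (h.rk_eq a b hf he)
    par_eq := h.par_eq
    par_root := fun a ha => h.par_root a ha (hpos a ha)
    rk_le := fun a ha => (h.rk_gt a ha (hpos a ha)).2
    par_top := h.par_top }

/-- The last vertex of the path is processed when its only unprocessed free neighbour is its
predecessor. -/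
theorem SearchState.peel {V : ℕ} {A : AddSubgroup K} {y₀ y : ℕ → ℕ → K} {rk par P : ℕ → ℕ}
    {len cnt : ℕ} (h : SearchState V y rk par P (len + 1) cnt) (hc : Circulated V A y₀ y)
    (hs : Supported V y₀)
    (hleaf : ∀ b < V, rk b = 0 → Free y (P (len + 1)) b → b = P len) :
    SearchState V y (Function.update rk (P (len + 1)) cnt)
      (Function.update par (P (len + 1)) (P len)) P len (cnt - 1) ∧
    searchMeasure V y len (cnt - 1) < searchMeasure V y (len + 1) cnt := by
  classical
  set v := P (len + 1) with hv
  have hvV : v < V := h.path_lt _ (by omega) le_rfl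
  have hv0 : rk v = 0 := h.path_rk _ (by omega) le_rfl
  have hlc := h.len_le
  have hcV := h.cnt_le
  have hcnt : 1 ≤ cnt := by omega
  have hne : ∀ r, 1 ≤ r → r ≤ len → P r ≠ v := fun r h1 h2 =>
    h.path_inj r (len + 1) h1 (by omega) le_rfl
  refine ⟨?_, ?_⟩
  · exact {
      rk_eq := by
        intro a b hf he
        obtain ⟨ha, hb, hab⟩ := hc.free_lt hs hf
        by_cases h1 : a = v
        · subst h1
          rw [Function.update_self, Function.update_of_ne (Ne.symm hab)] at he
          have := h.rk_gt b hb (by omega)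
          omega
        · rw [Function.update_of_ne h1] at he ⊢
          by_cases h2 : b = v
          · subst h2
            rw [Function.update_self] at he
            have := h.rk_gt a ha (by omega)
            omega
          · rw [Function.update_of_ne h2] at he
            exact h.rk_eq a b hf he
      par_eq := by
        intro a b hf hlt
        obtain ⟨ha, hb, hab⟩ := hc.free_lt hs hf
        by_cases h1 : a = v
        · subst h1
          rw [Function.update_self, Function.update_of_ne (Ne.symm hab)] at hlt
          rw [Function.update_self]
          have hb0 : rk b = 0 := by
            by_contra h0
            have := h.rk_gt b hb (by omega)
            omega
          exact (hleaf b hb hb0 hf).symm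
        · rw [Function.update_of_ne h1] at hlt ⊢
          by_cases h2 : b = v
          · subst h2
            rw [Function.update_self] at hlt
            exact h.par_eq a _ hf (by omega)
          · rw [Function.update_of_ne h2] at hlt
            exact h.par_eq a b hf hlt
      par_root := by
        intro a ha hpos
        by_cases h1 : a = v
        · subst h1
          rw [Function.update_self, Function.update_self]
          rcases Nat.eq_zero_or_pos len with h0 | h0
          · left; rw [h0]; exact h.path_zero
          · right
            refine ⟨h.path_lt _ h0 (by omega), (h.path_free len h0 (by omega)).symm, ?_⟩
            rw [Function.update_of_ne (hne len h0 le_rfl), h.path_rk _ h0 (by omega)]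
            omega
        · rw [Function.update_of_ne h1] at hpos
          rw [Function.update_of_ne h1, Function.update_of_ne h1]
          rcases h.par_root a ha hpos with h2 | ⟨h2, h3, h4⟩
          · exact Or.inl h2
          · refine Or.inr ⟨h2, h3, ?_⟩
            by_cases h5 : par a = v
            · rw [h5, Function.update_self]
              exact (h.rk_gt a ha hpos).1
            · rwa [Function.update_of_ne h5]
      rk_gt := by
        intro a ha hpos
        by_cases h1 : a = v
        · subst h1
          rw [Function.update_self]
          omega
        · rw [Function.update_of_ne h1] at hpos ⊢
          have := h.rk_gt a ha hpos
          omega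
      par_top := by
        rw [Function.update_of_ne (by omega)]
        exact h.par_top
      cnt_eq := by
        have : ((Finset.range V).filter fun a => Function.update rk v cnt a = 0) =
            ((Finset.range V).filter fun a => rk a = 0).erase v := by
          ext a
          simp only [Finset.mem_filter, Finset.mem_range, Finset.mem_erase]
          by_cases h1 : a = v
          · subst h1; simp; omega
          · simp [h1]
        rw [this, Finset.card_erase_of_mem (by simp [hvV, hv0]), ← h.cnt_eq]
      path_zero := h.path_zero
      path_lt := fun r h1 h2 => h.path_lt r h1 (by omega)
      path_rk := fun r h1 h2 => by
        rw [Function.update_of_ne (hne r h1 h2)]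
        exact h.path_rk r h1 (by omega)
      path_inj := fun r s h1 h2 h3 => h.path_inj r s h1 h2 (by omega)
      path_free := fun r h1 h2 => h.path_free r h1 (by omega) }
  · unfold searchMeasure
    obtain ⟨c, rfl⟩ : ∃ c, cnt = c + 1 := ⟨cnt - 1, by omega⟩
    have : (V + 1) * (freeCount V y + (c + 1)) = (V + 1) * (freeCount V y + c) + (V + 1) := by
      ring
    rw [this]
    simp only [Nat.add_sub_cancel]
    omega

/-- The path is extended by an unprocessed vertex outside of it. -/
theorem SearchState.extend {V : ℕ} {y : ℕ → ℕ → K} {rk par P : ℕ → ℕ}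
    {len cnt b : ℕ} (h : SearchState V y rk par P len cnt) (hb : b < V) (hb0 : rk b = 0)
    (hfree : 1 ≤ len → Free y (P len) b) (hnew : ∀ r, 1 ≤ r → r ≤ len → P r ≠ b) :
    SearchState V y rk par (Function.update P (len + 1) b) (len + 1) cnt ∧
    searchMeasure V y (len + 1) cnt < searchMeasure V y len cnt := by
  have hst : SearchState V y rk par (Function.update P (len + 1) b) (len + 1) cnt := by
    exact {
      rk_eq := h.rk_eq
      par_eq := h.par_eq
      par_root := h.par_root
      rk_gt := h.rk_gt
      par_top := h.par_top
      cnt_eq := h.cnt_eq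
      path_zero := by rw [Function.update_of_ne (by omega)]; exact h.path_zero
      path_lt := by
        intro r h1 h2
        by_cases hr : r = len + 1
        · subst hr; simpa using hb
        · rw [Function.update_of_ne hr]; exact h.path_lt r h1 (by omega)
      path_rk := by
        intro r h1 h2
        by_cases hr : r = len + 1
        · subst hr; simpa using hb0
        · rw [Function.update_of_ne hr]; exact h.path_rk r h1 (by omega)
      path_inj := by
        intro r s h1 h2 h3
        rw [Function.update_of_ne (by omega : r ≠ len + 1)]
        by_cases hr : s = len + 1
        · subst hr; simpa using hnew r h1 (by omega)
        · rw [Function.update_of_ne hr]; exact h.path_inj r s h1 h2 (by omega)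
      path_free := by
        intro r h1 h2
        rw [Function.update_of_ne (by omega : r ≠ len + 1)]
        by_cases hr : r = len
        · subst hr; simpa using hfree h1
        · rw [Function.update_of_ne (by omega)]; exact h.path_free r h1 (by omega) }
  refine ⟨hst, ?_⟩
  have h1 := hst.len_le
  have h2 := h.cnt_le
  unfold searchMeasure
  omega

/-- The residual capacities after `c` has been pushed along the walk `P s, P (s + 1), …, P t`. -/
def pushed (y : ℕ → ℕ → K) (P : ℕ → ℕ) (c : K) (s t : ℕ) (a b : ℕ) : K :=
  y a b + c * (∑ q ∈ Finset.Ico s t, if P q = b ∧ P (q + 1) = a then 1 else 0) -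
    c * (∑ q ∈ Finset.Ico s t, if P q = a ∧ P (q + 1) = b then 1 else 0)

theorem pushed_self (y : ℕ → ℕ → K) (P : ℕ → ℕ) (c : K) (s : ℕ) : pushed y P c s s = y := by
  funext a b
  simp [pushed]

theorem pushed_succ (y : ℕ → ℕ → K) (P : ℕ → ℕ) (c : K) {s t : ℕ} (hst : s ≤ t) (a b : ℕ) :
    pushed y P c s (t + 1) a b = pushed y P c s t a b +
      (if P t = b ∧ P (t + 1) = a then c else 0) - (if P t = a ∧ P (t + 1) = b then c else 0) := by
  simp only [pushed, Finset.sum_Ico_succ_top hst, mul_add, mul_ite, mul_one, mul_zero]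
  ring

theorem pushed_pair (y : ℕ → ℕ → K) (P : ℕ → ℕ) (c : K) (s t a b : ℕ) :
    pushed y P c s t a b + pushed y P c s t b a = y a b + y b a := by
  simp only [pushed]
  ring

theorem pushed_mem {A : AddSubgroup K} {y : ℕ → ℕ → K} (hy : ∀ a b, y a b ∈ A) (P : ℕ → ℕ) {c : K}
    (hc : c ∈ A) (s t a b : ℕ) : pushed y P c s t a b ∈ A := by
  unfold pushed
  refine A.sub_mem (A.add_mem (hy a b) ?_) ?_ <;>
  · rw [Finset.mul_sum]
    refine A.sum_mem fun q _ => ?_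
    split_ifs
    · simpa
    · simp

theorem pushed_row (y : ℕ → ℕ → K) (P : ℕ → ℕ) (c : K) {V s t : ℕ} (hst : s ≤ t)
    (hP : ∀ q, s ≤ q → q ≤ t → P q < V) (hcl : P t = P s) (a : ℕ) :
    ∑ b ∈ Finset.range V, pushed y P c s t a b = ∑ b ∈ Finset.range V, y a b := by
  have h1 : ∑ b ∈ Finset.range V, (∑ q ∈ Finset.Ico s t,
      if P q = b ∧ P (q + 1) = a then (1 : K) else 0) =
      ∑ q ∈ Finset.Ico s t, if P (q + 1) = a then 1 else 0 := by
    rw [Finset.sum_comm]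
    refine Finset.sum_congr rfl fun q hq => ?_
    rw [Finset.mem_Ico] at hq
    rw [Finset.sum_eq_single (P q)]
    · simp
    · intro b _ hb
      rw [if_neg]
      rintro ⟨h, -⟩
      exact hb h.symm
    · intro h
      exact absurd (Finset.mem_range.mpr (hP q hq.1 hq.2.le)) h
  have h2 : ∑ b ∈ Finset.range V, (∑ q ∈ Finset.Ico s t,
      if P q = a ∧ P (q + 1) = b then (1 : K) else 0) =
      ∑ q ∈ Finset.Ico s t, if P q = a then 1 else 0 := by
    rw [Finset.sum_comm]
    refine Finset.sum_congr rfl fun q hq => ?_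
    rw [Finset.mem_Ico] at hq
    rw [Finset.sum_eq_single (P (q + 1))]
    · simp
    · intro b _ hb
      rw [if_neg]
      rintro ⟨-, h⟩
      exact hb h.symm
    · intro h
      exact absurd (Finset.mem_range.mpr (hP (q + 1) (by omega) (by omega))) h
  have h3 : (∑ q ∈ Finset.Ico s t, if P (q + 1) = a then (1 : K) else 0) =
      ∑ q ∈ Finset.Ico s t, if P q = a then 1 else 0 := by
    rw [← sub_eq_zero, ← Finset.sum_sub_distrib,
      Finset.sum_Ico_sub (fun q => if P q = a then (1 : K) else 0) hst, hcl, sub_self]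
  simp only [pushed, Finset.sum_sub_distrib, Finset.sum_add_distrib, ← Finset.mul_sum, h1, h2, h3]
  ring

/-- On a walk that leaves no vertex twice, at most the bottleneck capacity is pushed along each
pair. -/
theorem pushed_nonneg {y : ℕ → ℕ → K} {P : ℕ → ℕ} {c : K} {s t : ℕ} (hc : 0 ≤ c)
    (hy : ∀ a b, 0 ≤ y a b) (hle : ∀ q, s ≤ q → q < t → c ≤ y (P q) (P (q + 1)))
    (hinj : ∀ q r, s ≤ q → q < r → r < t → P q ≠ P r) (a b : ℕ) :
    0 ≤ pushed y P c s t a b := by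
  have h1 : 0 ≤ c * (∑ q ∈ Finset.Ico s t, if P q = b ∧ P (q + 1) = a then (1 : K) else 0) :=
    mul_nonneg hc (Finset.sum_nonneg fun q _ => by split_ifs <;> simp)
  suffices h2 : c * (∑ q ∈ Finset.Ico s t, if P q = a ∧ P (q + 1) = b then (1 : K) else 0) ≤
      y a b by
    unfold pushed
    linarith
  by_cases hex : ∃ q ∈ Finset.Ico s t, P q = a ∧ P (q + 1) = b
  · obtain ⟨q, hq, hqa, hqb⟩ := hex
    rw [Finset.mem_Ico] at hq
    rw [Finset.sum_eq_single q]
    · rw [if_pos ⟨hqa, hqb⟩, mul_one, ← hqa, ← hqb]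
      exact hle q hq.1 hq.2
    · intro r hr hrq
      rw [Finset.mem_Ico] at hr
      rw [if_neg]
      rintro ⟨h, -⟩
      rcases lt_or_gt_of_ne hrq with h3 | h3
      · exact hinj r q hr.1 h3 hq.2 (h.trans hqa.symm)
      · exact hinj q r hq.1 h3 hr.2 (hqa.trans h.symm)
    · intro h
      exact absurd (Finset.mem_Ico.mpr hq) h
  · push Not at hex
    rw [Finset.sum_eq_zero, mul_zero]
    · exact hy a b
    · intro q hq
      rw [if_neg]
      rintro ⟨h3, h4⟩
      exact hex q hq h3 h4

theorem freeCount_lt {V : ℕ} {y y' : ℕ → ℕ → K} (hsub : ∀ a b, Free y' a b → Free y a b)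
    {a b : ℕ} (ha : a < V) (hb : b < V) (h : Free y a b) (h' : ¬ Free y' a b) :
    freeCount V y' < freeCount V y := by
  classical
  unfold freeCount
  apply Finset.card_lt_card
  rw [Finset.ssubset_iff_of_subset]
  · exact ⟨(a, b), by simp [ha, hb, h], by simp [h']⟩
  · intro p hp
    rw [Finset.mem_filter] at hp ⊢
    exact ⟨hp.1, hsub _ _ hp.2⟩

/-- A cycle closed by the path is cancelled: pushing the bottleneck capacity around it makes one of
its pairs unfree, and makes no pair free. -/
theorem SearchState.rotate {V : ℕ} {A : AddSubgroup K} {y₀ y : ℕ → ℕ → K} {rk par P : ℕ → ℕ}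
    {len cnt s : ℕ} {c : K} (h : SearchState V y rk par P len cnt) (hc : Circulated V A y₀ y)
    (hs : Supported V y₀) (hs1 : 1 ≤ s) (hs2 : s ≤ len) (hcl : P (len + 1) = P s)
    (hfree : Free y (P len) (P (len + 1))) (hback : P (len + 1) ≠ P (len - 1))
    (hle : ∀ q, s ≤ q → q < len + 1 → c ≤ y (P q) (P (q + 1)))
    (heq : ∃ q, s ≤ q ∧ q < len + 1 ∧ c = y (P q) (P (q + 1))) :
    SearchState V (pushed y P c s (len + 1)) rk par P 0 cnt ∧
    Circulated V A y₀ (pushed y P c s (len + 1)) ∧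
    searchMeasure V (pushed y P c s (len + 1)) 0 cnt < searchMeasure V y len cnt := by
  have hfr : ∀ q, s ≤ q → q < len + 1 → Free y (P q) (P (q + 1)) := by
    intro q h1 h2
    by_cases hq : q = len
    · subst hq; exact hfree
    · exact h.path_free q (by omega) (by omega)
  have hrk : ∀ q, s ≤ q → q ≤ len + 1 → rk (P q) = 0 := by
    intro q h1 h2
    by_cases hq : q = len + 1
    · subst hq; rw [hcl]; exact h.path_rk s hs1 hs2
    · exact h.path_rk q (by omega) (by omega)
  have hinj : ∀ q r, s ≤ q → q < r → r < len + 1 → P q ≠ P r := fun q r h1 h2 h3 =>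
    h.path_inj q r (by omega) h2 (by omega)
  obtain ⟨q₀, hq1, hq2, hq3⟩ := heq
  have hcpos : 0 < c := hq3 ▸ (hfr q₀ hq1 hq2).1
  have hnn := pushed_nonneg hcpos.le hc.nonneg hle hinj
  have hcirc : Circulated V A y₀ (pushed y P c s (len + 1)) := by
    refine ⟨fun a b => pushed_mem hc.mem P (hq3 ▸ hc.mem _ _) _ _ a b, hnn, fun a b => ?_,
      fun a => ?_⟩
    · rw [pushed_pair, hc.pair]
    · rw [pushed_row y P c (by omega) ?_ hcl, hc.row]
      intro q h1 h2
      by_cases hq : q = len + 1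
      · subst hq; exact (hc.free_lt hs hfree).2.1
      · exact h.path_lt q (by omega) (by omega)
  -- A pair that is not traversed keeps its capacities.
  have hsame : ∀ a b, (∀ q, s ≤ q → q < len + 1 → ¬ (P q = a ∧ P (q + 1) = b)) →
      (∀ q, s ≤ q → q < len + 1 → ¬ (P q = b ∧ P (q + 1) = a)) →
      pushed y P c s (len + 1) a b = y a b := by
    intro a b h1 h2
    unfold pushed
    rw [Finset.sum_eq_zero, Finset.sum_eq_zero]
    · ring
    · intro q hq
      rw [Finset.mem_Ico] at hq
      exact if_neg (h1 q hq.1 hq.2)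
    · intro q hq
      rw [Finset.mem_Ico] at hq
      exact if_neg (h2 q hq.1 hq.2)
  have hsub : ∀ a b, Free (pushed y P c s (len + 1)) a b → Free y a b := by
    intro a b hf
    by_cases h1 : ∃ q, s ≤ q ∧ q < len + 1 ∧ P q = a ∧ P (q + 1) = b
    · obtain ⟨q, h2, h3, rfl, rfl⟩ := h1
      exact hfr q h2 h3
    by_cases h1' : ∃ q, s ≤ q ∧ q < len + 1 ∧ P q = b ∧ P (q + 1) = a
    · obtain ⟨q, h2, h3, rfl, rfl⟩ := h1'
      exact (hfr q h2 h3).symm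
    push Not at h1 h1'
    have e1 := hsame a b (fun q h2 h3 h4 => h1 q h2 h3 h4.1 h4.2)
      (fun q h2 h3 h4 => h1' q h2 h3 h4.1 h4.2)
    have e2 := hsame b a (fun q h2 h3 h4 => h1' q h2 h3 h4.1 h4.2)
      (fun q h2 h3 h4 => h1 q h2 h3 h4.1 h4.2)
    exact ⟨e1 ▸ hf.1, e2 ▸ hf.2⟩
  -- Pairs with a processed vertex are not touched.
  have hdead : ∀ a b, 0 < rk a → Free y a b → Free (pushed y P c s (len + 1)) a b := by
    intro a b ha hf
    have n1 : ∀ q, s ≤ q → q < len + 1 → ¬ (P q = a ∧ P (q + 1) = b) := by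
      rintro q h2 h3 ⟨rfl, -⟩
      exact ha.ne' (hrk q h2 h3.le)
    have n2 : ∀ q, s ≤ q → q < len + 1 → ¬ (P q = b ∧ P (q + 1) = a) := by
      rintro q h2 h3 ⟨-, rfl⟩
      exact ha.ne' (hrk (q + 1) (by omega) h3)
    exact ⟨(hsame a b n1 n2).symm ▸ hf.1, (hsame b a n2 n1).symm ▸ hf.2⟩
  -- The cycle is simple and has more than two vertices, so that the bottleneck pair is not traversed
  -- backwards, and its capacity vanishes.
  have hnot : ¬ Free (pushed y P c s (len + 1)) (P q₀) (P (q₀ + 1)) := by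
    rintro ⟨hf, -⟩
    have hrev : ∀ q ∈ Finset.Ico s (len + 1),
        ¬ (P q = P (q₀ + 1) ∧ P (q + 1) = P q₀) := by
      intro q hq
      rw [Finset.mem_Ico] at hq
      rintro ⟨h1, h2⟩
      have hidx : ∀ i j, s ≤ i → i < len + 1 → s ≤ j → j < len + 1 → P i = P j → i = j := by
        intro i j a1 a2 a3 a4 a5
        rcases lt_trichotomy i j with a6 | a6 | a6
        · exact absurd a5 (hinj i j a1 a6 a4)
        · exact a6
        · exact absurd a5.symm (hinj j i a3 a6 a2)
      have hne : P (len + 1) ≠ P len := fun e => (hc.free_lt hs hfree).2.2 e.symm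
      have hsl : s ≠ len := fun e => hne (e ▸ hcl)
      by_cases e0 : q₀ = len
      · subst e0
        rw [hcl] at h1
        have e1 := hidx q s hq.1 hq.2 le_rfl (by omega) h1
        subst e1
        have e2 := hidx (q + 1) q₀ (by omega) (by omega) (by omega) (by omega) h2
        apply hback
        rw [hcl, ← e2, Nat.add_sub_cancel]
      · have e1 := hidx q (q₀ + 1) hq.1 hq.2 (by omega) (by omega) h1
        subst e1
        by_cases e3 : q₀ + 1 = len
        · rw [show q₀ + 1 + 1 = len + 1 by omega, hcl] at h2
          apply hback
          rw [hcl, h2]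
          congr 1
          omega
        · have := hidx (q₀ + 1 + 1) q₀ (by omega) (by omega) (by omega) (by omega) h2
          omega
    have h0 : (∑ q ∈ Finset.Ico s (len + 1),
        if P q = P (q₀ + 1) ∧ P (q + 1) = P q₀ then (1 : K) else 0) = 0 :=
      Finset.sum_eq_zero fun q hq => if_neg (hrev q hq)
    have h1 : (1 : K) ≤ ∑ q ∈ Finset.Ico s (len + 1),
        if P q = P q₀ ∧ P (q + 1) = P (q₀ + 1) then (1 : K) else 0 := by
      have := Finset.single_le_sum (s := Finset.Ico s (len + 1))
        (f := fun q => if P q = P q₀ ∧ P (q + 1) = P (q₀ + 1) then (1 : K) else 0)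
        (fun q _ => by split_ifs <;> simp) (Finset.mem_Ico.mpr ⟨hq1, hq2⟩)
      simpa using this
    unfold pushed at hf
    rw [h0, ← hq3] at hf
    nlinarith
  refine ⟨?_, hcirc, ?_⟩
  · exact {
      rk_eq := fun a b hf => h.rk_eq a b (hsub a b hf)
      par_eq := fun a b hf => h.par_eq a b (hsub a b hf)
      par_root := fun a ha hpos => (h.par_root a ha hpos).imp_right fun ⟨h1, h2, h3⟩ =>
        ⟨h1, hdead a _ hpos h2, h3⟩
      rk_gt := h.rk_gt
      par_top := h.par_top
      cnt_eq := h.cnt_eq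
      path_zero := h.path_zero
      path_lt := fun r h1 h2 => by omega
      path_rk := fun r h1 h2 => by omega
      path_inj := fun r s h1 h2 h3 => by omega
      path_free := fun r h1 h2 => by omega }
  · have hq := hfr q₀ hq1 hq2
    have hV := hc.free_lt hs hq
    have hlt := freeCount_lt hsub hV.1 hV.2.1 hq hnot
    have h1 := h.len_le
    have h2 := h.cnt_le
    unfold searchMeasure
    have : (V + 1) * (freeCount V (pushed y P c s (len + 1)) + cnt + 1) ≤
        (V + 1) * (freeCount V y + cnt) := Nat.mul_le_mul_left _ (by omega)
    rw [mul_add, mul_one] at this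
    omega

/-- Every flow can be made acyclic by pushing a circulation. -/
theorem exists_isForest {V : ℕ} {y₀ : ℕ → ℕ → K} (hs : Supported V y₀)
    (hnn : ∀ a b, 0 ≤ y₀ a b) :
    ∃ y rk par, Circulated V ⊤ y₀ y ∧ IsForest V y rk par := by
  classical
  have key : ∀ n y rk par P len cnt, searchMeasure V y len cnt ≤ n → Circulated V ⊤ y₀ y →
      SearchState V y rk par P len cnt →
      ∃ y rk par, Circulated V ⊤ y₀ y ∧ IsForest V y rk par := by
    intro n
    induction n using Nat.strong_induction_on with
    | _ n ih =>
      intro y rk par P len cnt hn hc hst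
      rcases Nat.eq_zero_or_pos cnt with h0 | h0
      · subst h0
        exact ⟨y, rk, par, hc, hst.isForest hc hs⟩
      -- An unprocessed vertex `b` extends the path or closes a cycle; if there is none, the last
      -- vertex of the path is a leaf of the unprocessed part.
      by_cases hb : ∃ b < V, rk b = 0 ∧ (1 ≤ len → Free y (P len) b ∧ b ≠ P (len - 1))
      · obtain ⟨b, hbV, hb0, hbf⟩ := hb
        by_cases hnew : ∀ r, 1 ≤ r → r ≤ len → P r ≠ b
        · obtain ⟨h1, h2⟩ := hst.extend hbV hb0 (fun h => (hbf h).1) hnew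
          exact ih _ (by omega) _ _ _ _ _ _ le_rfl hc h1
        · push Not at hnew
          obtain ⟨s, hs1, hs2, hsb⟩ := hnew
          have hlen : 1 ≤ len := by omega
          set P' := Function.update P (len + 1) b with hP'
          have hPP : ∀ r, r ≤ len → P' r = P r := fun r hr => by
            rw [hP', Function.update_of_ne (by omega)]
          have hPb : P' (len + 1) = b := by rw [hP', Function.update_self]
          have hst' : SearchState V y rk par P' len cnt := hst.congr_path hPP
          obtain ⟨q, hq, hmin⟩ := Finset.exists_min_image (Finset.Ico s (len + 1))
            (fun q => y (P' q) (P' (q + 1))) ⟨s, by simp; omega⟩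
          rw [Finset.mem_Ico] at hq
          obtain ⟨h1, h2, h3⟩ := hst'.rotate hc hs hs1 hs2 (by rw [hPb, hPP s hs2, hsb])
            (by rw [hPb, hPP len le_rfl]; exact (hbf hlen).1)
            (by rw [hPb, hPP _ (by omega)]; exact (hbf hlen).2)
            (fun r h1 h2 => hmin r (Finset.mem_Ico.mpr ⟨h1, h2⟩)) ⟨q, hq.1, hq.2, rfl⟩
          exact ih _ (by omega) _ _ _ _ _ _ le_rfl h2 h1
      · push Not at hb
        rcases Nat.eq_zero_or_pos len with hl | hl
        · exfalso
          rw [hst.cnt_eq, gt_iff_lt, Finset.card_pos] at h0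
          obtain ⟨a, ha⟩ := h0
          rw [Finset.mem_filter, Finset.mem_range] at ha
          have := hb a ha.1 ha.2
          omega
        · obtain ⟨l, rfl⟩ : ∃ l, len = l + 1 := ⟨len - 1, by omega⟩
          obtain ⟨h1, h2⟩ := hst.peel hc hs (fun b h1 h2 h3 => (hb b h1 h2).2 h3)
          exact ih _ (by omega) _ _ _ _ _ _ le_rfl hc h1
  exact key _ y₀ (fun _ => 0) (fun _ => V) (fun _ => V) 0 V le_rfl
    ⟨fun _ _ => trivial, hnn, fun _ _ => rfl, fun _ => rfl⟩
    (SearchState.init V y₀ _ _ _ (fun _ => rfl) rfl rfl)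

end Forest

/-! ### Fractional assignments with an acyclic support -/

section Bipartite

set_option linter.unusedSectionVars false

variable {K : Type} [Field K] [LinearOrder K] [IsStrictOrderedRing K]

/-- The residual capacities of a fractional assignment `x` of `nJ` jobs to `m` machines, where at
most `u i` of a job can be assigned to the machine `i`. The job `j` is the vertex `j` and the
machine `i` is the vertex `nJ + i`; pushing flow from a job to a machine decreases `x`. -/
def residual {nJ m : ℕ} (inc : Fin nJ → Finset (Fin m)) (x : Fin m → Fin nJ → K) (u : Fin m → K)
    (a b : ℕ) : K :=
  if h : a < nJ ∧ nJ ≤ b ∧ b - nJ < m then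
    if ⟨b - nJ, h.2.2⟩ ∈ inc ⟨a, h.1⟩ then x ⟨b - nJ, h.2.2⟩ ⟨a, h.1⟩ else 0
  else if h : b < nJ ∧ nJ ≤ a ∧ a - nJ < m then
    if ⟨a - nJ, h.2.2⟩ ∈ inc ⟨b, h.1⟩ then u ⟨a - nJ, h.2.2⟩ - x ⟨a - nJ, h.2.2⟩ ⟨b, h.1⟩ else 0
  else 0

variable {nJ m : ℕ} {inc : Fin nJ → Finset (Fin m)} {x : Fin m → Fin nJ → K} {u : Fin m → K}

theorem residual_job (j : Fin nJ) (i : Fin m) :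
    residual inc x u j (nJ + i) = if i ∈ inc j then x i j else 0 := by
  have h : (j : ℕ) < nJ ∧ nJ ≤ nJ + (i : ℕ) ∧ nJ + (i : ℕ) - nJ < m :=
    ⟨j.2, by omega, by have := i.2; omega⟩
  rw [residual, dif_pos h]
  simp

theorem residual_mach (j : Fin nJ) (i : Fin m) :
    residual inc x u (nJ + i) j = if i ∈ inc j then u i - x i j else 0 := by
  have h : (j : ℕ) < nJ ∧ nJ ≤ nJ + (i : ℕ) ∧ nJ + (i : ℕ) - nJ < m :=
    ⟨j.2, by omega, by have := i.2; omega⟩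
  rw [residual, dif_neg (by omega), dif_pos h]
  simp

/-- Both entries of a pair vanish unless it consists of a job and a machine in its set. -/
theorem residual_cases (a b : ℕ) :
    (residual inc x u a b = 0 ∧ residual inc x u b a = 0) ∨
    (∃ j i, i ∈ inc j ∧ a = (j : Fin nJ) ∧ b = nJ + (i : Fin m)) ∨
    (∃ j i, i ∈ inc j ∧ b = (j : Fin nJ) ∧ a = nJ + (i : Fin m)) := by
  by_cases h1 : a < nJ ∧ nJ ≤ b ∧ b - nJ < m
  · obtain ⟨j, rfl⟩ : ∃ j : Fin nJ, a = j := ⟨⟨a, h1.1⟩, rfl⟩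
    obtain ⟨i, rfl⟩ : ∃ i : Fin m, b = nJ + i := ⟨⟨b - nJ, h1.2.2⟩, by simp; omega⟩
    by_cases hi : i ∈ inc j
    · exact Or.inr (Or.inl ⟨_, _, hi, rfl, rfl⟩)
    · left
      rw [residual_job, residual_mach, if_neg hi, if_neg hi]
      exact ⟨rfl, rfl⟩
  by_cases h2 : b < nJ ∧ nJ ≤ a ∧ a - nJ < m
  · obtain ⟨j, rfl⟩ : ∃ j : Fin nJ, b = j := ⟨⟨b, h2.1⟩, rfl⟩
    obtain ⟨i, rfl⟩ : ∃ i : Fin m, a = nJ + i := ⟨⟨a - nJ, h2.2.2⟩, by simp; omega⟩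
    by_cases hi : i ∈ inc j
    · exact Or.inr (Or.inr ⟨_, _, hi, rfl, rfl⟩)
    · left
      rw [residual_job, residual_mach, if_neg hi, if_neg hi]
      exact ⟨rfl, rfl⟩
  left
  simp only [residual]
  rw [dif_neg h1, dif_neg h2, dif_neg h2, dif_neg h1]
  exact ⟨rfl, rfl⟩

theorem residual_supported : Supported (nJ + m) (residual inc x u) := by
  intro a b h
  rcases residual_cases (inc := inc) (x := x) (u := u) a b with
    h1 | ⟨j, i, _, rfl, rfl⟩ | ⟨j, i, _, rfl, rfl⟩
  · exact h1
  · have := i.2; have := j.2; omega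
  · have := i.2; have := j.2; omega

theorem residual_nonneg (h : ∀ j, ∀ i ∈ inc j, 0 ≤ x i j ∧ x i j ≤ u i) (a b : ℕ) :
    0 ≤ residual inc x u a b := by
  rcases residual_cases (inc := inc) (x := x) (u := u) a b with
    h1 | ⟨j, i, hi, rfl, rfl⟩ | ⟨j, i, hi, rfl, rfl⟩
  · exact h1.1.ge
  · rw [residual_job, if_pos hi]; exact (h j i hi).1
  · rw [residual_mach, if_pos hi]; exact sub_nonneg.mpr (h j i hi).2

theorem sum_range_bipartite (f : ℕ → K) :
    ∑ b ∈ Finset.range (nJ + m), f b = ∑ j : Fin nJ, f (j : ℕ) + ∑ i : Fin m, f (nJ + i) := by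
  rw [Finset.sum_range_add, Finset.sum_range, Finset.sum_range]

theorem residual_job_job (j j' : Fin nJ) :
    residual inc x u j j' = 0 ∧ residual inc x u j' j = 0 := by
  rcases residual_cases (inc := inc) (x := x) (u := u) j j' with
    h | ⟨j₁, i, _, _, h⟩ | ⟨j₁, i, _, _, h⟩
  · exact h
  · have := j'.2; omega
  · have := j.2; omega

theorem residual_mach_mach (i i' : Fin m) :
    residual inc x u (nJ + i) (nJ + i') = 0 ∧ residual inc x u (nJ + i') (nJ + i) = 0 := by
  rcases residual_cases (inc := inc) (x := x) (u := u) (nJ + i) (nJ + i') with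
    h | ⟨j₁, i, _, h, _⟩ | ⟨j₁, i, _, h, _⟩
  · exact h
  · have := j₁.2; omega
  · have := j₁.2; omega

/-- `y` holds the residual capacities of a fractional assignment with the same total amounts of
the jobs and of the machines as `x`, whose free pairs form a forest. -/
structure AcyclicAssignment (inc : Fin nJ → Finset (Fin m)) (x : Fin m → Fin nJ → K)
    (u : Fin m → K) (y : ℕ → ℕ → K) (rk par : ℕ → ℕ) : Prop where
  nonneg : ∀ a b, 0 ≤ y a b
  range : ∀ a b, nJ + m ≤ b → y a b = 0
  pair : ∀ j, ∀ i ∈ inc j, y (j : Fin nJ) (nJ + (i : Fin m)) + y (nJ + (i : Fin m)) (j : Fin nJ) = u i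
  out : ∀ j i, i ∉ inc j → y (j : Fin nJ) (nJ + (i : Fin m)) = 0
  out' : ∀ j i, i ∉ inc j → y (nJ + (i : Fin m)) (j : Fin nJ) = 0
  row : ∀ j : Fin nJ, ∑ i : Fin m, y j (nJ + i) = ∑ i ∈ inc j, x i j
  col : ∀ i : Fin m, ∑ j : Fin nJ, y (j : ℕ) (nJ + i) = ∑ j with i ∈ inc j, x i j
  free : ∀ a b, Free y a b → (∃ j i, i ∈ inc j ∧ a = (j : Fin nJ) ∧ b = nJ + (i : Fin m)) ∨
    (∃ j i, i ∈ inc j ∧ b = (j : Fin nJ) ∧ a = nJ + (i : Fin m))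
  forest : IsForest (nJ + m) y rk par

theorem Circulated.acyclicAssignment {A : AddSubgroup K} {y : ℕ → ℕ → K} {rk par : ℕ → ℕ}
    (hc : Circulated (nJ + m) A (residual inc x u) y) (hf : IsForest (nJ + m) y rk par) :
    AcyclicAssignment inc x u y rk par := by
  have hpair : ∀ j, ∀ i ∈ inc j, y (j : Fin nJ) (nJ + (i : Fin m)) + y (nJ + i) j = u i := by
    intro j i hi
    rw [hc.pair, residual_job, residual_mach, if_pos hi, if_pos hi]
    ring
  have hout : ∀ j i, i ∉ inc j → y (j : Fin nJ) (nJ + (i : Fin m)) = 0 := fun j i hi =>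
    hc.eq_zero (by rw [residual_job, if_neg hi]) (by rw [residual_mach, if_neg hi])
  have hout' : ∀ j i, i ∉ inc j → y (nJ + (i : Fin m)) (j : Fin nJ) = 0 := fun j i hi =>
    hc.eq_zero (by rw [residual_mach, if_neg hi]) (by rw [residual_job, if_neg hi])
  have hcases : ∀ a b, (y a b = 0) ∨
      (∃ j i, i ∈ inc j ∧ a = (j : Fin nJ) ∧ b = nJ + (i : Fin m)) ∨
      (∃ j i, i ∈ inc j ∧ b = (j : Fin nJ) ∧ a = nJ + (i : Fin m)) := fun a b =>
    (residual_cases (inc := inc) (x := x) (u := u) a b).imp_left fun h => hc.eq_zero h.1 h.2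
  have hcol : ∀ (i : Fin m) (j : Fin nJ),
      y j (nJ + i) = (if i ∈ inc j then u i else 0) - y (nJ + i) j := by
    intro i j
    split_ifs with h
    · rw [← hpair j i h]; ring
    · rw [hout j i h, hout' j i h]; ring
  have hcol₀ : ∀ (i : Fin m) (j : Fin nJ), (if i ∈ inc j then x i j else 0) =
      (if i ∈ inc j then u i else 0) - residual inc x u (nJ + i) j := by
    intro i j
    rw [residual_mach]
    split_ifs <;> ring
  refine ⟨hc.nonneg, ?_, hpair, hout, hout', ?_, ?_, ?_, hf⟩
  · intro a b hb
    have := residual_supported (inc := inc) (x := x) (u := u) b a (Or.inl hb)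
    exact hc.eq_zero this.2 this.1
  · intro j
    have h1 := hc.row j
    rw [sum_range_bipartite, sum_range_bipartite] at h1
    rw [Finset.sum_eq_zero (f := fun j' : Fin nJ => y j j'),
      Finset.sum_eq_zero (f := fun j' : Fin nJ => residual inc x u j j'),
      zero_add, zero_add] at h1
    · rw [h1]
      simp only [residual_job]
      rw [Finset.sum_ite_mem, Finset.univ_inter]
    · intro j' _
      exact (residual_job_job j j').1
    · intro j' _
      exact hc.eq_zero (residual_job_job j j').1 (residual_job_job j j').2
  · intro i
    have h1 := hc.row (nJ + i)
    rw [sum_range_bipartite, sum_range_bipartite] at h1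
    rw [Finset.sum_eq_zero (f := fun i' : Fin m => y (nJ + i) (nJ + i')),
      Finset.sum_eq_zero (f := fun i' : Fin m => residual inc x u (nJ + i) (nJ + i')),
      add_zero, add_zero] at h1
    · rw [Finset.sum_congr rfl fun j _ => hcol i j, Finset.sum_filter,
        Finset.sum_congr rfl fun j _ => hcol₀ i j, Finset.sum_sub_distrib, Finset.sum_sub_distrib,
        h1]
    · intro i' _
      exact (residual_mach_mach i i').1
    · intro i' _
      exact hc.eq_zero (residual_mach_mach i i').1 (residual_mach_mach i i').2
  · intro a b h
    exact (hcases a b).resolve_left h.1.ne'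

end Bipartite

/-! ### Heavy jobs: clusters of the forest -/

section Clusters

variable {K : Type} [Field K] [LinearOrder K]

/-- A vertex is linked if more than one half of it is assigned to its parent. -/
def Linked (y : ℕ → ℕ → K) (par : ℕ → ℕ) (j : ℕ) : Prop := 1 / 2 < y j (par j)

open Classical in
/-- The next job on the way to the root of a cluster: the parent of the parent machine of a linked
job. -/
def nextJob (y : ℕ → ℕ → K) (par : ℕ → ℕ) (j : ℕ) : ℕ :=
  if Linked y par j then par (par j) else j

/-- The top of the cluster of a job; it is the sentinel `V` if the cluster contains a root of the
forest that is a machine. -/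
def clusterTop (V : ℕ) (y : ℕ → ℕ → K) (par : ℕ → ℕ) (j : ℕ) : ℕ := (nextJob y par)^[V] j

/-- A machine is claimed if it is the parent of a linked job. -/
def Claimed (nJ : ℕ) (y : ℕ → ℕ → K) (par : ℕ → ℕ) (v : ℕ) : Prop :=
  ∃ c < nJ, Linked y par c ∧ par c = v

/-- The machines of the canonical heavy jobs: a linked job is tied to its parent machine, and the
top of a cluster can use all unclaimed machines hanging below the cluster, if they satisfy
`big`. -/
def HeavyMem (nJ V : ℕ) (y : ℕ → ℕ → K) (par : ℕ → ℕ) (big : ℕ → Prop) (j i : ℕ) : Prop :=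
  (Linked y par j ∧ par j = nJ + i) ∨
    (¬ Linked y par j ∧ ¬ Claimed nJ y par (nJ + i) ∧ clusterTop V y par (par (nJ + i)) = j ∧
      big i)

end Clusters

section Heavy

variable {nJ m : ℕ} {inc : Fin nJ → Finset (Fin m)} {x : Fin m → Fin nJ → ℝ} {u : Fin m → ℝ}
  {y : ℕ → ℕ → ℝ} {rk par : ℕ → ℕ}

theorem AcyclicAssignment.linked (h : AcyclicAssignment inc x u y rk par) {j : Fin nJ}
    (hl : Linked y par j) :
    ∃ i : Fin m, par j = nJ + i ∧ i ∈ inc j ∧ Free y j (nJ + i) ∧ rk (par j) < rk j := by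
  have hj := j.2
  unfold Linked at hl
  rcases h.forest.par_root j (by omega) with h1 | ⟨h1, h2, h3⟩
  · rw [h1, h.range _ _ le_rfl] at hl
    norm_num at hl
  · rcases h.free _ _ h2 with ⟨j', i, h4, h5, h6⟩ | ⟨j', i, h4, h5, h6⟩
    · obtain rfl : j = j' := Fin.ext h5
      exact ⟨i, h6, h4, h6 ▸ h2, h3⟩
    · omega

theorem AcyclicAssignment.par_mach (h : AcyclicAssignment inc x u y rk par) (i : Fin m) :
    par (nJ + i) = nJ + m ∨ ∃ j : Fin nJ, par (nJ + i) = j ∧ i ∈ inc j ∧ Free y j (nJ + i) ∧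
      rk j < rk (nJ + i) := by
  have hi := i.2
  rcases h.forest.par_root (nJ + i) (by omega) with h1 | ⟨h1, h2, h3⟩
  · exact Or.inl h1
  · right
    rcases h.free _ _ h2 with ⟨j, i', h4, h5, h6⟩ | ⟨j, i', h4, h5, h6⟩
    · have := j.2; omega
    · obtain rfl : i = i' := Fin.ext (by omega)
      exact ⟨j, h5, h4, h5 ▸ h2.symm, h5 ▸ h3⟩

/-- Every pair with a positive value is an edge from a job to its parent or from a machine to its
parent. -/
theorem AcyclicAssignment.edge (h : AcyclicAssignment inc x u y rk par) {j : ℕ} {i : ℕ}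
    (hf : Free y j i) : par j = i ∨ par i = j := by
  rcases lt_or_gt_of_ne (h.forest.rk_ne _ _ hf) with h1 | h1
  · exact Or.inr (h.forest.par_eq _ _ hf.symm h1)
  · exact Or.inl (h.forest.par_eq _ _ hf h1)

theorem AcyclicAssignment.not_linked_top (h : AcyclicAssignment inc x u y rk par) :
    ¬ Linked y par (nJ + m) := by
  unfold Linked
  rw [h.forest.par_top, h.range _ _ le_rfl]
  norm_num

theorem nextJob_of_not_linked {j : ℕ} (hl : ¬ Linked y par j) : nextJob y par j = j := by
  rw [nextJob, if_neg hl]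

theorem nextJob_of_linked {j : ℕ} (hl : Linked y par j) : nextJob y par j = par (par j) := by
  rw [nextJob, if_pos hl]

theorem clusterTop_of_not_linked {V j : ℕ} (hl : ¬ Linked y par j) : clusterTop V y par j = j :=
  Function.iterate_fixed (nextJob_of_not_linked hl) V

theorem AcyclicAssignment.nextJob_cases (h : AcyclicAssignment inc x u y rk par) {j : Fin nJ}
    (hl : Linked y par j) : nextJob y par j = nJ + m ∨
      ∃ j' : Fin nJ, nextJob y par j = j' ∧ rk j' < rk j := by
  obtain ⟨i, h1, -, -, h2⟩ := h.linked hl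
  rw [nextJob_of_linked hl]
  rw [h1] at h2 ⊢
  rcases h.par_mach i with h3 | ⟨j', h3, -, -, h4⟩
  · exact Or.inl h3
  · exact Or.inr ⟨j', h3, by omega⟩

theorem AcyclicAssignment.iterate_spec (h : AcyclicAssignment inc x u y rk par) (n : ℕ) :
    ∀ j : Fin nJ, rk j ≤ n → (nextJob y par)^[n] j = nJ + m ∨
      ∃ t : Fin nJ, (nextJob y par)^[n] j = t ∧ ¬ Linked y par t := by
  induction n with
  | zero =>
    intro j hj
    refine Or.inr ⟨j, rfl, fun hl => ?_⟩
    obtain ⟨i, -, -, -, h2⟩ := h.linked hl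
    omega
  | succ n ih =>
    intro j hj
    by_cases hl : Linked y par j
    · rw [Function.iterate_succ_apply]
      rcases h.nextJob_cases hl with h1 | ⟨j', h1, h2⟩
      · left
        rw [h1]
        exact Function.iterate_fixed (nextJob_of_not_linked h.not_linked_top) n
      · rw [h1]
        exact ih j' (by omega)
    · exact Or.inr ⟨j, Function.iterate_fixed (nextJob_of_not_linked hl) _, hl⟩

theorem AcyclicAssignment.clusterTop_cases (h : AcyclicAssignment inc x u y rk par) (j : Fin nJ) :
    clusterTop (nJ + m) y par j = nJ + m ∨
      ∃ t : Fin nJ, clusterTop (nJ + m) y par j = t ∧ ¬ Linked y par t :=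
  h.iterate_spec _ j (h.forest.rk_le _ (by have := j.2; omega))

theorem AcyclicAssignment.clusterTop_nextJob (h : AcyclicAssignment inc x u y rk par)
    (j : Fin nJ) : clusterTop (nJ + m) y par (nextJob y par j) = clusterTop (nJ + m) y par j := by
  have hfix : nextJob y par (clusterTop (nJ + m) y par j) = clusterTop (nJ + m) y par j := by
    rcases h.clusterTop_cases j with h1 | ⟨t, h1, h2⟩
    · rw [h1, nextJob_of_not_linked h.not_linked_top]
    · rw [h1, nextJob_of_not_linked h2]
  rw [clusterTop, ← Function.iterate_succ_apply, Function.iterate_succ_apply']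
  exact hfix

/-- No machine is the parent of two linked jobs. -/
theorem AcyclicAssignment.linked_inj (h : AcyclicAssignment inc x u y rk par) {z : Fin m → ℝ}
    (hz : ∀ i : Fin m, ∑ j : Fin nJ, y (j : ℕ) (nJ + i) = z i) (hz1 : ∀ i, z i ≤ 1) {j j' : Fin nJ}
    (hl : Linked y par j) (hl' : Linked y par j') (he : par j = par j') : j = j' := by
  by_contra hne
  obtain ⟨i, h1, -, -, -⟩ := h.linked hl
  have h2 : y j (nJ + i) + y j' (nJ + i) ≤ ∑ j : Fin nJ, y (j : ℕ) (nJ + i) := by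
    rw [← Finset.sum_pair (f := fun j : Fin nJ => y j (nJ + i)) hne]
    exact Finset.sum_le_sum_of_subset_of_nonneg (Finset.subset_univ _)
      fun _ _ _ => h.nonneg _ _
  have h3 := hz1 i
  unfold Linked at hl hl'
  rw [← he, h1] at hl'
  rw [h1] at hl
  rw [hz] at h2
  linarith

open Classical in
/-- The machines below a cluster with top `j` receive at least one half of a job in total: the
cluster has one claimed machine less than it has jobs, and each of them carries at most one job. -/
theorem AcyclicAssignment.half_le_sum (h : AcyclicAssignment inc x u y rk par) {z : Fin m → ℝ}
    (hz : ∀ i : Fin m, ∑ j : Fin nJ, y (j : ℕ) (nJ + i) = z i) (hz1 : ∀ i, z i ≤ 1)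
    (hrow : ∀ j : Fin nJ, ∑ i : Fin m, y j (nJ + i) = 1)
    (hfree : ∀ (j : Fin nJ) (i : Fin m), 0 < y j (nJ + i) → Free y j (nJ + i)) {t : Fin nJ}
    (ht : ¬ Linked y par t) :
    1 / 2 ≤ ∑ i : Fin m, if ¬ Claimed nJ y par (nJ + i) ∧
      clusterTop (nJ + m) y par (par (nJ + i)) = t then z i else 0 := by
  set top := clusterTop (nJ + m) y par with htop
  set A : Finset (Fin nJ) := Finset.univ.filter fun a : Fin nJ => top a = t with hA
  set B : Finset (Fin nJ) := A.filter fun a : Fin nJ => Linked y par a with hB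
  have htA : t ∈ A := by simp [hA, htop, clusterTop_of_not_linked ht]
  have hAt : ∀ a ∈ A, ¬ Linked y par a → a = t := by
    intro a ha hl
    simp only [hA, Finset.mem_filter, Finset.mem_univ, true_and, htop,
      clusterTop_of_not_linked hl] at ha
    exact Fin.ext ha
  have hAB : A = insert t B := by
    ext a
    simp only [hB, Finset.mem_insert, Finset.mem_filter]
    constructor
    · intro ha
      by_cases hl : Linked y par a
      · exact Or.inr ⟨ha, hl⟩
      · exact Or.inl (hAt a ha hl)
    · rintro (rfl | ha)
      · exact htA
      · exact ha.1
  have htB : t ∉ B := by simp [hB, ht]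
  have hcard : (A.card : ℝ) = B.card + 1 := by
    rw [hAB, Finset.card_insert_of_notMem htB]
    push_cast
    ring
  have hzz : ∀ i, 0 ≤ z i := fun i => hz i ▸ Finset.sum_nonneg fun _ _ => h.nonneg _ _
  -- `up a i` and `down a i` are the parts of the assignment along parent edges of jobs and of
  -- machines.
  set up : Fin nJ → Fin m → ℝ := fun a i => if par a = nJ + i then y a (nJ + i) else 0 with hup
  set down : Fin nJ → Fin m → ℝ := fun a i => if par (nJ + i) = a then y a (nJ + i) else 0
    with hdown
  have hup0 : ∀ a i, 0 ≤ up a i := fun a i => by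
    simp only [hup]; split_ifs <;> simp [h.nonneg]
  have hdown0 : ∀ a i, 0 ≤ down a i := fun a i => by
    simp only [hdown]; split_ifs <;> simp [h.nonneg]
  have hnot : ∀ (a : Fin nJ) (i : Fin m), par a = nJ + i → par (nJ + i) = a → False := by
    intro a i h1 h2
    have ha := a.2
    have hi := i.2
    rcases h.forest.par_root a (by omega) with h3 | ⟨-, -, h3⟩
    · omega
    · rcases h.par_mach i with h4 | ⟨j, h4, -, -, h5⟩
      · omega
      · rw [h1] at h3; rw [← h4, h2] at h5; omega
  have hud : ∀ a i, up a i + down a i ≤ y a (nJ + i) := by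
    intro a i
    have h0 := h.nonneg a (nJ + i)
    simp only [hup, hdown]
    split_ifs with h1 h2
    · exact absurd h2 (hnot a i h1)
    all_goals linarith
  have hedge : ∀ (a : Fin nJ) (i : Fin m), y a (nJ + i) ≤ up a i + down a i := by
    intro a i
    rcases (h.nonneg a (nJ + i)).eq_or_lt with h0 | h0
    · rw [← h0]
      exact add_nonneg (hup0 a i) (hdown0 a i)
    · rcases h.edge (hfree a i h0) with h1 | h1
      · have : up a i = y a (nJ + i) := if_pos h1
        linarith [hdown0 a i]
      · have : down a i = y a (nJ + i) := if_pos h1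
        linarith [hup0 a i]
  -- Both sides of the estimate count the total assignment of the jobs of the cluster.
  have h1 : (A.card : ℝ) ≤ ∑ a ∈ A, ∑ i, up a i + ∑ a ∈ A, ∑ i, down a i := by
    rw [← Finset.sum_add_distrib, Finset.card_eq_sum_ones, Nat.cast_sum]
    refine Finset.sum_le_sum fun a _ => ?_
    rw [← Finset.sum_add_distrib, Nat.cast_one, ← hrow a]
    exact Finset.sum_le_sum fun i _ => hedge a i
  have h2 : ∑ a ∈ A, ∑ i, up a i = ∑ i, up t i + ∑ a ∈ B, ∑ i, up a i := by
    rw [hAB, Finset.sum_insert htB]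
  -- The top is not linked, so at most one half of it goes to its parent.
  have h3 : ∑ i, up t i ≤ 1 / 2 := by
    by_cases hex : ∃ i : Fin m, par t = nJ + i
    · obtain ⟨i, hi⟩ := hex
      rw [Finset.sum_eq_single i]
      · simp only [hup]
        rw [if_pos hi, ← hi]
        exact not_lt.mp ht
      · intro i' _ hne
        simp only [hup]
        rw [if_neg]
        intro he
        exact hne (Fin.ext (by omega))
      · simp
    · push Not at hex
      rw [Finset.sum_eq_zero]
      · norm_num
      · intro i _
        simp only [hup]
        rw [if_neg (hex i)]
  -- A machine claimed from inside of the cluster carries at most one job, and an unclaimed machine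
  -- `i` below the cluster at most `z i`; all other machines carry nothing.
  have h4 : ∀ i, ∑ a ∈ B, up a i + ∑ a ∈ A, down a i ≤
      (∑ a ∈ B, if par a = nJ + i then (1 : ℝ) else 0) +
        if ¬ Claimed nJ y par (nJ + i) ∧ top (par (nJ + i)) = t then z i else 0 := by
    intro i
    have hall : ∑ a ∈ B, up a i + ∑ a ∈ A, down a i ≤ z i := by
      rw [← hz i]
      refine le_trans ?_ (Finset.sum_le_sum fun a _ => hud a i)
      rw [Finset.sum_add_distrib]
      exact add_le_add
        (Finset.sum_le_sum_of_subset_of_nonneg (Finset.subset_univ _) fun a _ _ => hup0 a i)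
        (Finset.sum_le_sum_of_subset_of_nonneg (Finset.subset_univ _) fun a _ _ => hdown0 a i)
    have hind : ∀ a ∈ B, (0 : ℝ) ≤ if par a = nJ + i then (1 : ℝ) else 0 := fun a _ => by
      split_ifs <;> simp
    by_cases hcl : Claimed nJ y par (nJ + i)
    · rw [if_neg (fun hh => hh.1 hcl), add_zero]
      obtain ⟨c, hc, hl, hpc⟩ := hcl
      by_cases hcB : (⟨c, hc⟩ : Fin nJ) ∈ B
      · refine (hall.trans (hz1 i)).trans ?_
        have := Finset.single_le_sum hind hcB
        simpa [hpc] using this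
      · -- The job linked to the machine lies outside of the cluster, so the whole machine does.
        have hcA : (⟨c, hc⟩ : Fin nJ) ∉ A := fun hh => hcB (by simp [hB, hh, hl])
        have e1 : ∑ a ∈ B, up a i = 0 := by
          refine Finset.sum_eq_zero fun a ha => if_neg fun he => ?_
          have hla : Linked y par a := (Finset.mem_filter.mp ha).2
          have := h.linked_inj hz hz1 hla (j' := ⟨c, hc⟩) hl (he.trans hpc.symm)
          exact hcB (this ▸ ha)
        have e2 : ∑ a ∈ A, down a i = 0 := by
          refine Finset.sum_eq_zero fun a ha => if_neg fun he => hcA ?_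
          have h7 := h.clusterTop_nextJob ⟨c, hc⟩
          rw [nextJob_of_linked hl] at h7
          simp only [hpc, he] at h7
          simp only [hA, Finset.mem_filter, Finset.mem_univ, true_and] at ha ⊢
          rw [htop, ← h7]
          exact ha
        rw [e1, e2, add_zero]
        exact Finset.sum_nonneg hind
    · by_cases htp : top (par (nJ + i)) = t
      · rw [if_pos ⟨hcl, htp⟩]
        linarith [Finset.sum_nonneg hind]
      · rw [if_neg fun hh => htp hh.2, add_zero]
        have e1 : ∑ a ∈ B, up a i = 0 := by
          refine Finset.sum_eq_zero fun a ha => if_neg fun he => hcl ?_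
          exact ⟨a, a.2, (Finset.mem_filter.mp ha).2, he⟩
        have e2 : ∑ a ∈ A, down a i = 0 := by
          refine Finset.sum_eq_zero fun a ha => if_neg fun he => htp ?_
          rw [he]
          exact (Finset.mem_filter.mp ha).2
        rw [e1, e2, add_zero]
        exact Finset.sum_nonneg hind
  have h5 : ∑ i : Fin m, (∑ a ∈ B, if par a = nJ + i then (1 : ℝ) else 0) ≤ B.card := by
    rw [Finset.sum_comm, Finset.card_eq_sum_ones, Nat.cast_sum]
    refine Finset.sum_le_sum fun a ha => ?_
    obtain ⟨i, hi, -⟩ := h.linked (Finset.mem_filter.mp ha).2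
    rw [Finset.sum_eq_single i]
    · simp [hi]
    · intro i' _ hne
      rw [if_neg]
      intro he
      exact hne (Fin.ext (by omega))
    · simp
  have h6 := Finset.sum_le_sum fun i (_ : i ∈ Finset.univ) => h4 i
  rw [Finset.sum_add_distrib, Finset.sum_add_distrib, Finset.sum_comm (t := B),
    Finset.sum_comm (t := A)] at h6
  linarith

/-- The jobs of the cluster with top `t` between `a` and `t` are shifted by one: this frees a
place for the machine of `t` at the job `a`. -/
theorem AcyclicAssignment.exists_shift (h : AcyclicAssignment inc x u y rk par)
    {f : Fin nJ → Fin m} (hf : ∀ j : Fin nJ, Linked y par j → par j = nJ + f j) {t : Fin nJ}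
    (ht : ¬ Linked y par t) (n : ℕ) :
    ∀ a : Fin nJ, rk a ≤ n → clusterTop (nJ + m) y par a = t →
      ∃ π : Equiv.Perm (Fin nJ),
        (∀ j : Fin nJ, clusterTop (nJ + m) y par (π j) = clusterTop (nJ + m) y par j) ∧
        (∀ j : Fin nJ, clusterTop (nJ + m) y par j = t → j ≠ a → f (π j) ∈ inc j) ∧
        π a = t ∧ ∀ j : Fin nJ, rk a < rk j → π j = j := by
  have hmem : ∀ j : Fin nJ, Linked y par j → f j ∈ inc j := by
    intro j hl
    obtain ⟨i, h1, h2, -⟩ := h.linked hl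
    have := hf j hl
    obtain rfl : i = f j := Fin.ext (by omega)
    exact h2
  induction n with
  | zero =>
    intro a ha hat
    have hal : ¬ Linked y par a := by
      intro hl
      obtain ⟨i, -, -, -, h2⟩ := h.linked hl
      omega
    rw [clusterTop_of_not_linked hal] at hat
    obtain rfl : a = t := Fin.ext hat
    refine ⟨1, fun _ => rfl, fun j hj hne => hmem j ?_, rfl, fun _ _ => rfl⟩
    by_contra hl
    rw [clusterTop_of_not_linked hl] at hj
    exact hne (Fin.ext hj)
  | succ n ih =>
    intro a ha hat
    by_cases hal : Linked y par a
    · have htop := h.clusterTop_nextJob a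
      rcases h.nextJob_cases hal with h1 | ⟨a', h1, h2⟩
      · rw [h1, clusterTop_of_not_linked h.not_linked_top, hat] at htop
        have := t.2
        omega
      · rw [h1] at htop
        obtain ⟨π, p1, p2, p3, p4⟩ := ih a' (by omega) (htop.trans hat)
        have hne : a ≠ a' := by rintro rfl; omega
        have hpa : par (nJ + f a) = a' := by
          rw [← hf a hal, ← nextJob_of_linked hal, h1]
        have hfa : f a ∈ inc a' := by
          rcases h.par_mach (f a) with h3 | ⟨j, h3, h4, -⟩
          · have := a'.2; omega
          · obtain rfl : a' = j := Fin.ext (by omega)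
            exact h4
        -- The next job `a'` takes the parent machine of `a`, and `a` the place of `a'`.
        refine ⟨(Equiv.swap a a').trans π, fun j => ?_, fun j hj hja => ?_, ?_, fun j hj => ?_⟩
        · rw [Equiv.trans_apply, p1]
          rcases eq_or_ne j a with rfl | hja
          · rw [Equiv.swap_apply_left, htop]
          rcases eq_or_ne j a' with rfl | hja'
          · rw [Equiv.swap_apply_right, htop]
          · rw [Equiv.swap_apply_of_ne_of_ne hja hja']
        · rw [Equiv.trans_apply]
          rcases eq_or_ne j a' with rfl | hja'
          · rw [Equiv.swap_apply_right, p4 a h2]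
            exact hfa
          · rw [Equiv.swap_apply_of_ne_of_ne hja hja']
            exact p2 j hj hja'
        · rw [Equiv.trans_apply, Equiv.swap_apply_left, p3]
        · rw [Equiv.trans_apply, Equiv.swap_apply_of_ne_of_ne, p4 j (by omega)]
          · rintro rfl; omega
          · rintro rfl; omega
    · rw [clusterTop_of_not_linked hal] at hat
      obtain rfl : a = t := Fin.ext hat
      refine ⟨1, fun _ => rfl, fun j hj hne => hmem j ?_, rfl, fun _ _ => rfl⟩
      by_contra hl
      rw [clusterTop_of_not_linked hl] at hj
      exact hne (Fin.ext hj)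

/-- An assignment of the canonical heavy jobs can be turned into an assignment of the original
heavy jobs that uses the same machines. -/
theorem AcyclicAssignment.exists_rearrangement (h : AcyclicAssignment inc x u y rk par)
    {big : ℕ → Prop} {f : Fin nJ → Fin m}
    (hf : ∀ j : Fin nJ, HeavyMem nJ (nJ + m) y par big j (f j)) :
    ∃ σ : Fin nJ → Fin nJ, Function.Bijective σ ∧ ∀ j, f (σ j) ∈ inc j := by
  have hfl : ∀ j : Fin nJ, Linked y par j → par j = nJ + f j := by
    intro j hl
    rcases hf j with h1 | h1
    · exact h1.2
    · exact absurd hl h1.1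
  have key : ∀ t : Fin nJ, ∃ π : Equiv.Perm (Fin nJ),
      (∀ j : Fin nJ, clusterTop (nJ + m) y par (π j) = clusterTop (nJ + m) y par j) ∧
      (∀ j : Fin nJ, clusterTop (nJ + m) y par j = t → f (π j) ∈ inc j) := by
    intro t
    by_cases ht : Linked y par t
    · refine ⟨1, fun _ => rfl, fun j hj => ?_⟩
      rcases h.clusterTop_cases j with h1 | ⟨t', h1, h2⟩
      · have := t.2; omega
      · exact absurd ht (by rwa [← hj, h1])
    · rcases hf t with h1 | ⟨-, -, h1, -⟩
      · exact absurd h1.1 ht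
      · rcases h.par_mach (f t) with h2 | ⟨a, h2, h3, -⟩
        · rw [h2, clusterTop_of_not_linked h.not_linked_top] at h1
          have := t.2; omega
        · rw [h2] at h1
          obtain ⟨π, p1, p2, p3, -⟩ := h.exists_shift hfl ht _ a le_rfl h1
          refine ⟨π, p1, fun j hj => ?_⟩
          rcases eq_or_ne j a with rfl | hja
          · rw [p3]; exact h3
          · exact p2 j hj hja
  choose π p1 p2 using key
  set σ : Fin nJ → Fin nJ := fun j =>
    if hj : clusterTop (nJ + m) y par j < nJ then π ⟨_, hj⟩ j else j with hσ
  have hσ1 : ∀ j, ∀ hj : clusterTop (nJ + m) y par (j : Fin nJ) < nJ, σ j = π ⟨_, hj⟩ j :=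
    fun j hj => dif_pos hj
  have hσ2 : ∀ j, ¬ clusterTop (nJ + m) y par (j : Fin nJ) < nJ → σ j = j := fun j hj => dif_neg hj
  have hσt : ∀ j, clusterTop (nJ + m) y par (σ j) = clusterTop (nJ + m) y par j := by
    intro j
    by_cases hj : clusterTop (nJ + m) y par j < nJ
    · rw [hσ1 j hj, p1]
    · rw [hσ2 j hj]
  refine ⟨σ, Finite.injective_iff_bijective.mp fun j j' hjj => ?_, fun j => ?_⟩
  · have ht : clusterTop (nJ + m) y par j = clusterTop (nJ + m) y par j' := by
      rw [← hσt j, hjj, hσt j']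
    by_cases hj : clusterTop (nJ + m) y par j < nJ
    · rw [hσ1 j hj, hσ1 j' (ht ▸ hj)] at hjj
      simp only [ht] at hjj
      exact (π _).injective hjj
    · rwa [hσ2 j hj, hσ2 j' (ht ▸ hj)] at hjj
  · by_cases hj : clusterTop (nJ + m) y par j < nJ
    · rw [hσ1 j hj]
      exact p2 _ j rfl
    · rw [hσ2 j hj]
      have hl : Linked y par j := by
        by_contra hl
        exact hj (by rw [clusterTop_of_not_linked hl]; exact j.2)
      obtain ⟨i, h1, h2, -⟩ := h.linked hl
      have := hfl j hl
      obtain rfl : i = f j := Fin.ext (by omega)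
      exact h2

end Heavy

/-! ### Light jobs: types and rounding -/

/-- A fractional assignment can be rounded so that every machine gets at most one additional
job. This is Hall's theorem for the jobs and the slots of the machines. -/
theorem exists_rounding {J : Type} [Fintype J] {m : ℕ} (p : J → Fin m → ℝ)
    (hp : ∀ j i, 0 ≤ p j i) (hsum : ∀ j, ∑ i, p j i = 1) :
    ∃ g : J → Fin m, (∀ j, 0 < p j (g j)) ∧
      ∀ i, (∑ j, if g j = i then (1 : ℝ) else 0) ≤ ∑ j, p j i + 1 := by
  classical
  -- Every machine has as many slots as its fractional load, rounded up.
  set c : Fin m → ℕ := fun i => ⌈∑ j, p j i⌉₊ with hc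
  set N : J → Finset (Σ i, Fin (c i)) := fun j => Finset.univ.filter fun v => 0 < p j v.1 with hN
  have hall : ∀ s : Finset J, s.card ≤ (s.biUnion N).card := by
    intro s
    set M : Finset (Fin m) := Finset.univ.filter fun i => ∃ j ∈ s, 0 < p j i with hM
    have h1 : s.biUnion N = M.sigma fun _ => Finset.univ := by
      ext v
      simp [hN, hM]
    rw [h1, Finset.card_sigma]
    simp only [Finset.card_univ, Fintype.card_fin]
    have h2 : (s.card : ℝ) ≤ ((∑ i ∈ M, c i : ℕ) : ℝ) := by
      push_cast
      calc (s.card : ℝ) = ∑ j ∈ s, ∑ i, p j i := by simp [hsum]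
        _ = ∑ i, ∑ j ∈ s, p j i := Finset.sum_comm
        _ = ∑ i ∈ M, ∑ j ∈ s, p j i := by
            symm
            apply Finset.sum_subset (Finset.subset_univ _)
            intro i _ hi
            simp only [hM, Finset.mem_filter, Finset.mem_univ, true_and, not_exists, not_and,
              not_lt] at hi
            exact Finset.sum_eq_zero fun j hj => le_antisymm (hi j hj) (hp j i)
        _ ≤ ∑ i ∈ M, (c i : ℝ) := by
            refine Finset.sum_le_sum fun i _ => le_trans ?_ (Nat.le_ceil _)
            exact Finset.sum_le_sum_of_subset_of_nonneg (Finset.subset_univ _) fun j _ _ => hp j i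
    exact_mod_cast h2
  obtain ⟨f, hf, hfN⟩ := (Finset.all_card_le_biUnion_card_iff_exists_injective N).mp hall
  refine ⟨fun j => (f j).1, fun j => (Finset.mem_filter.mp (hfN j)).2, fun i => ?_⟩
  have h1 : (Finset.univ.filter fun j => (f j).1 = i).card ≤ c i := by
    have : ((Finset.univ.filter fun j => (f j).1 = i).image f) ⊆
        (({i} : Finset (Fin m)).sigma fun i => (Finset.univ : Finset (Fin (c i)))) := by
      intro v hv
      simp only [Finset.mem_image, Finset.mem_filter, Finset.mem_univ, true_and] at hv
      obtain ⟨j, hj, rfl⟩ := hv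
      simp [hj]
    have h2 := Finset.card_le_card this
    rw [Finset.card_image_of_injective _ hf] at h2
    simpa using h2
  have h2 : (c i : ℝ) < ∑ j, p j i + 1 :=
    Nat.ceil_lt_add_one (Finset.sum_nonneg fun j _ => hp j i)
  rw [Finset.sum_boole]
  have h3 : ((Finset.univ.filter fun j => (f j).1 = i).card : ℝ) ≤ c i := by exact_mod_cast h1
  linarith

section Light

variable {K : Type} [Field K] [LinearOrder K]

open Classical in
/-- The number of machines that form a free pair with the job `j`. -/
def freeDegree (nJ m : ℕ) (y : ℕ → ℕ → K) (j : ℕ) : ℕ :=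
  ((Finset.range m).filter fun i => Free y j (nJ + i)).card

/-- The job `j` has the type `(h, k)`: it is assigned to `k` as far as the capacity allows it, and
the rest is assigned to `h`; here `h = k` means that there is no rest. Jobs that form free pairs
with two or more machines have no type. -/
def HasType {nJ m : ℕ} (inc : Fin nJ → Finset (Fin m)) (y : ℕ → ℕ → K) (j : Fin nJ)
    (h k : Fin m) : Prop :=
  freeDegree nJ m y j ≤ 1 ∧ k ∈ inc j ∧ y (nJ + k) j = 0 ∧
    ((h = k ∧ freeDegree nJ m y j = 0) ∨ (h ≠ k ∧ Free y j (nJ + h)))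

open Classical in
/-- The number of jobs of type `(h, k)`. -/
def typeCount {nJ m : ℕ} (inc : Fin nJ → Finset (Fin m)) (y : ℕ → ℕ → K) (h k : Fin m) : ℕ :=
  (Finset.univ.filter fun j => HasType inc y j h k).card

end Light

section LightReal

variable {nJ m : ℕ} {inc : Fin nJ → Finset (Fin m)} {x : Fin m → Fin nJ → ℝ} {ζ : Fin m → ℝ}
  {y : ℕ → ℕ → ℝ} {rk par : ℕ → ℕ}

theorem freeDegree_pos {j : Fin nJ} {i : Fin m} (hf : Free y j (nJ + i)) :
    1 ≤ freeDegree nJ m y j := by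
  classical
  rw [freeDegree, Nat.one_le_iff_ne_zero, Finset.card_ne_zero]
  exact ⟨i, by simp [hf]⟩

theorem free_unique {j : Fin nJ} {i i' : Fin m} (hd : freeDegree nJ m y j ≤ 1)
    (hf : Free y j (nJ + i)) (hf' : Free y j (nJ + i')) : i = i' := by
  classical
  rw [freeDegree, Finset.card_le_one] at hd
  exact Fin.ext (hd i (by simp [hf]) i' (by simp [hf']))

/-- A job is assigned to at most one machine as far as its capacity, which is at least `0.6`,
allows. -/
theorem AcyclicAssignment.tight_unique
    (H : AcyclicAssignment inc x (fun i => 1 - ζ i) y rk par) (hζ1 : ∀ i, ζ i ≤ 0.4)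
    (hrow : ∀ j : Fin nJ, ∑ i : Fin m, y j (nJ + i) = 1) {j : Fin nJ} {i k : Fin m}
    (hi : i ∈ inc j) (hk : k ∈ inc j) (hi0 : y (nJ + i) j = 0) (hk0 : y (nJ + k) j = 0) :
    i = k := by
  by_contra hne
  have h1 : y j (nJ + i) + y j (nJ + k) ≤ ∑ i : Fin m, y j (nJ + i) := by
    rw [← Finset.sum_pair (f := fun i : Fin m => y j (nJ + i)) hne]
    exact Finset.sum_le_sum_of_subset_of_nonneg (Finset.subset_univ _)
      fun _ _ _ => H.nonneg _ _
  have h2 := H.pair j i hi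
  have h3 := H.pair j k hk
  have h4 := hζ1 i
  have h5 := hζ1 k
  rw [hrow] at h1
  norm_num at h4 h5
  linarith

theorem AcyclicAssignment.eq_zero_of_not_free
    (H : AcyclicAssignment inc x (fun i => 1 - ζ i) y rk par) {j : Fin nJ} {i : Fin m}
    (hf : ¬ Free y j (nJ + i)) (ht : ¬ (i ∈ inc j ∧ y (nJ + i) j = 0)) : y j (nJ + i) = 0 := by
  by_cases hi : i ∈ inc j
  · by_contra h0
    have h1 : y (nJ + i) j ≠ 0 := fun h => ht ⟨hi, h⟩
    exact hf ⟨lt_of_le_of_ne (H.nonneg _ _) (Ne.symm h0),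
      lt_of_le_of_ne (H.nonneg _ _) (Ne.symm h1)⟩
  · exact H.out j i hi

/-- The fractional assignment of a job of type `(h, k)`. -/
theorem AcyclicAssignment.value_of_hasType
    (H : AcyclicAssignment inc x (fun i => 1 - ζ i) y rk par) (hζ1 : ∀ i, ζ i ≤ 0.4)
    (hrow : ∀ j : Fin nJ, ∑ i : Fin m, y j (nJ + i) = 1) {j : Fin nJ} {h k : Fin m}
    (ht : HasType inc y j h k) (i : Fin m) :
    y j (nJ + i) = (if i = k then 1 - ζ k else 0) + if i = h then ζ k else 0 := by
  obtain ⟨hd, hk, hk0, ht⟩ := ht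
  have hxk : y j (nJ + k) = 1 - ζ k := by
    have := H.pair j k hk
    rw [hk0] at this
    linarith
  have hother : ∀ i, i ≠ k → i ≠ h → y j (nJ + i) = 0 := by
    intro i h1 h2
    refine H.eq_zero_of_not_free (fun hf => ?_)
      fun ht => h1 (H.tight_unique hζ1 hrow ht.1 hk ht.2 hk0)
    rcases ht with ⟨-, h3⟩ | ⟨-, h3⟩
    · have := freeDegree_pos hf
      omega
    · exact h2 (free_unique hd hf h3)
  have hsum := hrow j
  rcases ht with ⟨rfl, h3⟩ | ⟨hne, h3⟩
  · rw [Finset.sum_eq_single h (fun i _ hi => hother i hi hi) (by simp)] at hsum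
    by_cases hi : i = h
    · subst hi
      rw [if_pos rfl, if_pos rfl, hxk]
      linarith
    · rw [hother i hi hi, if_neg hi, if_neg hi, add_zero]
  · have h4 : ∑ i : Fin m, y j (nJ + i) = y j (nJ + h) + y j (nJ + k) := by
      rw [← Finset.sum_pair (f := fun i : Fin m => y j (nJ + i)) hne]
      symm
      apply Finset.sum_subset (Finset.subset_univ _)
      intro i _ hi
      simp only [Finset.mem_insert, Finset.mem_singleton, not_or] at hi
      exact hother i hi.2 hi.1
    by_cases hik : i = k
    · subst hik
      rw [if_pos rfl, if_neg (Ne.symm hne), add_zero, hxk]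
    · by_cases hih : i = h
      · subst hih
        rw [if_neg hik, if_pos rfl, zero_add]
        linarith
      · rw [hother i hik hih, if_neg hik, if_neg hih, add_zero]

theorem AcyclicAssignment.hasType_unique
    (H : AcyclicAssignment inc x (fun i => 1 - ζ i) y rk par) (hζ1 : ∀ i, ζ i ≤ 0.4)
    (hrow : ∀ j : Fin nJ, ∑ i : Fin m, y j (nJ + i) = 1) {j : Fin nJ} {h k h' k' : Fin m}
    (ht : HasType inc y j h k) (ht' : HasType inc y j h' k') : h = h' ∧ k = k' := by
  obtain ⟨hd, hk, hk0, ht⟩ := ht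
  obtain ⟨-, hk', hk0', ht'⟩ := ht'
  obtain rfl := H.tight_unique hζ1 hrow hk hk' hk0 hk0'
  refine ⟨?_, rfl⟩
  rcases ht with ⟨rfl, h3⟩ | ⟨hne, h3⟩ <;> rcases ht' with ⟨rfl, h4⟩ | ⟨hne', h4⟩
  · rfl
  · have := freeDegree_pos h4; omega
  · have := freeDegree_pos h3; omega
  · exact free_unique hd h3 h4

theorem AcyclicAssignment.exists_hasType
    (H : AcyclicAssignment inc x (fun i => 1 - ζ i) y rk par) (hζ0 : ∀ i, 0 ≤ ζ i)
    (hrow : ∀ j : Fin nJ, ∑ i : Fin m, y j (nJ + i) = 1) {j : Fin nJ}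
    (hd : freeDegree nJ m y j ≤ 1) : ∃ h k, HasType inc y j h k := by
  have hpair := H.pair
  have htight : ∃ k ∈ inc j, y (nJ + k) j = 0 := by
    by_contra hc
    push Not at hc
    have hsum := hrow j
    by_cases hex : ∃ i : Fin m, Free y j (nJ + i)
    · obtain ⟨i, hi⟩ := hex
      rw [Finset.sum_eq_single i (fun i' _ hne => H.eq_zero_of_not_free
        (fun hf => hne (free_unique hd hf hi)) fun ht => hc _ ht.1 ht.2) (by simp)] at hsum
      have hinc : i ∈ inc j := by
        by_contra hinc
        have := H.out j i hinc
        linarith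
      have h1 := H.pair j i hinc
      have h2 := hζ0 i
      have h3 := hi.2
      linarith
    · push Not at hex
      rw [Finset.sum_eq_zero fun i _ => H.eq_zero_of_not_free (hex i)
        fun ht => hc _ ht.1 ht.2] at hsum
      norm_num at hsum
  obtain ⟨k, hk, hk0⟩ := htight
  by_cases hex : ∃ i : Fin m, Free y j (nJ + i)
  · obtain ⟨i, hi⟩ := hex
    refine ⟨i, k, hd, hk, hk0, Or.inr ⟨?_, hi⟩⟩
    rintro rfl
    exact hi.2.ne' hk0
  · push Not at hex
    refine ⟨k, k, hd, hk, hk0, Or.inl ⟨rfl, ?_⟩⟩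
    classical
    rw [freeDegree, Finset.card_eq_zero, Finset.filter_eq_empty_iff]
    intro i hi
    rw [Finset.mem_range] at hi
    exact hex ⟨i, hi⟩

/-- A job without a type is the parent of one of its machines. -/
theorem AcyclicAssignment.exists_child (H : AcyclicAssignment inc x (fun i => 1 - ζ i) y rk par)
    {j : Fin nJ} (hd : ¬ freeDegree nJ m y j ≤ 1) :
    ∃ i : Fin m, i ∈ inc j ∧ par (nJ + i) = j := by
  classical
  have hmem : ∀ i : Fin m, Free y j (nJ + i) → i ∈ inc j := by
    intro i hi
    by_contra hc
    exact hi.1.ne' (H.out j i hc)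
  rw [freeDegree, Finset.card_le_one] at hd
  push Not at hd
  obtain ⟨a, ha, b, hb, hab⟩ := hd
  simp only [Finset.mem_filter, Finset.mem_range] at ha hb
  rcases H.edge ha.2 with h1 | h1
  · rcases H.edge hb.2 with h2 | h2
    · omega
    · exact ⟨⟨b, hb.1⟩, hmem _ hb.2, h2⟩
  · exact ⟨⟨a, ha.1⟩, hmem _ ha.2, h1⟩

/-- The load of a machine in condition 4 of canonical instances is at most the fractional load. -/
theorem AcyclicAssignment.type_load_le
    (H : AcyclicAssignment inc x (fun i => 1 - ζ i) y rk par) (hζ1 : ∀ i, ζ i ≤ 0.4)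
    (hrow : ∀ j : Fin nJ, ∑ i : Fin m, y j (nJ + i) = 1) (i : Fin m) :
    ∑ k, (typeCount inc y k i : ℝ) * (1 - ζ i) + ∑ k, (typeCount inc y i k : ℝ) * ζ k ≤
      ∑ j : Fin nJ, y (j : ℕ) (nJ + i) := by
  classical
  have e : ∀ h k, (typeCount inc y h k : ℝ) = ∑ j, if HasType inc y j h k then (1 : ℝ) else 0 :=
    fun h k => by rw [typeCount, Finset.sum_boole]
  simp only [e, Finset.sum_mul]
  rw [Finset.sum_comm, Finset.sum_comm (s := Finset.univ (α := Fin m)), ← Finset.sum_add_distrib]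
  refine Finset.sum_le_sum fun j _ => ?_
  by_cases hex : ∃ h k, HasType inc y j h k
  · obtain ⟨h, k, ht⟩ := hex
    have hiff : ∀ h' k', HasType inc y j h' k' ↔ h' = h ∧ k' = k := fun h' k' =>
      ⟨fun ht' => H.hasType_unique hζ1 hrow ht' ht, by rintro ⟨rfl, rfl⟩; exact ht⟩
    rw [H.value_of_hasType hζ1 hrow ht i]
    simp only [hiff]
    refine le_of_eq ?_
    congr 1
    · by_cases hik : i = k
      · subst hik; simp
      · simp [hik]
    · by_cases hih : i = h
      · subst hih; simp
      · simp [hih]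
  · push Not at hex
    simp only [hex, if_false, zero_mul, Finset.sum_const_zero, add_zero]
    exact H.nonneg _ _

/-- A fractional split `φ` of the light loads `ε * typeCount` can be turned into an assignment of
the light jobs that puts at most `2 * ε` more on every machine: one `ε` for rounding the split, and
one for a job without a type. -/
theorem AcyclicAssignment.exists_light_schedule
    (H : AcyclicAssignment inc x (fun i => 1 - ζ i) y rk par) (hζ0 : ∀ i, 0 ≤ ζ i)
    (hζ1 : ∀ i, ζ i ≤ 0.4) (hrow : ∀ j : Fin nJ, ∑ i : Fin m, y j (nJ + i) = 1) {ε : ℝ}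
    (hε : 0 < ε) {φ : Fin m → Fin m → ℝ}
    (hφ : ∀ h k, 0 ≤ φ h k ∧ φ h k ≤ ε * typeCount inc y h k) :
    ∃ g : Fin nJ → Fin m, (∀ j, g j ∈ inc j) ∧ ∀ i, (∑ j, if g j = i then ε else 0) ≤
      ∑ k, φ i k + ∑ h, (ε * typeCount inc y h i - φ h i) + 2 * ε := by
  classical
  have e : ∀ h k, (typeCount inc y h k : ℝ) = ∑ j, if HasType inc y j h k then (1 : ℝ) else 0 :=
    fun h k => by rw [typeCount, Finset.sum_boole]
  set w : Fin m → Fin m → ℝ := fun h k => ε * typeCount inc y h k with hw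
  -- The share of the machine `i` in the jobs of type `(h, k)`.
  set r : Fin m → Fin m → Fin m → ℝ := fun h k i =>
    (if i = h then φ h k / w h k else 0) + (if i = k then 1 - φ h k / w h k else 0) with hr
  have hw0 : ∀ h k, 0 ≤ w h k := fun h k => (hφ h k).1.trans (hφ h k).2
  have hq0 : ∀ h k, 0 ≤ φ h k / w h k := fun h k => div_nonneg (hφ h k).1 (hw0 h k)
  have hq1 : ∀ h k, φ h k / w h k ≤ 1 := fun h k => div_le_one_of_le₀ (hφ h k).2 (hw0 h k)
  have hr0 : ∀ h k i, 0 ≤ r h k i := by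
    intro h k i
    have := hq0 h k
    have := hq1 h k
    simp only [hr]
    split_ifs <;> linarith
  have hrsum : ∀ h k, ∑ i, r h k i = 1 := by
    intro h k
    simp only [hr, Finset.sum_add_distrib, Finset.sum_ite_eq', Finset.mem_univ, if_true]
    ring
  have hrw : ∀ h k i, w h k * r h k i =
      (if i = h then φ h k else 0) + (if i = k then w h k - φ h k else 0) := by
    intro h k i
    have : w h k * (φ h k / w h k) = φ h k := by
      rcases eq_or_ne (w h k) 0 with h0 | h0
      · have := hφ h k
        rw [h0, zero_mul]
        change _ ∧ _ ≤ w h k at this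
        linarith
      · field_simp
    simp only [hr]
    split_ifs <;> simp only [mul_add, mul_sub, mul_one, mul_zero, this]
  -- Jobs of the same type are divided in the same proportion.
  set p : Fin nJ → Fin m → ℝ := fun j i => ∑ h, ∑ k, if HasType inc y j h k then r h k i else 0
    with hp
  have hpt : ∀ j h k, HasType inc y j h k → ∀ i, p j i = r h k i := by
    intro j h k ht i
    have hiff : ∀ h' k', HasType inc y j h' k' ↔ h' = h ∧ k' = k := fun h' k' =>
      ⟨fun ht' => H.hasType_unique hζ1 hrow ht' ht, by rintro ⟨rfl, rfl⟩; exact ht⟩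
    simp only [hp, hiff]
    rw [Finset.sum_eq_single h, Finset.sum_eq_single k]
    · simp
    · intro k' _ hk
      simp [hk]
    · simp
    · intro h' _ hh
      simp [hh]
    · simp
  have hp0 : ∀ j i, 0 ≤ p j i := fun j i => Finset.sum_nonneg fun h _ =>
    Finset.sum_nonneg fun k _ => by split_ifs <;> simp [hr0]
  have hpe : ∀ i, ε * ∑ j, p j i = ∑ k, φ i k + ∑ h, (w h i - φ h i) := by
    intro i
    have h1 : ε * ∑ j, p j i = ∑ h, ∑ k, w h k * r h k i := by
      simp only [hp]
      rw [Finset.sum_comm, Finset.mul_sum]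
      refine Finset.sum_congr rfl fun h _ => ?_
      rw [Finset.sum_comm, Finset.mul_sum]
      refine Finset.sum_congr rfl fun k _ => ?_
      simp only [hw]
      rw [e, mul_assoc, Finset.sum_mul]
      congr 1
      refine Finset.sum_congr rfl fun j _ => ?_
      split_ifs <;> simp
    rw [h1]
    simp only [hrw, Finset.sum_add_distrib, Finset.sum_ite_eq, Finset.mem_univ, if_true]
    congr 1
    rw [Finset.sum_comm]
    simp
  obtain ⟨g, hg, hgc⟩ := exists_rounding (J := {j : Fin nJ // freeDegree nJ m y j ≤ 1})
    (fun j i => p j i) (fun j i => hp0 j i) (fun ⟨j, hj⟩ => by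
      obtain ⟨h, k, ht⟩ := H.exists_hasType hζ0 hrow hj
      simp only [hpt j h k ht, hrsum])
  have hchild : ∀ j : {j : Fin nJ // ¬ freeDegree nJ m y j ≤ 1},
      ∃ i : Fin m, i ∈ inc j ∧ par (nJ + i) = j := fun j => H.exists_child j.2
  choose c hc1 hc2 using hchild
  refine ⟨fun j => if hj : freeDegree nJ m y j ≤ 1 then g ⟨j, hj⟩ else c ⟨j, hj⟩, fun j => ?_,
    fun i => ?_⟩
  · beta_reduce
    by_cases hj : freeDegree nJ m y j ≤ 1
    · rw [dif_pos hj]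
      obtain ⟨h, k, ht⟩ := H.exists_hasType hζ0 hrow hj
      have h1 := hg ⟨j, hj⟩
      simp only [hpt j h k ht] at h1
      have hk := ht.2.1
      have hh : h ∈ inc j := by
        rcases ht.2.2.2 with ⟨rfl, -⟩ | ⟨-, h2⟩
        · exact hk
        · by_contra hc
          exact h2.1.ne' (H.out j h hc)
      by_contra hcon
      have e1 : g ⟨j, hj⟩ ≠ h := by rintro e1; rw [e1] at hcon; exact hcon hh
      have e2 : g ⟨j, hj⟩ ≠ k := by rintro e1; rw [e1] at hcon; exact hcon hk
      simp [hr, e1, e2] at h1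
    · rw [dif_neg hj]
      exact hc1 ⟨j, hj⟩
  · have hcount : (∑ j : Fin nJ, if (if hj : freeDegree nJ m y j ≤ 1 then g ⟨j, hj⟩ else c ⟨j, hj⟩) = i
        then ε else 0) =
        ε * ((∑ j, if g j = i then (1 : ℝ) else 0) + ∑ j, if c j = i then (1 : ℝ) else 0) := by
      rw [← Fintype.sum_subtype_add_sum_subtype (fun j : Fin nJ => freeDegree nJ m y j ≤ 1), mul_add,
        Finset.mul_sum, Finset.mul_sum]
      congr 1
      · refine Finset.sum_congr rfl fun j _ => ?_
        rw [dif_pos j.2]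
        split_ifs <;> simp
      · refine Finset.sum_congr rfl fun j _ => ?_
        rw [dif_neg j.2]
        split_ifs <;> simp
    -- A machine has only one parent, so it gets at most one job without a type.
    have h1 : (∑ j, if c j = i then (1 : ℝ) else 0) ≤ 1 := by
      rw [Finset.sum_boole]
      have : (Finset.univ.filter fun j => c j = i).card ≤ 1 := by
        rw [Finset.card_le_one]
        intro a ha b hb
        simp only [Finset.mem_filter, Finset.mem_univ, true_and] at ha hb
        apply Subtype.ext
        apply Fin.ext
        rw [← hc2 a, ← hc2 b, ha, hb]
      exact_mod_cast this
    have h2 := hgc i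
    have h3 : ∑ j : {j : Fin nJ // freeDegree nJ m y j ≤ 1}, p j i ≤ ∑ j, p j i := by
      rw [← Fintype.sum_subtype_add_sum_subtype (fun j : Fin nJ => freeDegree nJ m y j ≤ 1)
        (fun j => p j i)]
      exact le_add_of_nonneg_right (Finset.sum_nonneg fun j _ => hp0 j i)
    rw [hcount]
    calc _ ≤ ε * ((∑ j, p j i + 1) + 1) := mul_le_mul_of_nonneg_left (by linarith) hε.le
      _ = ε * ∑ j, p j i + 2 * ε := by ring
      _ = _ := by rw [hpe]

end LightReal

/-! ### The canonical instance -/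

section Canonical

variable {m nH nL : ℕ}

/-- Machines whose value of `0.4 z` is at least `0.6 δ / m`. -/
def BigMachine {K : Type} [Field K] [LinearOrder K] {m : ℕ} (δ : K) (z : Fin m → K) (i : ℕ) : Prop :=
  ∃ h : i < m, 3 / 5 * δ ≤ m * (2 / 5 * z ⟨i, h⟩)

open Classical in
/-- The vector `z` of the canonical instance: `0.4 z` on the machines of canonical heavy jobs. -/
def canonicalZ {K : Type} [Field K] [LinearOrder K] {m : ℕ} (nH : ℕ) (δ : K) (z : Fin m → K)
    (y : ℕ → ℕ → K) (par : ℕ → ℕ) (i : Fin m) : K :=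
  if ∃ j : Fin nH, HeavyMem nH (nH + m) y par (BigMachine δ z) j i then 2 / 5 * z i else 0

variable {I : Instance ℝ m nH nL} {δ : ℝ} {s : LPPoint ℝ m nH nL} {yH yL : ℕ → ℕ → ℝ}
  {rkH parH rkL parL : ℕ → ℕ}

/-- The facts about the heavy jobs that are needed for the canonical instance. -/
theorem heavy_facts (hfeas : LPFeasible I 0.6 δ s)
    (hH : AcyclicAssignment I.heavyMach s.xH (fun _ => 2) yH rkH parH) :
    (∀ i : Fin m, ∑ j : Fin nH, yH (j : ℕ) (nH + i) = s.z i) ∧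
    (∀ j : Fin nH, ∑ i : Fin m, yH j (nH + i) = 1) ∧
    ∀ (j : Fin nH) (i : Fin m), 0 < yH j (nH + i) → Free yH j (nH + i) := by
  have hrow : ∀ j : Fin nH, ∑ i : Fin m, yH j (nH + i) = 1 := fun j => by
    rw [hH.row, hfeas.heavy_covered]
  refine ⟨fun i => by rw [hH.col, hfeas.heavy_load], hrow, fun j i h => ⟨h, ?_⟩⟩
  have hi : i ∈ I.heavyMach j := by
    by_contra hc
    exact h.ne' (hH.out j i hc)
  have h1 := hH.pair j i hi
  have h2 : yH j (nH + i) ≤ 1 := by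
    rw [← hrow j]
    exact Finset.single_le_sum (f := fun i : Fin m => yH j (nH + i))
      (fun i _ => hH.nonneg _ _) (Finset.mem_univ i)
  linarith

theorem heavyMem_unique (hfeas : LPFeasible I 0.6 δ s)
    (hH : AcyclicAssignment I.heavyMach s.xH (fun _ => 2) yH rkH parH) {big : ℕ → Prop}
    {j j' : Fin nH} {i : ℕ} (h : HeavyMem nH (nH + m) yH parH big j i)
    (h' : HeavyMem nH (nH + m) yH parH big j' i) : j = j' := by
  obtain ⟨hcol, hrow, hfree⟩ := heavy_facts hfeas hH
  rcases h with ⟨h1, h2⟩ | ⟨h1, h2, h3, -⟩ <;> rcases h' with ⟨h1', h2'⟩ | ⟨h1', h2', h3', -⟩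
  · exact hH.linked_inj hcol hfeas.z_le_one h1 h1' (h2.trans h2'.symm)
  · exact absurd ⟨j, j.2, h1, h2⟩ h2'
  · exact absurd ⟨j', j'.2, h1', h2'⟩ h2
  · exact Fin.ext (h3.symm.trans h3')

/-- A machine of a canonical heavy job has a value that is not too small. -/
theorem le_of_heavyMem (hfeas : LPFeasible I 0.6 δ s) (hδ : 0.6 * δ < 0.2)
    (hH : AcyclicAssignment I.heavyMach s.xH (fun _ => 2) yH rkH parH)
    {j : Fin nH} {i : Fin m}
    (h : HeavyMem nH (nH + m) yH parH (BigMachine δ s.z) j i) :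
    3 / 5 * δ ≤ m * (2 / 5 * s.z i) ∧ (Linked yH parH j → 1 / 2 < s.z i) := by
  obtain ⟨hcol, hrow, hfree⟩ := heavy_facts hfeas hH
  rcases h with ⟨h1, h2⟩ | ⟨h1, h2, h3, h4⟩
  · have h3 : 1 / 2 < s.z i := by
      rw [← hcol i]
      refine lt_of_lt_of_le ?_ (Finset.single_le_sum (f := fun j : Fin nH => yH j (nH + i))
        (fun i _ => hH.nonneg _ _) (Finset.mem_univ j))
      rwa [Linked, h2] at h1
    refine ⟨?_, fun _ => h3⟩
    have hm : (1 : ℝ) ≤ m := by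
      have := i.2
      exact_mod_cast (by omega : 1 ≤ m)
    norm_num at hδ
    nlinarith
  · exact ⟨h4.2, fun hl => absurd hl h1⟩

open Classical in
/-- The reduction for acyclic solutions of the linear program. The machine sets and `z` come from
the heavy jobs, and `w` from the types of the light jobs. -/
theorem exists_canonicalReduction (hm : 0 < m) (hε : 0 < I.eps) (hε1 : I.eps ≤ 1) (hδ0 : 0 < δ)
    (hδ : 0.6 * δ < 0.2) (hfeas : LPFeasible I 0.6 δ s)
    (hH : AcyclicAssignment I.heavyMach s.xH (fun _ => 2) yH rkH parH)
    (hL : AcyclicAssignment I.lightMach s.xL (fun i => 1 - canonicalZ nH δ s.z yH parH i)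
      yL rkL parL) :
    ∃ C : CanonicalInstance m nH,
      (∀ j i, i ∈ C.mach j ↔ HeavyMem nH (nH + m) yH parH (BigMachine δ s.z) j i) ∧
      (∀ h k, C.w h k = I.eps * typeCount I.lightMach yL h k) ∧
      (∀ i, C.z i = canonicalZ nH δ s.z yH parH i) ∧ IsCanonicalReduction I 0.6 δ C := by
  obtain ⟨hcol, hrow, hfree⟩ := heavy_facts hfeas hH
  set ζ := canonicalZ nH δ s.z yH parH with hζ
  have hm' : (0 : ℝ) < m := by exact_mod_cast hm
  have hz0 := hfeas.z_nonneg
  have hz1 := hfeas.z_le_one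
  have hζpos : ∀ (j : Fin nH) (i : Fin m), HeavyMem nH (nH + m) yH parH (BigMachine δ s.z) j i →
      ζ i = 2 / 5 * s.z i := fun j i h => if_pos ⟨j, h⟩
  have hζ0 : ∀ i, 0 ≤ ζ i := by
    intro i
    simp only [hζ, canonicalZ]
    split_ifs
    · have := hz0 i; positivity
    · exact le_rfl
  have hζz : ∀ i, ζ i ≤ 2 / 5 * s.z i := by
    intro i
    simp only [hζ, canonicalZ]
    split_ifs
    · exact le_rfl
    · have := hz0 i; positivity
  have hζ1 : ∀ i, ζ i ≤ 0.4 := by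
    intro i
    have h1 := hζz i
    have h2 := hz1 i
    norm_num
    linarith
  have hzpos : ∀ (j : Fin nH) (i : Fin m), HeavyMem nH (nH + m) yH parH (BigMachine δ s.z) j i →
      0 < s.z i := by
    intro j i h
    have h1 := (le_of_heavyMem hfeas hδ hH h).1
    by_contra hc
    have : s.z i = 0 := le_antisymm (not_lt.mp hc) (hz0 i)
    rw [this] at h1
    linarith
  have hrowL : ∀ j : Fin nL, ∑ i : Fin m, yL j (nL + i) = 1 := fun j => by
    rw [hL.row, hfeas.light_covered]
  -- A job of type `(h, h)` is assigned to `h` completely and uses up the capacity `1 - ζ h` there.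
  have hdiag : ∀ j h, HasType I.lightMach yL j h h → ζ h = 0 := by
    intro j h ht
    have h1 := hL.value_of_hasType hζ1 hrowL ht h
    have h2 := hL.pair j h ht.2.1
    rw [ht.2.2.1] at h2
    simp only [if_true] at h1
    linarith
  have hoff : ∀ j h k, HasType I.lightMach yL j h k → h ≠ k → 0 < ζ k := by
    intro j h k ht hne
    have h1 := hL.value_of_hasType hζ1 hrowL ht h
    rw [if_neg hne, if_pos rfl, zero_add] at h1
    rcases ht.2.2.2 with ⟨h2, -⟩ | ⟨-, h2⟩
    · exact absurd h2 hne
    · rw [← h1]; exact h2.1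
  have hcount : ∀ h k, (∀ j, ¬ HasType I.lightMach yL j h k) →
      typeCount I.lightMach yL h k = 0 := by
    intro h k hno
    rw [typeCount, Finset.card_eq_zero, Finset.filter_eq_empty_iff]
    intro j _
    exact hno j
  set C : CanonicalInstance m nH := {
    mach := fun j => Finset.univ.filter fun i =>
      HeavyMem nH (nH + m) yH parH (BigMachine δ s.z) j i
    w := fun h k => I.eps * typeCount I.lightMach yL h k
    z := ζ
    mach_disjoint := by
      intro j j' hne
      rw [Finset.disjoint_left]
      intro i hi hi'
      rw [Finset.mem_filter] at hi hi'
      exact hne (heavyMem_unique hfeas hH hi.2 hi'.2)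
    w_nonneg := fun h k => by positivity
    w_eq_zero := by
      intro h k hk hne
      rw [hcount h k fun j ht => (hoff j h k ht hne).ne' hk]
      simp
    w_diag := by
      intro h hpos
      rw [hcount h h fun j ht => hpos.ne' (hdiag j h ht)]
      simp
    z_nonneg := hζ0
    z_le := hζ1
    z_eq_zero_iff := by
      intro i
      constructor
      · intro h0 j hj
        rw [Finset.mem_filter] at hj
        have h1 := hζpos j i hj.2
        have h2 := hzpos j i hj.2
        linarith
      · intro h
        simp only [hζ, canonicalZ]
        rw [if_neg]
        rintro ⟨j, hj⟩
        exact h j (by simp [hj]) } with hC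
  have hmem : ∀ j i, i ∈ C.mach j ↔
      HeavyMem nH (nH + m) yH parH (BigMachine δ s.z) j i := by
    intro j i
    simp [hC]
  have hthr : (1 : ℝ) / (m / (0.6 * δ)) = 3 / 5 * δ / m := by
    rw [one_div_div]
    norm_num
  refine ⟨C, hmem, fun _ _ => rfl, fun _ => rfl, ?_, ?_⟩
  · refine ⟨?_, ?_, by positivity, hδ, ?_, ?_, ?_, ?_⟩
    · rw [le_div_iff₀ (by positivity)]
      have : (1 : ℝ) ≤ m := by exact_mod_cast hm
      norm_num at hδ ⊢
      linarith
    · rw [le_div_iff₀ hε]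
      linarith
    · intro i
      by_cases hex : ∃ j : Fin nH, HeavyMem nH (nH + m) yH parH (BigMachine δ s.z) j i
      · right
        obtain ⟨j, hj⟩ := hex
        change _ ≤ ζ i
        rw [hthr, hζpos j i hj, div_le_iff₀ hm']
        linarith [(le_of_heavyMem hfeas hδ hH hj).1]
      · left
        exact if_neg hex
    · intro h k
      change I.eps * (typeCount I.lightMach yL h k : ℝ) = 0 ∨ _ ≤
        I.eps * (typeCount I.lightMach yL h k : ℝ)
      rcases Nat.eq_zero_or_pos (typeCount I.lightMach yL h k) with h0 | h0
      · left; rw [h0]; simp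
      · right
        have : (1 : ℝ) ≤ typeCount I.lightMach yL h k := by exact_mod_cast h0
        rw [one_div_one_div]
        nlinarith
    · intro j
      have hsum : ∑ i ∈ C.mach j, C.z i = ∑ i ∈ C.mach j, 2 / 5 * s.z i :=
        Finset.sum_congr rfl fun i hi => hζpos j i ((hmem j i).mp hi)
      rw [hsum]
      by_cases hl : Linked yH parH j
      · obtain ⟨i, hi, -⟩ := hH.linked hl
        have hij : HeavyMem nH (nH + m) yH parH (BigMachine δ s.z) j i := Or.inl ⟨hl, hi⟩
        have h1 := (le_of_heavyMem hfeas hδ hH hij).2 hl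
        have h2 := Finset.single_le_sum (f := fun i => 2 / 5 * s.z i)
          (fun i _ => by have := hz0 i; positivity) ((hmem j i).mpr hij)
        norm_num at hδ ⊢
        linarith
      · have h1 := hH.half_le_sum hcol hz1 hrow hfree hl
        -- The machines that are not big lose at most `0.6 δ / m` each.
        have h2 : ∑ i : Fin m, (2 / 5 * (if ¬ Claimed nH yH parH (nH + i) ∧
            clusterTop (nH + m) yH parH (parH (nH + i)) = j then s.z i else 0) -
              3 / 5 * δ / m) ≤ ∑ i ∈ C.mach j, 2 / 5 * s.z i := by
          rw [← Finset.sum_filter_add_sum_filter_not Finset.univ (fun i => i ∈ C.mach j)]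
          have h3 : (Finset.univ.filter fun i => i ∈ C.mach j) = C.mach j := by ext; simp
          rw [h3]
          have hd : 0 < 3 / 5 * δ / m := by positivity
          have h4 : ∀ i ∈ C.mach j, (2 / 5 * (if ¬ Claimed nH yH parH (nH + i) ∧
              clusterTop (nH + m) yH parH (parH (nH + i)) = j then s.z i else 0) -
              3 / 5 * δ / m) ≤ 2 / 5 * s.z i := by
            intro i _
            have := hz0 i
            split_ifs <;> linarith
          have h5 : ∀ i ∈ (Finset.univ.filter fun i => ¬ i ∈ C.mach j),
              (2 / 5 * (if ¬ Claimed nH yH parH (nH + i) ∧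
              clusterTop (nH + m) yH parH (parH (nH + i)) = j then s.z i else 0) -
              3 / 5 * δ / m) ≤ 0 := by
            intro i hi
            rw [Finset.mem_filter, hmem] at hi
            split_ifs with hc
            · have hnb : ¬ BigMachine δ s.z i := fun hb => hi.2 (Or.inr ⟨hl, hc.1, hc.2, hb⟩)
              have : ¬ (3 / 5 * δ ≤ m * (2 / 5 * s.z i)) := fun hb => hnb ⟨i.2, hb⟩
              rw [sub_nonpos, le_div_iff₀ hm']
              linarith
            · linarith
          have := Finset.sum_le_sum h4
          have := Finset.sum_nonpos h5
          linarith
        rw [Finset.sum_sub_distrib, ← Finset.mul_sum, Finset.sum_const, Finset.card_univ,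
          Fintype.card_fin, nsmul_eq_mul, mul_div_cancel₀ _ hm'.ne'] at h2
        norm_num at h1 h2 ⊢
        linarith
    · intro h
      have h1 := hL.type_load_le hζ1 hrowL h
      have h2 : ∑ k, C.w k h * (1 - C.z h) + ∑ k, C.w h k * C.z k = I.eps *
          (∑ k, (typeCount I.lightMach yL k h : ℝ) * (1 - ζ h) +
            ∑ k, (typeCount I.lightMach yL h k : ℝ) * ζ k) := by
        rw [mul_add, Finset.mul_sum, Finset.mul_sum]
        simp only [hC, mul_assoc]
      have h3 := hfeas.total_load h
      rw [← hL.col h] at *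
      have h4 : C.z h = ζ h := rfl
      have h5 := hζz h
      have h6 := hz0 h
      have h7 := mul_le_mul_of_nonneg_left h1 hε.le
      linarith
  · intro δ' hδ'0 hδ'1 f hf
    obtain ⟨hfm, φ, hφ, hload⟩ := hf
    obtain ⟨σ, hσ, hσm⟩ := hH.exists_rearrangement fun j => (hmem j (f j)).mp (hfm j)
    obtain ⟨g, hg, hgl⟩ := hL.exists_light_schedule hζ0 hζ1 hrowL hε hφ
    refine ⟨⟨fun j => f (σ j), g, hσm, hg⟩, ?_⟩
    have : Nonempty (Fin m) := ⟨⟨0, hm⟩⟩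
    refine ciSup_le fun i => ?_
    have h1 : (∑ j, if f (σ j) = i then (1 : ℝ) else 0) = ∑ j, if f j = i then (1 : ℝ) else 0 :=
      hσ.sum_comp fun j => if f j = i then (1 : ℝ) else 0
    have h2 := hgl i
    have h3 := hload i
    change (∑ j, if f (σ j) = i then (1 : ℝ) else 0) + (∑ j, if g j = i then I.eps else 0) ≤ _
    rw [h1]
    change _ + _ + ∑ h, (I.eps * (typeCount I.lightMach yL h i : ℝ) - φ h i) ≤ _ at h3
    linarith

/-- The bounds on the variables of the light jobs that make the residual capacities
nonnegative. -/
theorem light_bounds (hfeas : LPFeasible I 0.6 δ s) (j : Fin nL) (i : Fin m)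
    (hi : i ∈ I.lightMach j) :
    0 ≤ s.xL i j ∧ s.xL i j ≤ 1 - canonicalZ nH δ s.z yH parH i := by
  refine ⟨hfeas.xL_nonneg j i hi, ?_⟩
  have h1 := hfeas.compact j i hi
  have h2 := hfeas.z_nonneg i
  norm_num at h1
  unfold canonicalZ
  split_ifs <;> linarith

theorem heavy_bounds (hfeas : LPFeasible I 0.6 δ s) (j : Fin nH) (i : Fin m)
    (hi : i ∈ I.heavyMach j) : 0 ≤ s.xH i j ∧ s.xH i j ≤ 1 := by
  refine ⟨hfeas.xH_nonneg j i hi, ?_⟩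
  rw [← hfeas.heavy_covered j]
  exact Finset.single_le_sum (f := fun i => s.xH i j) (fun i hi => hfeas.xH_nonneg j i hi) hi

theorem exists_canonicalInstance (hm : 0 < m) (hε : 0 < I.eps) (hε1 : I.eps ≤ 1) (hδ0 : 0 < δ)
    (hδ : 0.6 * δ < 0.2) (hfeas : LPFeasible I 0.6 δ s) :
    ∃ (k : ℕ) (C : CanonicalInstance m k), IsCanonicalReduction I 0.6 δ C := by
  obtain ⟨yH, rkH, parH, hc, hf⟩ := exists_isForest
    (residual_supported (inc := I.heavyMach) (x := s.xH) (u := fun _ => 2))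
    (residual_nonneg fun j i hi => ⟨(heavy_bounds hfeas j i hi).1,
      (heavy_bounds hfeas j i hi).2.trans one_le_two⟩)
  obtain ⟨yL, rkL, parL, hc', hf'⟩ := exists_isForest
    (residual_supported (inc := I.lightMach) (x := s.xL)
      (u := fun i => 1 - canonicalZ nH δ s.z yH parH i))
    (residual_nonneg fun j i hi => light_bounds hfeas j i hi)
  obtain ⟨C, -, -, -, hC⟩ := exists_canonicalReduction hm hε hε1 hδ0 hδ hfeas
    (hc.acyclicAssignment hf) (hc'.acyclicAssignment hf')
  exact ⟨nH, C, hC⟩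

end Canonical

/-! ### Bit lengths -/

theorem bitSize_le_of_mul_eq {q : ℚ} {n : ℤ} {d : ℕ} (hd : d ≠ 0) (h : q * d = n) :
    bitSize q ≤ Nat.size n.natAbs + Nat.size d + 1 := by
  have hq : q = (n : ℚ) / (d : ℤ) := by
    have : (d : ℚ) ≠ 0 := by exact_mod_cast hd
    rw [← h]
    push_cast
    field_simp
  have h1 : (q.den : ℤ) ∣ d := by
    rw [hq, ← Rat.divInt_eq_div]
    exact Rat.den_dvd n d
  obtain ⟨e, he⟩ := Int.natCast_dvd_natCast.mp h1
  have he0 : e ≠ 0 := by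
    rintro rfl
    simp at he
    exact hd he
  have h2 : q.num * e = n := by
    have h3 : (q.num : ℚ) = q * q.den := (Rat.mul_den_eq_num q).symm
    have : ((q.num * e : ℤ) : ℚ) = n := by
      rw [← h, he]
      push_cast
      rw [h3]
      ring
    exact_mod_cast this
  unfold bitSize
  have h4 : q.num.natAbs ≤ n.natAbs := by
    rw [← h2, Int.natAbs_mul, Int.natAbs_natCast]
    exact Nat.le_mul_of_pos_right _ (Nat.pos_of_ne_zero he0)
  have h5 : q.den ≤ d := Nat.le_of_dvd (Nat.pos_of_ne_zero hd) ⟨e, he⟩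
  have := Nat.size_le_size h4
  have := Nat.size_le_size h5
  omega

theorem size_mul_le (a b : ℕ) : Nat.size (a * b) ≤ Nat.size a + Nat.size b := by
  rw [Nat.size_le, pow_add]
  exact Nat.mul_lt_mul'' (Nat.lt_size_self a) (Nat.lt_size_self b)

theorem size_add_le (a b : ℕ) : Nat.size (a + b) ≤ Nat.size a + Nat.size b + 1 := by
  rw [Nat.size_le, pow_succ, pow_add]
  have h1 := Nat.lt_size_self a
  have h2 := Nat.lt_size_self b
  have h3 : 2 ^ a.size ≤ 2 ^ a.size * 2 ^ b.size := Nat.le_mul_of_pos_right _ (by positivity)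
  have h4 : 2 ^ b.size ≤ 2 ^ a.size * 2 ^ b.size := Nat.le_mul_of_pos_left _ (by positivity)
  omega

theorem bitSize_add_le (p q : ℚ) : bitSize (p + q) ≤ 2 * (bitSize p + bitSize q) := by
  have h := bitSize_le_of_mul_eq (q := p + q) (n := p.num * q.den + q.num * p.den)
    (d := p.den * q.den) (by simp) (by
      push_cast
      rw [← Rat.mul_den_eq_num p, ← Rat.mul_den_eq_num q]
      ring)
  have h1 : (p.num * q.den + q.num * p.den).natAbs ≤
      p.num.natAbs * q.den + q.num.natAbs * p.den := by
    refine (Int.natAbs_add_le _ _).trans ?_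
    simp [Int.natAbs_mul]
  have h2 := Nat.size_le_size h1
  have h3 := size_add_le (p.num.natAbs * q.den) (q.num.natAbs * p.den)
  have h4 := size_mul_le p.num.natAbs q.den
  have h5 := size_mul_le q.num.natAbs p.den
  have h6 := size_mul_le p.den q.den
  unfold bitSize at *
  omega

theorem bitSize_neg (q : ℚ) : bitSize (-q) = bitSize q := by
  simp [bitSize]

theorem bitSize_sub_le (p q : ℚ) : bitSize (p - q) ≤ 2 * (bitSize p + bitSize q) := by
  rw [sub_eq_add_neg, ← bitSize_neg q]
  exact bitSize_add_le p (-q)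

theorem bitSize_mul_le (p q : ℚ) : bitSize (p * q) ≤ 2 * (bitSize p + bitSize q) := by
  have h := bitSize_le_of_mul_eq (q := p * q) (n := p.num * q.num)
    (d := p.den * q.den) (by simp) (by
      push_cast
      rw [← Rat.mul_den_eq_num p, ← Rat.mul_den_eq_num q]
      ring)
  rw [Int.natAbs_mul] at h
  have h4 := size_mul_le p.num.natAbs q.num.natAbs
  have h6 := size_mul_le p.den q.den
  unfold bitSize at *
  omega

theorem bitSize_inv_le (q : ℚ) : bitSize q⁻¹ ≤ bitSize q + 1 := by
  rcases eq_or_ne q 0 with rfl | hq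
  · simp
  · have hn : (q.num.natAbs : ℤ) = |q.num| := Int.natCast_natAbs _
    have h := bitSize_le_of_mul_eq (q := q⁻¹) (n := SignType.sign q.num * q.den)
      (d := q.num.natAbs) (by simpa using hq) (by
        have h2 : ((q.num.natAbs : ℕ) : ℚ) = (SignType.sign q.num : ℤ) * q.num := by
          rw [← Int.cast_natCast, hn, ← Int.cast_mul, sign_mul_self]
        rw [h2]
        push_cast
        rw [← Rat.mul_den_eq_num q]
        field_simp)
    have h1 : ((SignType.sign q.num : ℤ) * (q.den : ℤ)).natAbs ≤ q.den := by
      rw [Int.natAbs_mul, Int.natAbs_natCast]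
      have : (SignType.sign q.num : ℤ).natAbs ≤ 1 := by
        cases SignType.sign q.num <;> simp
      nlinarith
    have := Nat.size_le_size h1
    unfold bitSize at *
    omega

theorem bitSize_pos (q : ℚ) : 1 ≤ bitSize q := by
  unfold bitSize
  omega

theorem bitSize_div_le (p q : ℚ) : bitSize (p / q) ≤ 4 * (bitSize p + bitSize q) := by
  rw [div_eq_mul_inv]
  have := bitSize_mul_le p q⁻¹
  have := bitSize_inv_le q
  have := bitSize_pos p
  omega

theorem bitSize_natCast_le (n : ℕ) : bitSize n ≤ n + 2 := by
  have : Nat.size n ≤ n := by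
    rw [Nat.size_le]
    exact Nat.lt_two_pow_self
  simp [bitSize]
  omega

/-! ### Reasoning about programs and their running times -/

/-- All cells of the memory hold numbers with at most `B` bits. -/
def Small (B : ℕ) (μ : Store) : Prop := ∀ a r c, bitSize (μ a r c) ≤ B

theorem Small.one_le {B : ℕ} {μ : Store} (h : Small B μ) : 1 ≤ B :=
  (bitSize_pos _).trans (h 0 0 0)

/-- A factor for the bit length of the value of an expression in terms of the bit lengths of the
cells. -/
def Expr.valFactor : Expr → ℕ
  | .lit q => bitSize q
  | .read _ _ _ => 1
  | .add e₁ e₂ => 4 * (e₁.valFactor + e₂.valFactor)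
  | .sub e₁ e₂ => 4 * (e₁.valFactor + e₂.valFactor)
  | .mul e₁ e₂ => 4 * (e₁.valFactor + e₂.valFactor)
  | .div e₁ e₂ => 4 * (e₁.valFactor + e₂.valFactor)

/-- A factor for the cost of an expression in terms of the bit lengths of the cells. -/
def Expr.costFactor : Expr → ℕ
  | .lit q => bitSize q
  | .read _ r c => r.costFactor + c.costFactor + 1
  | .add e₁ e₂ => e₁.costFactor + e₂.costFactor + 4 * (e₁.valFactor + e₂.valFactor)
  | .sub e₁ e₂ => e₁.costFactor + e₂.costFactor + 4 * (e₁.valFactor + e₂.valFactor)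
  | .mul e₁ e₂ => e₁.costFactor + e₂.costFactor + 4 * (e₁.valFactor + e₂.valFactor)
  | .div e₁ e₂ => e₁.costFactor + e₂.costFactor + 4 * (e₁.valFactor + e₂.valFactor)

theorem Expr.bitSize_eval_le {B : ℕ} {μ : Store} (h : Small B μ) (e : Expr) :
    bitSize (e.eval μ) ≤ e.valFactor * B := by
  have hB := h.one_le
  induction e with
  | lit q => exact Nat.le_mul_of_pos_right _ hB
  | read a r c => simpa [Expr.eval, Expr.valFactor] using h _ _ _
  | add e₁ e₂ h₁ h₂ =>
    have := bitSize_add_le (e₁.eval μ) (e₂.eval μ)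
    simp only [Expr.eval, Expr.valFactor]
    nlinarith
  | sub e₁ e₂ h₁ h₂ =>
    have := bitSize_sub_le (e₁.eval μ) (e₂.eval μ)
    simp only [Expr.eval, Expr.valFactor]
    nlinarith
  | mul e₁ e₂ h₁ h₂ =>
    have := bitSize_mul_le (e₁.eval μ) (e₂.eval μ)
    simp only [Expr.eval, Expr.valFactor]
    nlinarith
  | div e₁ e₂ h₁ h₂ =>
    have := bitSize_div_le (e₁.eval μ) (e₂.eval μ)
    simp only [Expr.eval, Expr.valFactor]
    nlinarith

theorem Expr.cost_le {B : ℕ} {μ : Store} (h : Small B μ) (e : Expr) :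
    e.cost μ ≤ e.costFactor * B := by
  have hB := h.one_le
  induction e with
  | lit q => exact Nat.le_mul_of_pos_right _ hB
  | read a r c h₁ h₂ =>
    have := h a ⌊r.eval μ⌋₊ ⌊c.eval μ⌋₊
    simp only [Expr.cost, Expr.costFactor]
    nlinarith
  | add e₁ e₂ h₁ h₂ =>
    have := (Expr.add e₁ e₂).bitSize_eval_le h
    simp only [Expr.cost, Expr.costFactor, Expr.eval, Expr.valFactor] at *
    nlinarith
  | sub e₁ e₂ h₁ h₂ =>
    have := (Expr.sub e₁ e₂).bitSize_eval_le h
    simp only [Expr.cost, Expr.costFactor, Expr.eval, Expr.valFactor] at *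
    nlinarith
  | mul e₁ e₂ h₁ h₂ =>
    have := (Expr.mul e₁ e₂).bitSize_eval_le h
    simp only [Expr.cost, Expr.costFactor, Expr.eval, Expr.valFactor] at *
    nlinarith
  | div e₁ e₂ h₁ h₂ =>
    have := (Expr.div e₁ e₂).bitSize_eval_le h
    simp only [Expr.cost, Expr.costFactor, Expr.eval, Expr.valFactor] at *
    nlinarith

/-- The running time of a program, per bit of the cells, as a polynomial in a bound on the number
of iterations of each of its loops. -/
def Program.timePoly : Program → Polynomial ℕ
  | .skip => 1
  | .assign _ r c e => Polynomial.C (r.costFactor + c.costFactor + e.costFactor + 1)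
  | .seq P Q => P.timePoly + Q.timePoly
  | .ite e₁ e₂ P Q =>
    Polynomial.C (e₁.costFactor + e₂.costFactor + 1) + P.timePoly + Q.timePoly
  | .loop e₁ e₂ P =>
    (Polynomial.X + 1) * (Polynomial.C (e₁.costFactor + e₂.costFactor + 1) + P.timePoly)

/-- The arrays that a program may write to. -/
def Program.writes : Program → List ℕ
  | .skip => []
  | .assign a _ _ _ => [a]
  | .seq P Q => P.writes ++ Q.writes
  | .ite _ _ P Q => P.writes ++ Q.writes
  | .loop _ _ P => P.writes

theorem Runs.frame {P : Program} {μ μ' : Store} {t : ℕ} (h : Runs P μ μ' t) :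
    ∀ a, a ∉ P.writes → μ' a = μ a := by
  induction h with
  | skip μ => exact fun _ _ => rfl
  | assign μ a r c e =>
    intro a' ha'
    simp only [Program.writes, List.mem_singleton] at ha'
    funext r' c'
    simp [Store.write, ha']
  | seq _ _ h₁ h₂ =>
    intro a ha
    simp only [Program.writes, List.mem_append, not_or] at ha
    rw [h₂ a ha.2, h₁ a ha.1]
  | ite_true _ _ h₁ =>
    intro a ha
    simp only [Program.writes, List.mem_append, not_or] at ha
    exact h₁ a ha.1
  | ite_false _ _ h₁ =>
    intro a ha
    simp only [Program.writes, List.mem_append, not_or] at ha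
    exact h₁ a ha.2
  | loop_done _ => exact fun _ _ => rfl
  | loop_step _ _ _ h₁ h₂ =>
    intro a ha
    rw [h₂ a ha, h₁ a ha]

/-- Started with the memory `μ`, provided that its cells have at most `B` bits, the program `P`
halts with a memory that satisfies `Q` and whose cells have at most `B` bits, in time
`P.timePoly.eval N * B`. -/
def Exec (N B : ℕ) (μ : Store) (P : Program) (Q : Store → Prop) : Prop :=
  Small B μ → ∃ μ' t, Runs P μ μ' t ∧ t ≤ P.timePoly.eval N * B ∧ Small B μ' ∧ Q μ'

section Exec

variable {N B : ℕ} {μ : Store} {P P' : Program} {Q Q' : Store → Prop} {e e' : Expr}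

theorem Exec.mono (h : Exec N B μ P Q) (hQ : ∀ μ', Q μ' → Q' μ') : Exec N B μ P Q' := by
  intro hB
  obtain ⟨μ', t, h1, h2, h3, h4⟩ := h hB
  exact ⟨μ', t, h1, h2, h3, hQ _ h4⟩

/-- The arrays that a program does not write to are unchanged. -/
theorem Exec.frame (h : Exec N B μ P Q)
    (hQ : ∀ μ', Q μ' → (∀ a, a ∉ P.writes → μ' a = μ a) → Q' μ') : Exec N B μ P Q' := by
  intro hB
  obtain ⟨μ', t, h1, h2, h3, h4⟩ := h hB
  exact ⟨μ', t, h1, h2, h3, hQ _ h4 h1.frame⟩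

theorem Exec.skip (h : Q μ) : Exec N B μ .skip Q := by
  intro hB
  refine ⟨μ, 1, Runs.skip μ, ?_, hB, h⟩
  simpa [Program.timePoly] using hB.one_le

/-- The value that is written has to obey the bound on bit lengths; values that are read from the
memory do so automatically, see `Small.copy`. -/
theorem Exec.assign {a r' c' : ℕ} {r c : Expr} {v : ℚ} (hr : r.eval μ = r') (hc : c.eval μ = c')
    (he : e.eval μ = v) (hv : Small B μ → bitSize v ≤ B) (hQ : Q (μ.write a r' c' v)) :
    Exec N B μ (.assign a r c e) Q := by
  intro hB
  have h1 := Runs.assign μ a r c e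
  rw [hr, hc, he, Nat.floor_natCast, Nat.floor_natCast] at h1
  refine ⟨_, _, h1, ?_, ?_, hQ⟩
  · simp only [Program.timePoly, Polynomial.eval_C]
    have := r.cost_le hB
    have := c.cost_le hB
    have := e.cost_le hB
    have := hB.one_le
    nlinarith
  · intro a' r' c'
    unfold Store.write
    split_ifs
    · exact hv hB
    · exact hB _ _ _

theorem Exec.seq (h : Exec N B μ P fun μ' => Exec N B μ' P' Q) : Exec N B μ (.seq P P') Q := by
  intro hB
  obtain ⟨μ', t, h1, h2, h3, h4⟩ := h hB
  obtain ⟨μ'', t', h5, h6, h7, h8⟩ := h4 h3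
  refine ⟨μ'', t + t', h1.seq h5, ?_, h7, h8⟩
  simp only [Program.timePoly, Polynomial.eval_add]
  nlinarith

theorem Exec.ite (h1 : e.eval μ ≤ e'.eval μ → Exec N B μ P Q)
    (h2 : ¬ e.eval μ ≤ e'.eval μ → Exec N B μ P' Q) : Exec N B μ (.ite e e' P P') Q := by
  intro hB
  have := e.cost_le hB
  have := e'.cost_le hB
  have := hB.one_le
  simp only [Program.timePoly, Polynomial.eval_add, Polynomial.eval_C]
  by_cases h : e.eval μ ≤ e'.eval μ
  · obtain ⟨μ', t, h3, h4, h5, h6⟩ := h1 h hB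
    exact ⟨μ', _, Runs.ite_true h h3, by nlinarith, h5, h6⟩
  · obtain ⟨μ', t, h3, h4, h5, h6⟩ := h2 h hB
    exact ⟨μ', _, Runs.ite_false h h3, by nlinarith, h5, h6⟩

/-- The rule for while loops: the first argument of the invariant is a bound on the number of
remaining iterations. -/
theorem Exec.loop (Inv : ℕ → Store → Prop)
    (hbody : ∀ n μ, Inv n μ → e.eval μ ≤ e'.eval μ →
      Exec N B μ P fun μ' => ∃ n' < n, Inv n' μ')
    (hQ : ∀ n μ, Inv n μ → ¬ e.eval μ ≤ e'.eval μ → Q μ) {n₀ : ℕ} (hn₀ : n₀ ≤ N)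
    (h₀ : Inv n₀ μ) : Exec N B μ (.loop e e' P) Q := by
  set K := e.costFactor + e'.costFactor + 1 + P.timePoly.eval N with hK
  have key : ∀ n μ, Inv n μ → Small B μ → ∃ μ' t, Runs (.loop e e' P) μ μ' t ∧
      t ≤ (n + 1) * K * B ∧ Small B μ' ∧ Q μ' := by
    intro n
    induction n using Nat.strong_induction_on with
    | _ n ih =>
      intro μ hI hB
      have h1 := e.cost_le hB
      have h2 := e'.cost_le hB
      have h3 := hB.one_le
      by_cases h : e.eval μ ≤ e'.eval μ
      · obtain ⟨μ', t, h4, h5, h6, n', hn', h7⟩ := hbody n μ hI h hB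
        obtain ⟨μ'', t', h8, h9, h10, h11⟩ := ih n' hn' μ' h7 h6
        refine ⟨μ'', _, Runs.loop_step h h4 h8, ?_, h10, h11⟩
        have h12 : (n' + 1) * K * B ≤ n * K * B :=
          Nat.mul_le_mul_right _ (Nat.mul_le_mul_right _ hn')
        have h13 : (n + 1) * K * B = n * K * B + K * B := by ring
        have h14 : K * B = e.costFactor * B + e'.costFactor * B + B + P.timePoly.eval N * B := by
          rw [hK]; ring
        omega
      · refine ⟨μ, _, Runs.loop_done h, ?_, hB, hQ n μ hI h⟩
        have h13 : (n + 1) * K * B = n * K * B + K * B := by ring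
        have h14 : K * B = e.costFactor * B + e'.costFactor * B + B + P.timePoly.eval N * B := by
          rw [hK]; ring
        omega
  intro hB
  obtain ⟨μ', t, h1, h2, h3, h4⟩ := key n₀ μ h₀ hB
  refine ⟨μ', t, h1, h2.trans ?_, h3, h4⟩
  simp only [Program.timePoly, Polynomial.eval_add, Polynomial.eval_mul, Polynomial.eval_C,
    Polynomial.eval_X, Polynomial.eval_one]
  exact Nat.mul_le_mul_right _ (Nat.mul_le_mul_right _ (by omega))

/-- The scalar variable `a` is kept in the first cell of the array `a`. -/
def scalar (a : ℕ) : Expr := .read a (.lit 0) (.lit 0)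

/-- The entry of a vector, which is kept in the first row of an array. -/
def entry (a : ℕ) (c : Expr) : Expr := .read a (.lit 0) c

/-- Assignment to a scalar variable. -/
def setScalar (a : ℕ) (e : Expr) : Program := .assign a (.lit 0) (.lit 0) e

/-- Assignment to an entry of a vector. -/
def setEntry (a : ℕ) (c e : Expr) : Program := .assign a (.lit 0) c e

/-- A loop over `v = 0, …, e - 1`. -/
def forLoop (v : ℕ) (e : Expr) (P : Program) : Program :=
  .seq (setScalar v (.lit 0))
    (.loop (.add (scalar v) (.lit 1)) e (.seq P (setScalar v (.add (scalar v) (.lit 1)))))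

/-- Conditional execution under the condition `e ≤ e'`. -/
def whenLe (e e' : Expr) (P : Program) : Program := .ite e e' P .skip

/-- Conditional execution under the condition `e < e'`. -/
def whenLt (e e' : Expr) (P : Program) : Program := .ite e' e .skip P

/-- A case distinction whether `e = e'`. -/
def iteEq (e e' : Expr) (P P' : Program) : Program := .ite e e' (.ite e' e P P') P'

/-- Conditional execution under the condition `e = e'`. -/
def whenEq (e e' : Expr) (P : Program) : Program := iteEq e e' P .skip

/-- Conditional execution under the condition `e ≠ e'`. -/
def whenNe (e e' : Expr) (P : Program) : Program := iteEq e e' .skip P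

@[simp] theorem eval_lit (q : ℚ) : (Expr.lit q).eval μ = q := rfl

@[simp] theorem eval_add : (Expr.add e e').eval μ = e.eval μ + e'.eval μ := rfl

@[simp] theorem eval_sub : (Expr.sub e e').eval μ = e.eval μ - e'.eval μ := rfl

@[simp] theorem eval_mul : (Expr.mul e e').eval μ = e.eval μ * e'.eval μ := rfl

@[simp] theorem eval_scalar (a : ℕ) : (scalar a).eval μ = μ a 0 0 := by
  simp [scalar, Expr.eval]

theorem eval_read {a r' c' : ℕ} {r c : Expr} (hr : r.eval μ = r') (hc : c.eval μ = c') :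
    (Expr.read a r c).eval μ = μ a r' c' := by
  simp [Expr.eval, hr, hc]

theorem eval_entry {a c' : ℕ} {c : Expr} (hc : c.eval μ = c') :
    (entry a c).eval μ = μ a 0 c' := by
  simp [entry, Expr.eval, hc]

theorem Exec.setScalar {a : ℕ} {v : ℚ} (he : e.eval μ = v) (hv : Small B μ → bitSize v ≤ B)
    (hQ : Q (μ.write a 0 0 v)) : Exec N B μ (setScalar a e) Q :=
  Exec.assign (by simp) (by simp) he hv hQ

theorem Exec.setEntry {a c' : ℕ} {c : Expr} {v : ℚ} (hc : c.eval μ = c') (he : e.eval μ = v)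
    (hv : Small B μ → bitSize v ≤ B) (hQ : Q (μ.write a 0 c' v)) :
    Exec N B μ (setEntry a c e) Q :=
  Exec.assign (by simp) hc he hv hQ

theorem Exec.whenLe (h1 : e.eval μ ≤ e'.eval μ → Exec N B μ P Q)
    (h2 : ¬ e.eval μ ≤ e'.eval μ → Q μ) : Exec N B μ (whenLe e e' P) Q :=
  Exec.ite h1 fun h => Exec.skip (h2 h)

theorem Exec.whenLt (h1 : e.eval μ < e'.eval μ → Exec N B μ P Q)
    (h2 : ¬ e.eval μ < e'.eval μ → Q μ) : Exec N B μ (whenLt e e' P) Q :=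
  Exec.ite (fun h => Exec.skip (h2 (not_lt.mpr h))) fun h => h1 (not_le.mp h)

theorem Exec.iteEq (h1 : e.eval μ = e'.eval μ → Exec N B μ P Q)
    (h2 : e.eval μ ≠ e'.eval μ → Exec N B μ P' Q) : Exec N B μ (iteEq e e' P P') Q :=
  Exec.ite (fun h => Exec.ite (fun h' => h1 (le_antisymm h h'))
    fun h' => h2 fun he => h' he.ge) fun h => h2 fun he => h he.le

theorem Exec.whenEq (h1 : e.eval μ = e'.eval μ → Exec N B μ P Q)
    (h2 : e.eval μ ≠ e'.eval μ → Q μ) : Exec N B μ (whenEq e e' P) Q :=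
  Exec.iteEq h1 fun h => Exec.skip (h2 h)

theorem Exec.whenNe (h1 : e.eval μ ≠ e'.eval μ → Exec N B μ P Q)
    (h2 : e.eval μ = e'.eval μ → Q μ) : Exec N B μ (whenNe e e' P) Q :=
  Exec.iteEq (fun h => Exec.skip (h2 h)) h1

/-- The rule for loops over `v = 0, …, n - 1`. The invariant must not depend on `v`; the arrays
that the loop does not write to are known to be unchanged. -/
theorem Exec.forLoop {v n : ℕ} (J : ℕ → Store → Prop) (hn : n ≤ N)
    (hbits : ∀ k ≤ n, bitSize (k : ℚ) ≤ B) (hv : v ∉ P.writes)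
    (he : ∀ μ', (∀ a, a ∉ P.writes → a ≠ v → μ' a = μ a) → e.eval μ' = n)
    (hJ : ∀ k μ' q, J k μ' → J k (μ'.write v 0 0 q)) (h₀ : J 0 μ)
    (hbody : ∀ k μ', k < n → (∀ a, a ∉ P.writes → a ≠ v → μ' a = μ a) → μ' v 0 0 = (k : ℚ) → J k μ' →
      Exec N B μ' P (J (k + 1)))
    (hQ : ∀ μ', (∀ a, a ∉ P.writes → a ≠ v → μ' a = μ a) → J n μ' → Q μ') :
    Exec N B μ (forLoop v e P) Q := by
  have hw : ∀ (μ' : Store) q a, a ≠ v → (μ'.write v 0 0 q) a = μ' a := by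
    intro μ' q a ha
    funext r c
    simp [Store.write, ha]
  refine Exec.seq (Exec.setScalar (v := 0) rfl (fun _ => by simpa using hbits 0 (by omega)) ?_)
  refine Exec.loop (fun d μ' => ∃ k : ℕ, k + d = n ∧ μ' v 0 0 = k ∧
    (∀ a, a ∉ P.writes → a ≠ v → μ' a = μ a) ∧ J k μ') ?_ ?_ hn ?_
  · rintro d μ' ⟨k, hk, hvk, hfr, hJk⟩ hle
    rw [he μ' hfr] at hle
    simp only [eval_add, eval_scalar, hvk, eval_lit] at hle
    have hlt : k < n := by
      have : ((k + 1 : ℕ) : ℚ) ≤ n := by push_cast; exact hle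
      exact_mod_cast this
    refine Exec.seq ((hbody k μ' hlt hfr hvk hJk).frame fun μ'' hJ' hfr' => ?_)
    have hv'' : μ'' v 0 0 = k := by rw [hfr' v hv, hvk]
    refine Exec.setScalar (v := ((k + 1 : ℕ) : ℚ)) (by simp [hv'']) (fun _ => hbits _ hlt) ?_
    refine ⟨d - 1, by omega, k + 1, by omega, by simp [Store.write], fun a ha hav => ?_,
      hJ _ _ _ hJ'⟩
    rw [hw _ _ a hav, hfr' a ha, hfr a ha hav]
  · rintro d μ' ⟨k, hk, hvk, hfr, hJk⟩ hle
    rw [he μ' hfr] at hle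
    simp only [eval_add, eval_scalar, hvk, eval_lit] at hle
    have hge : n ≤ k := by
      by_contra hlt
      apply hle
      have : ((k + 1 : ℕ) : ℚ) ≤ n := by exact_mod_cast (by omega : k + 1 ≤ n)
      push_cast at this
      exact this
    obtain rfl : k = n := by omega
    exact hQ μ' hfr hJk
  · exact ⟨0, by omega, by simp [Store.write], fun a _ hav => hw _ _ a hav, hJ _ _ _ h₀⟩

end Exec

/-! ### The program that cancels cycles -/

/-- Choose an unprocessed vertex `b` that extends the path, and the sentinel `V` if there is none.
The arrays from number `o` on are: the residual capacities, the ranks, the parents, the path, its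
length, the number of unprocessed vertices, the variables `b`, `s`, `λ`, two loop variables,
and `V`. -/
def findNext (o : ℕ) : Program :=
  .seq (setScalar (o + 6) (scalar (o + 11)))
    (forLoop (o + 9) (scalar (o + 11))
      (whenLe (entry (o + 1) (scalar (o + 9))) (.lit 0)
        (.ite (scalar (o + 4)) (.lit 0) (setScalar (o + 6) (scalar (o + 9)))
          (whenLt (.lit 0) (.read o (entry (o + 3) (scalar (o + 4))) (scalar (o + 9)))
            (whenLt (.lit 0) (.read o (scalar (o + 9)) (entry (o + 3) (scalar (o + 4))))
              (whenNe (scalar (o + 9)) (entry (o + 3) (.sub (scalar (o + 4)) (.lit 1)))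
                (setScalar (o + 6) (scalar (o + 9)))))))))

/-- Append `b` to the path and find its previous position `s` on the path (`0` if it is new). -/
def findRepeat (o : ℕ) : Program :=
  .seq (setEntry (o + 3) (.add (scalar (o + 4)) (.lit 1)) (scalar (o + 6)))
    (.seq (setScalar (o + 7) (.lit 0))
      (forLoop (o + 10) (scalar (o + 4))
        (whenEq (entry (o + 3) (.add (scalar (o + 10)) (.lit 1))) (scalar (o + 6))
          (setScalar (o + 7) (.add (scalar (o + 10)) (.lit 1))))))

/-- The capacity of the `r`-th pair of the path, where `r` is the loop variable plus one. -/
def pathCap (o : ℕ) : Expr :=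
  .read o (entry (o + 3) (.add (scalar (o + 10)) (.lit 1)))
    (entry (o + 3) (.add (scalar (o + 10)) (.lit 2)))

/-- Compute the bottleneck capacity `λ` of the cycle. -/
def findMin (o : ℕ) : Program :=
  .seq (setScalar (o + 8) (.read o (entry (o + 3) (scalar (o + 4)))
      (entry (o + 3) (.add (scalar (o + 4)) (.lit 1)))))
    (forLoop (o + 10) (scalar (o + 4))
      (whenLe (scalar (o + 7)) (.add (scalar (o + 10)) (.lit 1))
        (whenLe (pathCap o) (scalar (o + 8)) (setScalar (o + 8) (pathCap o)))))

/-- Push `λ` around the cycle. -/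
def pushCycle (o : ℕ) : Program :=
  forLoop (o + 10) (scalar (o + 4))
    (whenLe (scalar (o + 7)) (.add (scalar (o + 10)) (.lit 1))
      (.seq (.assign o (entry (o + 3) (.add (scalar (o + 10)) (.lit 1)))
          (entry (o + 3) (.add (scalar (o + 10)) (.lit 2)))
          (.sub (pathCap o) (scalar (o + 8))))
        (.assign o (entry (o + 3) (.add (scalar (o + 10)) (.lit 2)))
          (entry (o + 3) (.add (scalar (o + 10)) (.lit 1)))
          (.add (.read o (entry (o + 3) (.add (scalar (o + 10)) (.lit 2)))
            (entry (o + 3) (.add (scalar (o + 10)) (.lit 1)))) (scalar (o + 8))))))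

/-- Process the last vertex of the path. -/
def peelLast (o : ℕ) : Program :=
  .seq (setEntry (o + 1) (entry (o + 3) (scalar (o + 4))) (scalar (o + 5)))
    (.seq (setEntry (o + 2) (entry (o + 3) (scalar (o + 4)))
        (entry (o + 3) (.sub (scalar (o + 4)) (.lit 1))))
      (.seq (setScalar (o + 5) (.sub (scalar (o + 5)) (.lit 1)))
        (setScalar (o + 4) (.sub (scalar (o + 4)) (.lit 1)))))

/-- One step of the search for cycles. -/
def searchStep (o : ℕ) : Program :=
  .seq (findNext o)
    (.ite (scalar (o + 11)) (scalar (o + 6)) (peelLast o)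
      (.seq (findRepeat o)
        (.ite (scalar (o + 7)) (.lit 0)
          (setScalar (o + 4) (.add (scalar (o + 4)) (.lit 1)))
          (.seq (findMin o) (.seq (pushCycle o) (setScalar (o + 4) (.lit 0)))))))

/-- Cancel all cycles of the graph whose number of vertices is given in the array `o + 11`. -/
def cancelCycles (o : ℕ) : Program :=
  .seq (setEntry (o + 3) (.lit 0) (scalar (o + 11)))
    (.seq (setEntry (o + 2) (scalar (o + 11)) (scalar (o + 11)))
      (.seq (setScalar (o + 5) (scalar (o + 11)))
        (.loop (.lit 1) (scalar (o + 5)) (searchStep o))))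

/-- The memory holds a state of the search. -/
structure HoldsState (o : ℕ) (μ : Store) (V : ℕ) (rk par P : ℕ → ℕ) (len cnt : ℕ) : Prop where
  rk : ∀ a, μ (o + 1) 0 a = rk a
  par : ∀ a, μ (o + 2) 0 a = par a
  path : ∀ r, μ (o + 3) 0 r = P r
  len : μ (o + 4) 0 0 = len
  cnt : μ (o + 5) 0 0 = cnt
  V : μ (o + 11) 0 0 = V

section

variable {N B o V : ℕ} {μ : Store} {rk par P : ℕ → ℕ} {len cnt : ℕ}

theorem HoldsState.congr {μ' : Store} (h : HoldsState o μ V rk par P len cnt)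
    (h1 : μ' (o + 1) = μ (o + 1)) (h2 : μ' (o + 2) = μ (o + 2)) (h3 : μ' (o + 3) = μ (o + 3))
    (h4 : μ' (o + 4) = μ (o + 4)) (h5 : μ' (o + 5) = μ (o + 5)) (h6 : μ' (o + 11) = μ (o + 11)) :
    HoldsState o μ' V rk par P len cnt :=
  ⟨h1 ▸ h.rk, h2 ▸ h.par, h3 ▸ h.path, h4 ▸ h.len, h5 ▸ h.cnt, h6 ▸ h.V⟩

/-- The vertices that extend a path. -/
def Extends (y : ℕ → ℕ → ℚ) (rk P : ℕ → ℕ) (len a : ℕ) : Prop :=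
  rk a = 0 ∧ (1 ≤ len → Free y (P len) a ∧ a ≠ P (len - 1))

theorem exec_findNext (hs : HoldsState o μ V rk par P len cnt) (hVN : V ≤ N)
    (hbits : ∀ k ≤ V + 1, bitSize (k : ℚ) ≤ B) :
    Exec N B μ (findNext o) fun μ' => HoldsState o μ' V rk par P len cnt ∧ μ' o = μ o ∧
      ∃ b : ℕ, μ' (o + 6) 0 0 = b ∧
        ((b = V ∧ ∀ a < V, ¬ Extends (μ o) rk P len a) ∨
          (b < V ∧ Extends (μ o) rk P len b)) := by
  refine Exec.frame (Q := fun μ' => ∃ b : ℕ, μ' (o + 6) 0 0 = b ∧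
        ((b = V ∧ ∀ a < V, ¬ Extends (μ o) rk P len a) ∨
          (b < V ∧ Extends (μ o) rk P len b))) ?_ fun μ' hQ hfr => ⟨?_, ?_, hQ⟩
  · refine Exec.seq (Exec.setScalar (v := V) (by simpa using hs.V) (fun _ => hbits V (by omega)) ?_)
    have hs' : HoldsState o (μ.write (o + 6) 0 0 V) V rk par P len cnt := by
      refine hs.congr ?_ ?_ ?_ ?_ ?_ ?_ <;> funext r c <;> simp [Store.write]
    have ho : (μ.write (o + 6) 0 0 (V : ℚ)) o = μ o := by
      funext r c; simp [Store.write]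
    have hb0 : (μ.write (o + 6) 0 0 (V : ℚ)) (o + 6) 0 0 = V := by simp [Store.write]
    generalize μ.write (o + 6) 0 0 (V : ℚ) = ν at hs' ho hb0
    rw [← ho]
    clear ho hs
    refine Exec.forLoop (n := V) (fun k μ' => ∃ b : ℕ, μ' (o + 6) 0 0 = b ∧
        ((b = V ∧ ∀ a < k, ¬ Extends (ν o) rk P len a) ∨
          (b < V ∧ Extends (ν o) rk P len b))) hVN (fun k hk => hbits k (by omega)) ?_ ?_ ?_ ?_ ?_ ?_
    · simp [whenLe, whenLt, whenNe, iteEq, setScalar, Program.writes]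
    · intro μ' hfr
      rw [eval_scalar, hfr (o + 11) (by simp [whenLe, whenLt, whenNe, iteEq, setScalar, Program.writes])
        (by omega)]
      exact hs'.V
    · intro k μ' q hJ
      simpa [Store.write] using hJ
    · exact ⟨V, hb0, Or.inl ⟨rfl, by omega⟩⟩
    · intro k μ' hk hfr hvk hJ
      have f : ∀ a, a ≠ 6 → a ≠ 9 → μ' (o + a) = ν (o + a) := fun a h6 h9 =>
        hfr (o + a) (by simp [whenLe, whenLt, whenNe, iteEq, setScalar, Program.writes, h6]) (by omega)
      have hlen : (scalar (o + 4)).eval μ' = (len : ℕ) := by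
        rw [eval_scalar, f 4 (by omega) (by omega)]; exact hs'.len
      have hk' : (scalar (o + 9)).eval μ' = (k : ℕ) := by rw [eval_scalar, hvk]
      have hcur : (entry (o + 3) (scalar (o + 4))).eval μ' = (P len : ℕ) := by
        rw [eval_entry hlen, f 3 (by omega) (by omega)]; exact hs'.path _
      have hrk : (entry (o + 1) (scalar (o + 9))).eval μ' = (rk k : ℕ) := by
        rw [eval_entry hk', f 1 (by omega) (by omega)]; exact hs'.rk _
      have h0 : μ' o = ν o := f 0 (by omega) (by omega)
      have hy1 : (Expr.read o (entry (o + 3) (scalar (o + 4))) (scalar (o + 9))).eval μ' =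
          ν o (P len) k := by rw [eval_read hcur hk', h0]
      have hy2 : (Expr.read o (scalar (o + 9)) (entry (o + 3) (scalar (o + 4)))).eval μ' =
          ν o k (P len) := by rw [eval_read hk' hcur, h0]
      have hset : Extends (ν o) rk P len k → Exec N B μ' (setScalar (o + 6) (scalar (o + 9)))
          fun μ' => ∃ b : ℕ, μ' (o + 6) 0 0 = b ∧
          ((b = V ∧ ∀ a < k + 1, ¬ Extends (ν o) rk P len a) ∨
          (b < V ∧ Extends (ν o) rk P len b)) := fun hE =>
        Exec.setScalar hk' (fun _ => hbits k (by omega))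
          ⟨k, by simp [Store.write], Or.inr ⟨hk, hE⟩⟩
      have hskip : ¬ Extends (ν o) rk P len k → ∃ b : ℕ, μ' (o + 6) 0 0 = b ∧
          ((b = V ∧ ∀ a < k + 1, ¬ Extends (ν o) rk P len a) ∨
          (b < V ∧ Extends (ν o) rk P len b)) := by
        intro hE
        obtain ⟨b, hb, ⟨hb1, hb2⟩ | hb1⟩ := hJ
        · refine ⟨b, hb, Or.inl ⟨hb1, fun a ha => ?_⟩⟩
          rcases Nat.lt_succ_iff_lt_or_eq.mp ha with h1 | rfl
          · exact hb2 a h1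
          · exact hE
        · exact ⟨b, hb, Or.inr hb1⟩
      refine Exec.whenLe (fun h1 => ?_) fun h1 => hskip fun hE => h1 ?_
      · rw [hrk, eval_lit] at h1
        have hrk0 : rk k = 0 := by
          have : rk k ≤ 0 := by exact_mod_cast h1
          omega
        refine Exec.ite (fun h2 => ?_) fun h2 => ?_
        · rw [hlen, eval_lit] at h2
          have : len ≤ 0 := by exact_mod_cast h2
          exact hset ⟨hrk0, by omega⟩
        · rw [hlen, eval_lit] at h2
          have hl : 1 ≤ len := by
            by_contra hc
            apply h2
            have : len = 0 := by omega
            simp [this]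
          have hprev : (entry (o + 3) (.sub (scalar (o + 4)) (.lit 1))).eval μ' =
              (P (len - 1) : ℕ) := by
            rw [eval_entry (c' := len - 1), f 3 (by omega) (by omega)]
            · exact hs'.path _
            · rw [eval_sub, hlen, eval_lit]
              push_cast [hl]
              ring
          refine Exec.whenLt (fun h3 => ?_) fun h3 => hskip fun hE => h3 ?_
          · refine Exec.whenLt (fun h4 => ?_) fun h4 => hskip fun hE => h4 ?_
            · rw [eval_lit, hy1] at h3
              rw [eval_lit, hy2] at h4
              refine Exec.whenNe (fun h5 => hset ⟨hrk0, fun _ => ⟨⟨h3, h4⟩, ?_⟩⟩)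
                fun h5 => hskip fun hE => (hE.2 hl).2 ?_
              · rintro rfl
                exact h5 (by rw [hprev, hk'])
              · rw [hprev, hk'] at h5
                exact_mod_cast h5
            · rw [eval_lit, hy2]
              exact (hE.2 hl).1.2
          · rw [eval_lit, hy1]
            exact (hE.2 hl).1.1
      · rw [hrk, hE.1]
        simp
    · intro μ' _ hJ
      exact hJ
  · refine hs.congr ?_ ?_ ?_ ?_ ?_ ?_ <;> refine hfr _ ?_ <;>
      simp [findNext, forLoop, whenLe, whenLt, whenNe, iteEq, setScalar, Program.writes]
  · refine hfr _ ?_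
    simp [findNext, forLoop, whenLe, whenLt, whenNe, iteEq, setScalar, Program.writes]

theorem exec_findRepeat {b : ℕ} (hs : HoldsState o μ V rk par P len cnt) (hlV : len ≤ V)
    (hVN : V ≤ N) (hbits : ∀ k ≤ V + 1, bitSize (k : ℚ) ≤ B) (hb : μ (o + 6) 0 0 = b)
    (hbV : b ≤ V) :
    Exec N B μ (findRepeat o) fun μ' =>
      HoldsState o μ' V rk par (Function.update P (len + 1) b) len cnt ∧ μ' o = μ o ∧
      ∃ s : ℕ, μ' (o + 7) 0 0 = s ∧
        ((s = 0 ∧ ∀ r, 1 ≤ r → r ≤ len → P r ≠ b) ∨ (1 ≤ s ∧ s ≤ len ∧ P s = b)) := by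
  set P' := Function.update P (len + 1) b with hP'
  refine Exec.seq (Exec.setEntry (c' := len + 1) (v := b) (by simp [hs.len]) (by simp [hb])
    (fun _ => hbits b (by omega)) ?_)
  have hs1 : HoldsState o (μ.write (o + 3) 0 (len + 1) b) V rk par P' len cnt := by
    refine ⟨?_, ?_, ?_, ?_, ?_, ?_⟩
    · simpa [Store.write] using hs.rk
    · simpa [Store.write] using hs.par
    · intro r
      by_cases hr : r = len + 1
      · simp [Store.write, hr, hP']
      · simp [Store.write, hr, hP', hs.path]
    · simpa [Store.write] using hs.len
    · simpa [Store.write] using hs.cnt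
    · simpa [Store.write] using hs.V
  have ho : (μ.write (o + 3) 0 (len + 1) (b : ℚ)) o = μ o := by
    funext r c; simp [Store.write]
  have hb1 : (μ.write (o + 3) 0 (len + 1) (b : ℚ)) (o + 6) 0 0 = b := by
    simp [Store.write, hb]
  generalize μ.write (o + 3) 0 (len + 1) (b : ℚ) = ν at hs1 ho hb1
  rw [← ho]
  clear ho hs hb
  refine Exec.frame (Q := fun μ' => ∃ s : ℕ, μ' (o + 7) 0 0 = s ∧
    ((s = 0 ∧ ∀ r, 1 ≤ r → r ≤ len → P r ≠ b) ∨ (1 ≤ s ∧ s ≤ len ∧ P s = b))) ?_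
    fun μ' hQ hfr => ⟨?_, ?_, hQ⟩
  · refine Exec.seq (Exec.setScalar (v := (0 : ℕ)) (by simp) (fun _ => hbits 0 (by omega)) ?_)
    have hs2 : HoldsState o (ν.write (o + 7) 0 0 (0 : ℕ)) V rk par P' len cnt := by
      refine hs1.congr ?_ ?_ ?_ ?_ ?_ ?_ <;> funext r c <;> simp [Store.write]
    have hb2 : (ν.write (o + 7) 0 0 (0 : ℕ)) (o + 6) 0 0 = b := by simp [Store.write, hb1]
    have hs0 : (ν.write (o + 7) 0 0 (0 : ℕ)) (o + 7) 0 0 = (0 : ℕ) := by simp [Store.write]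
    generalize ν.write (o + 7) 0 0 ((0 : ℕ) : ℚ) = ν' at hs2 hb2 hs0
    refine Exec.forLoop (n := len) (fun k μ' => ∃ s : ℕ, μ' (o + 7) 0 0 = s ∧
      ((s = 0 ∧ ∀ r, 1 ≤ r → r ≤ k → P r ≠ b) ∨ (1 ≤ s ∧ s ≤ len ∧ P s = b)))
      (by omega) (fun k hk => hbits k (by omega)) ?_ ?_ ?_ ?_ ?_ ?_
    · simp [whenEq, iteEq, setScalar, Program.writes]
    · intro μ' hfr
      rw [eval_scalar, hfr (o + 4) (by simp [whenEq, iteEq, setScalar, Program.writes])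
        (by omega)]
      exact hs2.len
    · intro k μ' q hJ
      simpa [Store.write] using hJ
    · exact ⟨0, hs0, Or.inl ⟨rfl, by omega⟩⟩
    · intro k μ' hk hfr hvk hJ
      have f : ∀ a, a ≠ 7 → a ≠ 10 → μ' (o + a) = ν' (o + a) := fun a h7 h10 =>
        hfr (o + a) (by simp [whenEq, iteEq, setScalar, Program.writes, h7]) (by omega)
      have hk1 : (Expr.add (scalar (o + 10)) (.lit 1)).eval μ' = (k + 1 : ℕ) := by
        simp [hvk]
      have hPk : (entry (o + 3) (.add (scalar (o + 10)) (.lit 1))).eval μ' = (P (k + 1) : ℕ) := by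
        rw [eval_entry hk1, f 3 (by omega) (by omega), hs2.path, hP',
          Function.update_of_ne (by omega)]
      have hb' : (scalar (o + 6)).eval μ' = b := by
        rw [eval_scalar, f 6 (by omega) (by omega), hb2]
      refine Exec.whenEq (fun h1 => ?_) fun h1 => ?_
      · rw [hPk, hb'] at h1
        have h2 : P (k + 1) = b := by exact_mod_cast h1
        exact Exec.setScalar hk1 (fun _ => hbits _ (by omega))
          ⟨k + 1, by simp [Store.write], Or.inr ⟨by omega, hk, h2⟩⟩
      · rw [hPk, hb'] at h1
        have h2 : P (k + 1) ≠ b := by exact_mod_cast h1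
        obtain ⟨s, hs, ⟨h3, h4⟩ | h3⟩ := hJ
        · refine ⟨s, hs, Or.inl ⟨h3, fun r hr1 hr2 => ?_⟩⟩
          rcases Nat.le_succ_iff.mp hr2 with h5 | rfl
          · exact h4 r hr1 h5
          · exact h2
        · exact ⟨s, hs, Or.inr h3⟩
    · intro μ' _ hJ
      exact hJ
  · refine hs1.congr ?_ ?_ ?_ ?_ ?_ ?_ <;> refine hfr _ ?_ <;>
      simp [forLoop, whenEq, iteEq, setScalar, Program.writes]
  · refine hfr _ ?_
    simp [forLoop, whenEq, iteEq, setScalar, Program.writes]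

theorem exec_findMin {s : ℕ} (hs : HoldsState o μ V rk par P len cnt) (hlV : len ≤ V)
    (hVN : V ≤ N) (hbits : ∀ k ≤ V + 1, bitSize (k : ℚ) ≤ B) (hs7 : μ (o + 7) 0 0 = s)
    (hs1 : 1 ≤ s) (hsl : s ≤ len) :
    Exec N B μ (findMin o) fun μ' =>
      HoldsState o μ' V rk par P len cnt ∧ μ' o = μ o ∧ μ' (o + 7) 0 0 = s ∧
      (∀ q, s ≤ q → q < len + 1 → μ' (o + 8) 0 0 ≤ μ o (P q) (P (q + 1))) ∧
      ∃ q, s ≤ q ∧ q < len + 1 ∧ μ' (o + 8) 0 0 = μ o (P q) (P (q + 1)) := by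
  refine Exec.frame (Q := fun μ' =>
      (∀ q, s ≤ q → q < len + 1 → μ' (o + 8) 0 0 ≤ μ o (P q) (P (q + 1))) ∧
      ∃ q, s ≤ q ∧ q < len + 1 ∧ μ' (o + 8) 0 0 = μ o (P q) (P (q + 1))) ?_
    fun μ' hQ hfr => ⟨?_, ?_, ?_, hQ⟩
  · have hlen : (scalar (o + 4)).eval μ = (len : ℕ) := by rw [eval_scalar]; exact hs.len
    have hcur : (entry (o + 3) (scalar (o + 4))).eval μ = (P len : ℕ) := by
      rw [eval_entry hlen]; exact hs.path _
    have hnext : (entry (o + 3) (.add (scalar (o + 4)) (.lit 1))).eval μ = (P (len + 1) : ℕ) := by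
      rw [eval_entry (c' := len + 1)]
      · exact hs.path _
      · simp [hs.len]
    refine Exec.seq (Exec.setScalar (eval_read hcur hnext) (fun hB => hB _ _ _) ?_)
    set lam := μ o (P len) (P (len + 1)) with hlam
    have hs' : HoldsState o (μ.write (o + 8) 0 0 lam) V rk par P len cnt := by
      refine hs.congr ?_ ?_ ?_ ?_ ?_ ?_ <;> funext r c <;> simp [Store.write]
    have ho : (μ.write (o + 8) 0 0 lam) o = μ o := by
      funext r c; simp [Store.write]
    have h7 : (μ.write (o + 8) 0 0 lam) (o + 7) 0 0 = s := by simp [Store.write, hs7]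
    have h8 : (μ.write (o + 8) 0 0 lam) (o + 8) 0 0 = lam := by simp [Store.write]
    generalize μ.write (o + 8) 0 0 lam = ν at hs' ho h7 h8
    refine Exec.forLoop (n := len) (fun k μ' =>
      (∀ q, s ≤ q → q < k + 1 → μ' (o + 8) 0 0 ≤ μ o (P q) (P (q + 1))) ∧
      μ' (o + 8) 0 0 ≤ lam ∧
      ∃ q, s ≤ q ∧ q < len + 1 ∧ μ' (o + 8) 0 0 = μ o (P q) (P (q + 1)))
      (by omega) (fun k hk => hbits k (by omega)) ?_ ?_ ?_ ?_ ?_ ?_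
    · simp [whenLe, setScalar, Program.writes]
    · intro μ' hfr
      rw [eval_scalar, hfr (o + 4) (by simp [whenLe, setScalar, Program.writes]) (by omega)]
      exact hs'.len
    · intro k μ' q hJ
      simpa [Store.write] using hJ
    · exact ⟨fun q h1 h2 => by omega, h8.le, len, hsl, by omega, h8⟩
    · intro k μ' hk hfr hvk ⟨hJ1, hJ2, hJ3⟩
      have f : ∀ a, a ≠ 8 → a ≠ 10 → μ' (o + a) = ν (o + a) := fun a h8 h10 =>
        hfr (o + a) (by simp [whenLe, setScalar, Program.writes, h8]) (by omega)
      have hk1 : (Expr.add (scalar (o + 10)) (.lit 1)).eval μ' = (k + 1 : ℕ) := by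
        simp [hvk]
      have h0 : μ' o = ν o := f 0 (by omega) (by omega)
      have hcap : (pathCap o).eval μ' = μ o (P (k + 1)) (P (k + 1 + 1)) := by
        rw [pathCap, eval_read (r' := P (k + 1)) (c' := P (k + 1 + 1)), h0, ho]
        · rw [eval_entry hk1, f 3 (by omega) (by omega)]
          exact hs'.path _
        · rw [eval_entry (c' := k + 1 + 1), f 3 (by omega) (by omega)]
          · exact hs'.path _
          · simp only [eval_add, eval_scalar, eval_lit, hvk]
            push_cast
            ring
      have hs8 : (scalar (o + 7)).eval μ' = (s : ℕ) := by
        rw [eval_scalar, f 7 (by omega) (by omega), h7]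
      have hl8 : (scalar (o + 8)).eval μ' = μ' (o + 8) 0 0 := eval_scalar _
      refine Exec.whenLe (fun h1 => ?_) fun h1 => ?_
      · rw [hs8, hk1] at h1
        have h2 : s ≤ k + 1 := by exact_mod_cast h1
        refine Exec.whenLe (fun h3 => ?_) fun h3 => ?_
        · rw [hcap, hl8] at h3
          refine Exec.setScalar hcap (fun hB => ?_) ?_
          · rw [← ho, ← h0]
            exact hB _ _ _
          · have hw : ∀ v, μ'.write (o + 8) 0 0 v (o + 8) 0 0 = v := by simp [Store.write]
            rw [hw]
            refine ⟨fun q hq1 hq2 => ?_, h3.trans hJ2, k + 1, h2, by omega, rfl⟩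
            rcases Nat.lt_succ_iff_lt_or_eq.mp hq2 with h4 | rfl
            · exact h3.trans (hJ1 q hq1 h4)
            · exact le_rfl
        · rw [hcap, hl8] at h3
          refine ⟨fun q hq1 hq2 => ?_, hJ2, hJ3⟩
          rcases Nat.lt_succ_iff_lt_or_eq.mp hq2 with h4 | rfl
          · exact hJ1 q hq1 h4
          · exact (not_le.mp h3).le
      · rw [hs8, hk1] at h1
        have h2 : ¬ s ≤ k + 1 := fun h => h1 (by exact_mod_cast h)
        exact ⟨fun q hq1 hq2 => by omega, hJ2, hJ3⟩
    · intro μ' _ hJ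
      exact ⟨hJ.1, hJ.2.2⟩
  · refine hs.congr ?_ ?_ ?_ ?_ ?_ ?_ <;> refine hfr _ ?_ <;>
      simp [findMin, forLoop, whenLe, setScalar, Program.writes]
  · refine hfr _ ?_
    simp [findMin, forLoop, whenLe, setScalar, Program.writes]
  · rw [hfr _ ?_, hs7]
    simp [findMin, forLoop, whenLe, setScalar, Program.writes]

theorem exec_pushCycle {s : ℕ} {c : ℚ} (hs : HoldsState o μ V rk par P len cnt) (hlV : len ≤ V)
    (hVN : V ≤ N) (hbits : ∀ k ≤ V + 1, bitSize (k : ℚ) ≤ B) (hs7 : μ (o + 7) 0 0 = s)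
    (hs8 : μ (o + 8) 0 0 = c) (hs1 : 1 ≤ s) (hsl : s ≤ len)
    (hne : ∀ q, s ≤ q → q < len + 1 → P q ≠ P (q + 1))
    (hB : ∀ t ≤ len + 1, ∀ a b, bitSize (pushed (μ o) P c s t a b) ≤ B) :
    Exec N B μ (pushCycle o) fun μ' =>
      HoldsState o μ' V rk par P len cnt ∧ μ' o = pushed (μ o) P c s (len + 1) := by
  have hfr0 : ∀ μ' : Store, (∀ a, a ∉ (pushCycle o).writes → μ' a = μ a) →
      ∀ a, a ≠ 0 → a ≠ 10 → μ' (o + a) = μ (o + a) := by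
    intro μ' hfr a h1 h2
    refine hfr _ ?_
    simp [pushCycle, forLoop, whenLe, setScalar, Program.writes, h1, h2]
  refine Exec.frame (Q := fun μ' => μ' o = pushed (μ o) P c s (len + 1)) ?_
    fun μ' hQ hfr => ⟨?_, hQ⟩
  · refine Exec.forLoop (n := len) (fun k μ' => μ' o = pushed (μ o) P c s (max s (k + 1)))
      (by omega) (fun k hk => hbits k (by omega)) ?_ ?_ ?_ ?_ ?_ ?_
    · simp [whenLe, Program.writes]
    · intro μ' hfr
      rw [eval_scalar, hfr (o + 4) (by simp [whenLe, Program.writes]) (by omega)]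
      exact hs.len
    · intro k μ' q hJ
      rw [← hJ]
      funext r c
      simp [Store.write]
    · rw [max_eq_left (by omega), pushed_self]
    · intro k μ' hk hfr hvk hJ
      have f : ∀ a, a ≠ 0 → a ≠ 10 → μ' (o + a) = μ (o + a) := fun a h0 h10 =>
        hfr (o + a) (by simp [whenLe, Program.writes, h0]) (by omega)
      have ev1 : ∀ ν : Store, ν (o + 10) = μ' (o + 10) → ν (o + 3) = μ' (o + 3) →
          (entry (o + 3) (.add (scalar (o + 10)) (.lit 1))).eval ν = (P (k + 1) : ℕ) := by
        intro ν h1 h2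
        rw [eval_entry (c' := k + 1), h2, f 3 (by omega) (by omega)]
        · exact hs.path _
        · simp [h1, hvk]
      have ev2 : ∀ ν : Store, ν (o + 10) = μ' (o + 10) → ν (o + 3) = μ' (o + 3) →
          (entry (o + 3) (.add (scalar (o + 10)) (.lit 2))).eval ν = (P (k + 1 + 1) : ℕ) := by
        intro ν h1 h2
        rw [eval_entry (c' := k + 1 + 1), h2, f 3 (by omega) (by omega)]
        · exact hs.path _
        · simp only [eval_add, eval_scalar, eval_lit, h1, hvk]
          push_cast
          ring
      have hs7' : (scalar (o + 7)).eval μ' = (s : ℕ) := by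
        rw [eval_scalar, f 7 (by omega) (by omega), hs7]
      have hk1 : (Expr.add (scalar (o + 10)) (.lit 1)).eval μ' = (k + 1 : ℕ) := by
        simp [hvk]
      refine Exec.whenLe (fun h1 => ?_) fun h1 => ?_
      · rw [hs7', hk1] at h1
        have h2 : s ≤ k + 1 := by exact_mod_cast h1
        rw [max_eq_right h2] at hJ
        rw [max_eq_right (by omega : s ≤ k + 1 + 1)]
        have hPP := hne (k + 1) h2 (by omega)
        set a := P (k + 1) with ha
        set b := P (k + 1 + 1) with hb
        have hsucc := pushed_succ (μ o) P c h2
        have e1 : pushed (μ o) P c s (k + 1 + 1) a b = pushed (μ o) P c s (k + 1) a b - c := by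
          rw [hsucc, if_neg fun h => hPP h.1, if_pos ⟨rfl, rfl⟩]
          ring
        have e2 : pushed (μ o) P c s (k + 1 + 1) b a = pushed (μ o) P c s (k + 1) b a + c := by
          rw [hsucc, if_pos ⟨rfl, rfl⟩, if_neg fun h => hPP h.1]
          ring
        refine Exec.seq (Exec.assign (ev1 _ rfl rfl) (ev2 _ rfl rfl)
          (v := pushed (μ o) P c s (k + 1 + 1) a b) ?_ (fun _ => hB _ (by omega) _ _) ?_)
        · rw [eval_sub, pathCap, eval_read (ev1 _ rfl rfl) (ev2 _ rfl rfl), eval_scalar,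
            f 8 (by omega) (by omega), hs8, hJ, e1]
        have g10 : ∀ a' r c' v, μ'.write o r c' v (o + (a' + 1)) = μ' (o + (a' + 1)) := by
          intro a' r c' v
          funext r' c''
          simp [Store.write]
        refine Exec.assign (ev2 _ (g10 9 _ _ _) (g10 2 _ _ _)) (ev1 _ (g10 9 _ _ _) (g10 2 _ _ _))
          (v := pushed (μ o) P c s (k + 1 + 1) b a) ?_ (fun _ => hB _ (by omega) _ _) ?_
        · rw [eval_add, eval_read (ev2 _ (g10 9 _ _ _) (g10 2 _ _ _))
            (ev1 _ (g10 9 _ _ _) (g10 2 _ _ _)), eval_scalar, g10 7,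
            f 8 (by omega) (by omega), hs8, e2, ← hJ]
          simp only [Store.write]
          rw [if_neg]
          rintro ⟨-, h3, -⟩
          exact hPP h3.symm
        · funext r c'
          simp only [Store.write, true_and]
          split_ifs with h3 h4
          · rw [h3.1, h3.2]
          · rw [h4.1, h4.2]
          · rw [hJ, hsucc, if_neg fun h => h3 ⟨h.2.symm, h.1.symm⟩,
              if_neg fun h => h4 ⟨h.1.symm, h.2.symm⟩]
            ring
      · rw [hs7', hk1] at h1
        have h2 : ¬ s ≤ k + 1 := fun h => h1 (by exact_mod_cast h)
        rw [hJ, max_eq_left (by omega), max_eq_left (by omega)]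
    · intro μ' _ hJ
      rwa [max_eq_right (by omega)] at hJ
  · have f := hfr0 μ' hfr
    exact hs.congr (f 1 (by omega) (by omega)) (f 2 (by omega) (by omega))
      (f 3 (by omega) (by omega)) (f 4 (by omega) (by omega)) (f 5 (by omega) (by omega))
      (f 11 (by omega) (by omega))

theorem exec_peelLast (hs : HoldsState o μ V rk par P (len + 1) (cnt + 1)) (hlV : len ≤ V)
    (hcV : cnt < V) (hbits : ∀ k ≤ V + 1, bitSize (k : ℚ) ≤ B) :
    Exec N B μ (peelLast o) fun μ' =>
      HoldsState o μ' V (Function.update rk (P (len + 1)) (cnt + 1))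
        (Function.update par (P (len + 1)) (P len)) P len cnt ∧ μ' o = μ o := by
  have hP : ∀ ν : Store, ν (o + 3) = μ (o + 3) → ν (o + 4) = μ (o + 4) →
      (entry (o + 3) (scalar (o + 4))).eval ν = (P (len + 1) : ℕ) := by
    intro ν h1 h2
    rw [eval_entry (c' := len + 1), h1, hs.path]
    rw [eval_scalar, h2, hs.len]
  have hP' : ∀ ν : Store, ν (o + 3) = μ (o + 3) → ν (o + 4) = μ (o + 4) →
      (entry (o + 3) (.sub (scalar (o + 4)) (.lit 1))).eval ν = (P len : ℕ) := by
    intro ν h1 h2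
    rw [eval_entry (c' := len), h1, hs.path]
    rw [eval_sub, eval_scalar, h2, hs.len]
    simp
  refine Exec.seq (Exec.setEntry (hP _ rfl rfl) (v := ((cnt + 1 : ℕ) : ℚ)) ?_
    (fun _ => hbits _ (by omega)) ?_)
  · rw [eval_scalar, hs.cnt]
  have w1 : ∀ (ν : Store) (a a' r c : ℕ) (v : ℚ), a' ≠ a →
      ν.write (o + a) r c v (o + a') = ν (o + a') := by
    intro ν a a' r c v h
    funext r' c'
    simp [Store.write, h]
  refine Exec.seq (Exec.setEntry
    (hP _ (w1 _ 1 3 _ _ _ (by omega)) (w1 _ 1 4 _ _ _ (by omega)))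
    (hP' _ (w1 _ 1 3 _ _ _ (by omega)) (w1 _ 1 4 _ _ _ (by omega))) (fun hB => ?_) ?_)
  · have := hB (o + 3) 0 len
    rwa [w1 _ 1 3 _ _ _ (by omega), hs.path] at this
  refine Exec.seq (Exec.setScalar (v := (cnt : ℚ)) ?_ (fun _ => hbits _ (by omega)) ?_)
  · rw [eval_sub, eval_scalar, w1 _ 2 5 _ _ _ (by omega), w1 _ 1 5 _ _ _ (by omega), hs.cnt]
    simp
  refine Exec.setScalar (v := (len : ℚ)) ?_ (fun _ => hbits _ (by omega)) ?_
  · rw [eval_sub, eval_scalar, w1 _ 5 4 _ _ _ (by omega), w1 _ 2 4 _ _ _ (by omega),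
      w1 _ 1 4 _ _ _ (by omega), hs.len]
    simp
  refine ⟨⟨?_, ?_, ?_, ?_, ?_, ?_⟩, ?_⟩
  · intro a
    by_cases ha : a = P (len + 1)
    · simp [Store.write, ha]
    · simp [Store.write, ha, hs.rk]
  · intro a
    by_cases ha : a = P (len + 1)
    · simp [Store.write, ha]
    · simp [Store.write, ha, hs.par]
  · intro r
    simp [Store.write, hs.path]
  · simp [Store.write]
  · simp [Store.write]
  · simp [Store.write, hs.V]
  · funext r c
    simp [Store.write]

theorem exec_searchStep {A : AddSubgroup ℚ} {y₀ : ℕ → ℕ → ℚ}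
    (hs : HoldsState o μ V rk par P len cnt) (hst : SearchState V (μ o) rk par P len cnt)
    (hc : Circulated V A y₀ (μ o)) (hsup : Supported V y₀) (hcnt : 1 ≤ cnt)
    (hVN : V ≤ N) (hbits : ∀ k ≤ V + 1, bitSize (k : ℚ) ≤ B)
    (hA : ∀ q ∈ A, 0 ≤ q → q ≤ 2 → bitSize q ≤ B) (hy₀ : ∀ a b, y₀ a b + y₀ b a ≤ 2) :
    Exec N B μ (searchStep o) fun μ' => ∃ rk' par' P' len' cnt',
      HoldsState o μ' V rk' par' P' len' cnt' ∧ SearchState V (μ' o) rk' par' P' len' cnt' ∧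
      Circulated V A y₀ (μ' o) ∧
      searchMeasure V (μ' o) len' cnt' < searchMeasure V (μ o) len cnt := by
  have hlc := hst.len_le
  have hcV := hst.cnt_le
  refine Exec.seq ((exec_findNext hs hVN hbits).mono ?_)
  rintro ν ⟨hs, ho, b, hb6, hb⟩
  rw [← ho] at hst hc hb ⊢
  clear ho
  have hbev : (scalar (o + 6)).eval ν = b := by rw [eval_scalar, hb6]
  have hVev : (scalar (o + 11)).eval ν = V := by rw [eval_scalar, hs.V]
  refine Exec.ite (fun h1 => ?_) fun h1 => ?_
  -- no vertex extends the path
  · rw [hbev, hVev] at h1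
    have h2 : V ≤ b := by exact_mod_cast h1
    rcases hb with ⟨-, hb⟩ | hb
    · have hl : 1 ≤ len := by
        by_contra hl0
        have h0 := hst.cnt_eq.symm ▸ hcnt
        obtain ⟨a, ha⟩ := Finset.card_pos.mp h0
        rw [Finset.mem_filter, Finset.mem_range] at ha
        exact hb a ha.1 ⟨ha.2, by omega⟩
      obtain ⟨l, rfl⟩ : ∃ l, len = l + 1 := ⟨len - 1, by omega⟩
      obtain ⟨c, rfl⟩ : ∃ c, cnt = c + 1 := ⟨cnt - 1, by omega⟩
      obtain ⟨h3, h4⟩ := hst.peel hc hsup fun a ha1 ha2 ha3 => by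
        by_contra ha4
        exact hb a ha1 ⟨ha2, fun _ => ⟨ha3, ha4⟩⟩
      refine (exec_peelLast hs (by omega) (by omega) hbits).mono ?_
      rintro ν' ⟨hs', ho'⟩
      refine ⟨_, _, _, _, _, hs', ?_, ?_, ?_⟩
      · rw [ho']; exact h3
      · rw [ho']; exact hc
      · rw [ho']; exact h4
    · omega
  · rw [hbev, hVev] at h1
    have h2 : b < V := by
      by_contra hbv
      exact h1 (by exact_mod_cast not_lt.mp hbv)
    rcases hb with hb | ⟨-, hb0, hbf⟩
    · omega
    refine Exec.seq ((exec_findRepeat hs (by omega) hVN hbits hb6 h2.le).mono ?_)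
    rintro ν' ⟨hs', ho', s, hs7, hsr⟩
    rw [← ho'] at hst hc hbf ⊢
    clear ho'
    have hsev : (scalar (o + 7)).eval ν' = s := by rw [eval_scalar, hs7]
    refine Exec.ite (fun h3 => ?_) fun h3 => ?_
    -- the vertex is new
    · rw [hsev, eval_lit] at h3
      have h4 : s ≤ 0 := by exact_mod_cast h3
      rcases hsr with ⟨-, hnew⟩ | hsr
      · obtain ⟨h5, h6⟩ := hst.extend h2 hb0 (fun h => (hbf h).1) hnew
        have hl := h5.len_le
        refine Exec.setScalar (v := ((len + 1 : ℕ) : ℚ)) (by simp [hs'.len])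
          (fun _ => hbits _ (by omega)) ?_
        have ho2 : ν'.write (o + 4) 0 0 ((len + 1 : ℕ) : ℚ) o = ν' o := by
          funext r c; simp [Store.write]
        refine ⟨rk, par, Function.update P (len + 1) b, len + 1, cnt,
          ⟨?_, ?_, ?_, ?_, ?_, ?_⟩, ?_, ?_, ?_⟩
        · simpa [Store.write] using hs'.rk
        · simpa [Store.write] using hs'.par
        · simpa [Store.write] using hs'.path
        · simp [Store.write]
        · simpa [Store.write] using hs'.cnt
        · simpa [Store.write] using hs'.V
        · rw [ho2]; exact h5
        · rw [ho2]; exact hc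
        · rw [ho2]; exact h6
      · omega
    -- the vertex closes a cycle
    · rw [hsev, eval_lit] at h3
      have h4 : 1 ≤ s := by
        by_contra hs0
        apply h3
        have : s = 0 := by omega
        simp [this]
      rcases hsr with ⟨hs0, -⟩ | ⟨-, hsl, hsb⟩
      · omega
      set P' := Function.update P (len + 1) b with hP'
      have hPP : ∀ r, r ≤ len → P' r = P r := fun r hr => by
        rw [hP', Function.update_of_ne (by omega)]
      have hPb : P' (len + 1) = b := by rw [hP', Function.update_self]
      have hst' := hst.congr_path hPP
      have hbf' := hbf (by omega)
      refine Exec.seq ((exec_findMin hs' (by omega) hVN hbits hs7 h4 hsl).mono ?_)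
      rintro ν₂ ⟨hs₂, ho₂, hs72, hle, hex⟩
      rw [← ho₂] at hst' hc hbf' hle hex ⊢
      clear ho₂
      have hfl : Free (ν₂ o) (P' len) (P' (len + 1)) := by
        rw [hPb, hPP len le_rfl]; exact hbf'.1
      have hfr : ∀ q, s ≤ q → q < len + 1 → Free (ν₂ o) (P' q) (P' (q + 1)) := by
        intro q h5 h6
        by_cases hq : q = len
        · subst hq; exact hfl
        · exact hst'.path_free q (by omega) (by omega)
      obtain ⟨h5, h6, h7⟩ := hst'.rotate hc hsup h4 hsl (by rw [hPb, hPP s hsl, hsb]) hfl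
        (by rw [hPb, hPP _ (by omega)]; exact hbf'.2) hle hex
      obtain ⟨q, hq1, hq2, hq3⟩ := hex
      set c := ν₂ (o + 8) 0 0 with hcdef
      have hc0 : 0 ≤ c := by rw [hq3]; exact hc.nonneg _ _
      refine Exec.seq ((exec_pushCycle (c := c) hs₂ (by omega) hVN hbits hs72 rfl h4 hsl
        (fun q hq1 hq2 => (hc.free_lt hsup (hfr q hq1 hq2)).2.2) ?_).mono ?_)
      · intro t ht a b
        have hnn : ∀ a b, 0 ≤ pushed (ν₂ o) P' c s t a b :=
          pushed_nonneg hc0 hc.nonneg (fun q h8 h9 => hle q h8 (by omega))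
            fun q r h8 h9 h10 => hst'.path_inj q r (by omega) h9 (by omega)
        refine hA _ (pushed_mem hc.mem _ (hq3 ▸ hc.mem _ _) _ _ _ _) (hnn a b) ?_
        have h8 := pushed_pair (ν₂ o) P' c s t a b
        have h9 := hc.pair a b
        have h10 := hy₀ a b
        have h11 := hnn b a
        linarith
      · rintro ν₃ ⟨hs₃, ho₃⟩
        refine Exec.setScalar (v := ((0 : ℕ) : ℚ)) (by simp) (fun _ => hbits _ (by omega)) ?_
        have ho4 : ν₃.write (o + 4) 0 0 ((0 : ℕ) : ℚ) o = ν₃ o := by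
          funext r c; simp [Store.write]
        rw [← ho₃, ← ho4] at h5 h6 h7
        refine ⟨rk, par, _, 0, cnt, ⟨?_, ?_, ?_, ?_, ?_, ?_⟩, h5, h6, h7⟩
        · simpa [Store.write] using hs₃.rk
        · simpa [Store.write] using hs₃.par
        · simpa [Store.write] using hs₃.path
        · simp [Store.write]
        · simpa [Store.write] using hs₃.cnt
        · simpa [Store.write] using hs₃.V

/-- The program for cancelling cycles is correct if its variables are initially zero. -/
theorem exec_cancelCycles {A : AddSubgroup ℚ} {y₀ : ℕ → ℕ → ℚ}
    (hV : μ (o + 11) 0 0 = V) (hz : ∀ a, 1 ≤ a → a ≤ 4 → μ (o + a) = 0) (hy : μ o = y₀)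
    (hsup : Supported V y₀) (hmem : ∀ a b, y₀ a b ∈ A) (hnn : ∀ a b, 0 ≤ y₀ a b)
    (hy₀ : ∀ a b, y₀ a b + y₀ b a ≤ 2) (hN : (V + 1) * (V * V + V) + V ≤ N)
    (hbits : ∀ k ≤ V + 1, bitSize (k : ℚ) ≤ B)
    (hA : ∀ q ∈ A, 0 ≤ q → q ≤ 2 → bitSize q ≤ B) :
    Exec N B μ (cancelCycles o) fun μ' => ∃ rk par : ℕ → ℕ,
      Circulated V A y₀ (μ' o) ∧ IsForest V (μ' o) rk par ∧ ∀ a, μ' (o + 2) 0 a = par a := by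
  have hVN : V ≤ N := by nlinarith
  set P : ℕ → ℕ := Function.update 0 0 V with hP
  set par : ℕ → ℕ := Function.update 0 V V with hpar
  refine Exec.seq (Exec.setEntry (c' := 0) (v := V) (by simp) (by simp [hV])
    (fun _ => hbits V (by omega)) ?_)
  refine Exec.seq (Exec.setEntry (c' := V) (v := V) (by simp [Store.write, hV])
    (by simp [Store.write, hV]) (fun _ => hbits V (by omega)) ?_)
  refine Exec.seq (Exec.setScalar (v := V) (by simp [Store.write, hV])
    (fun _ => hbits V (by omega)) ?_)
  set ν := ((μ.write (o + 3) 0 0 (V : ℚ)).write (o + 2) 0 V (V : ℚ)).write (o + 5) 0 0 (V : ℚ)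
    with hν
  have hs : HoldsState o ν V 0 par P 0 V := by
    refine ⟨fun a => ?_, fun a => ?_, fun r => ?_, ?_, ?_, ?_⟩
    · simp [hν, Store.write, hz 1]
    · by_cases ha : a = V
      · simp [hν, Store.write, hpar, ha]
      · simp [hν, Store.write, hpar, ha, hz 2]
    · by_cases hr : r = 0
      · simp [hν, Store.write, hP, hr]
      · simp [hν, Store.write, hP, hr, hz 3]
    · simp [hν, Store.write, hz 4]
    · simp [hν, Store.write]
    · simp [hν, Store.write, hV]
  have ho : ν o = y₀ := by
    rw [← hy]
    funext r c
    simp [hν, Store.write]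
  clear_value ν
  refine Exec.loop (fun n μ' => ∃ rk par P len cnt, HoldsState o μ' V rk par P len cnt ∧
    SearchState V (μ' o) rk par P len cnt ∧ Circulated V A y₀ (μ' o) ∧
    searchMeasure V (μ' o) len cnt ≤ n) ?_ ?_ hN ?_
  · rintro n μ' ⟨rk, par, P, len, cnt, h1, h2, h3, h4⟩ hle
    rw [eval_lit, eval_scalar, h1.cnt] at hle
    refine (exec_searchStep h1 h2 h3 hsup (by exact_mod_cast hle) hVN hbits hA hy₀).mono ?_
    rintro μ'' ⟨rk', par', P', len', cnt', h5, h6, h7, h8⟩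
    exact ⟨_, lt_of_lt_of_le h8 h4, rk', par', P', len', cnt', h5, h6, h7, le_rfl⟩
  · rintro n μ' ⟨rk, par, P, len, cnt, h1, h2, h3, h4⟩ hle
    rw [eval_lit, eval_scalar, h1.cnt] at hle
    have h0 : cnt = 0 := by
      by_contra hc
      exact hle (by exact_mod_cast Nat.one_le_iff_ne_zero.mpr hc)
    subst h0
    exact ⟨rk, par, h3, h2.isForest h3 hsup, h1.par⟩
  · refine ⟨0, par, P, 0, V, hs, ?_, ?_, ?_⟩
    · exact SearchState.init V _ _ _ _ (fun _ => rfl) (by simp [hpar]) (by simp [hP])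
    · rw [ho]
      exact ⟨hmem, hnn, fun _ _ => rfl, fun _ => rfl⟩
    · have := freeCount_le V (ν o)
      unfold searchMeasure
      have h2 : (V + 1) * (freeCount V (ν o) + V) ≤ (V + 1) * (V * V + V) :=
        Nat.mul_le_mul_left _ (by omega)
      omega

end

/-! ### The programs around the cancellation of cycles -/

/-- The program that sets up the residual capacities of a fractional assignment in the array `o`;
the arrays `inc` and `x` hold the incidence matrix and the values, and `u` is the upper bound for
the machine in the loop variable `51`. -/
def buildResidual (o inc x : ℕ) (nJ m u : Expr) : Program :=
  .seq (setScalar (o + 11) (.add nJ m))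
    (forLoop 50 nJ (forLoop 51 m
      (whenLe (.lit 1) (.read inc (scalar 50) (scalar 51))
        (.seq (.assign o (scalar 50) (.add nJ (scalar 51)) (.read x (scalar 50) (scalar 51)))
          (.assign o (.add nJ (scalar 51)) (scalar 50)
            (.sub u (.read x (scalar 50) (scalar 51))))))))

section

variable {N B : ℕ} {μ : Store}

theorem Small.copy {μ : Store} {B : ℕ} {v : ℚ} {a r c : ℕ} (h : μ a r c = v) (hB : Small B μ) :
    bitSize v ≤ B := h ▸ hB a r c

theorem exec_buildResidual {o incA xA nJ m : ℕ} {enJ em eu : Expr}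
    {inc : Fin nJ → Finset (Fin m)} {x : Fin m → Fin nJ → ℚ} {u : Fin m → ℚ}
    (ho : 10 ≤ o ∧ o ≤ 38) (hincA : incA < 10) (hxA : xA < 10)
    (hnN : nJ ≤ N) (hmN : m ≤ N) (hbits : ∀ k ≤ nJ + m, bitSize (k : ℚ) ≤ B)
    (hu : ∀ j, ∀ i ∈ inc j, bitSize (u i - x i j) ≤ B)
    (henJ : ∀ ν : Store, (∀ a < 10, ν a = μ a) → enJ.eval ν = nJ)
    (hem : ∀ ν : Store, (∀ a < 10, ν a = μ a) → em.eval ν = m)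
    (heu : ∀ ν : Store, (∀ a < 10, ν a = μ a) → ∀ i : Fin m, ν 51 0 0 = (i : ℕ) → eu.eval ν = u i)
    (hinc : ∀ (j : Fin nJ) (i : Fin m), μ incA j i = if i ∈ inc j then 1 else 0)
    (hx : ∀ (j : Fin nJ) (i : Fin m), μ xA j i = x i j) (h0 : μ o = 0) :
    Exec N B μ (buildResidual o incA xA enJ em eu) fun μ' =>
      μ' o = residual inc x u ∧ μ' (o + 11) 0 0 = ((nJ + m : ℕ) : ℚ) := by
  refine Exec.seq (Exec.setScalar (v := ((nJ + m : ℕ) : ℚ))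
    (by rw [eval_add, henJ μ fun _ _ => rfl, hem μ fun _ _ => rfl]; push_cast; rfl)
    (fun _ => hbits _ le_rfl) ?_)
  set ν := μ.write (o + 11) 0 0 ((nJ + m : ℕ) : ℚ) with hν
  have hν10 : ∀ a < 10, ν a = μ a := by
    intro a ha
    funext r c
    simp only [hν, Store.write]
    rw [if_neg]
    rintro ⟨h1, -⟩
    omega
  have hνo : ν o = 0 := by
    rw [← h0]
    funext r c
    simp [hν, Store.write]
  have hν11 : ν (o + 11) 0 0 = ((nJ + m : ℕ) : ℚ) := by simp [hν, Store.write]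
  clear_value ν
  -- The pairs of jobs and machines are treated in lexicographic order.
  refine Exec.forLoop (n := nJ) (fun k μ' => (∀ a b, μ' o a b =
      if min a b < k then residual inc x u a b else 0) ∧
      μ' (o + 11) 0 0 = ((nJ + m : ℕ) : ℚ)) hnN
    (fun k hk => hbits k (by omega)) ?_ ?_ ?_ ?_ ?_ ?_
  · simp [forLoop, whenLe, setScalar, Program.writes]
    omega
  · intro μ' hfr
    refine henJ μ' fun a ha => ?_
    rw [hfr a ?_ (by omega), hν10 a ha]
    simp [forLoop, whenLe, setScalar, Program.writes]
    omega
  · rintro k μ' q ⟨hJ, hJ'⟩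
    have h50 : ∀ a r c, a ≠ 50 → μ'.write 50 0 0 q a r c = μ' a r c := by
      intro a r c ha
      simp [Store.write, ha]
    refine ⟨fun a b => ?_, ?_⟩
    · rw [h50 _ _ _ (by omega), hJ]
    · rw [h50 _ _ _ (by omega), hJ']
  · exact ⟨fun a b => by simp [hνo], hν11⟩
  · rintro k μ' hk hfr hvk ⟨hJ, hJ'⟩
    have f : ∀ a < 10, μ' a = μ a := by
      intro a ha
      rw [hfr a ?_ (by omega), hν10 a ha]
      simp [forLoop, whenLe, setScalar, Program.writes]
      omega
    refine Exec.forLoop (n := m) (fun l μ' => (∀ a b, μ' o a b =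
        if min a b < k ∨ (min a b = k ∧ max a b < nJ + l) then residual inc x u a b else 0) ∧
        μ' (o + 11) 0 0 = ((nJ + m : ℕ) : ℚ)) hmN
      (fun k hk => hbits k (by omega)) ?_ ?_ ?_ ?_ ?_ ?_
    · simp [whenLe, Program.writes]
      omega
    · intro μ'' hfr'
      refine hem μ'' fun a ha => ?_
      rw [hfr' a ?_ (by omega), f a ha]
      simp [whenLe, Program.writes]
      omega
    · rintro l μ'' q ⟨hJ, hJ'⟩
      have h51 : ∀ a r c, a ≠ 51 → μ''.write 51 0 0 q a r c = μ'' a r c := by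
        intro a r c ha
        simp [Store.write, ha]
      refine ⟨fun a b => ?_, ?_⟩
      · rw [h51 _ _ _ (by omega), hJ]
      · rw [h51 _ _ _ (by omega), hJ']
    · refine ⟨fun a b => ?_, hJ'⟩
      rw [hJ]
      by_cases h1 : min a b < k
      · simp [h1]
      · rw [if_neg h1]
        split_ifs with h2
        · rcases h2 with h2 | ⟨h2, h3⟩
          · exact absurd h2 h1
          · -- pairs of jobs have no capacity
            obtain ⟨j, rfl⟩ : ∃ j : Fin nJ, a = j := ⟨⟨a, by omega⟩, rfl⟩
            obtain ⟨j', rfl⟩ : ∃ j : Fin nJ, b = j := ⟨⟨b, by omega⟩, rfl⟩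
            exact (residual_job_job j j').1.symm
        · rfl
    · rintro l μ'' hl hfr' hvl ⟨hJ, hJ'⟩
      have f' : ∀ a < 10, μ'' a = μ a := by
        intro a ha
        rw [hfr' a ?_ (by omega), f a ha]
        simp [whenLe, Program.writes]
        omega
      have h50 : μ'' 50 0 0 = k := by
        rw [hfr' 50 ?_ (by omega), hvk]
        simp [whenLe, Program.writes]
        omega
      set j : Fin nJ := ⟨k, hk⟩ with hj
      set i : Fin m := ⟨l, hl⟩ with hi
      have ej : ∀ ν' : Store, ν' 50 = μ'' 50 → (scalar 50).eval ν' = (k : ℕ) := by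
        intro ν' h; rw [eval_scalar, h, h50]
      have ei : ∀ ν' : Store, ν' 51 = μ'' 51 → (scalar 51).eval ν' = (l : ℕ) := by
        intro ν' h; rw [eval_scalar, h, hvl]
      have ev : ∀ ν' : Store, (∀ a < 10, ν' a = μ a) → ν' 51 = μ'' 51 →
          (Expr.add enJ (scalar 51)).eval ν' = (nJ + l : ℕ) := by
        intro ν' h h'
        rw [eval_add, henJ ν' h, ei ν' h']; push_cast; rfl
      have ex : ∀ ν' : Store, (∀ a < 10, ν' a = μ a) → ν' 50 = μ'' 50 → ν' 51 = μ'' 51 →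
          (Expr.read xA (scalar 50) (scalar 51)).eval ν' = x i j := by
        intro ν' h h' h''
        rw [eval_read (ej ν' h') (ei ν' h''), h _ hxA]
        exact hx j i
      have einc : (Expr.read incA (scalar 50) (scalar 51)).eval μ'' =
          if i ∈ inc j then 1 else 0 := by
        rw [eval_read (ej _ rfl) (ei _ rfl), f' _ hincA]
        exact hinc j i
      have hrj : residual inc x u k (nJ + l) = if i ∈ inc j then x i j else 0 := residual_job j i
      have hrm : residual inc x u (nJ + l) k = if i ∈ inc j then u i - x i j else 0 :=
        residual_mach j i
      have hiff : ∀ a b, ¬ (a = k ∧ b = nJ + l) → ¬ (a = nJ + l ∧ b = k) →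
          ((min a b < k ∨ (min a b = k ∧ max a b < nJ + (l + 1))) ↔
          (min a b < k ∨ (min a b = k ∧ max a b < nJ + l))) := by
        intro a b h1 h2
        omega
      have hnot1 : ¬ (min k (nJ + l) < k ∨ (min k (nJ + l) = k ∧ max k (nJ + l) < nJ + l)) := by
        omega
      have hnot2 : ¬ (min (nJ + l) k < k ∨ (min (nJ + l) k = k ∧ max (nJ + l) k < nJ + l)) := by
        omega
      refine Exec.whenLe (fun h1 => ?_) fun h1 => ?_
      · rw [einc, eval_lit] at h1
        have hmem : i ∈ inc j := by
          by_contra hc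
          rw [if_neg hc] at h1
          norm_num at h1
        refine Exec.seq (Exec.assign (ej _ rfl) (ev _ f' rfl) (ex _ f' rfl rfl)
          (Small.copy (by rw [f' _ hxA]; exact hx j i)) ?_)
        set ν₁ := μ''.write o k (nJ + l) (x i j) with hν₁
        have g : ∀ a, a ≠ o → ν₁ a = μ'' a := by
          intro a ha
          funext r c
          simp [hν₁, Store.write, ha]
        have f₁ : ∀ a < 10, ν₁ a = μ a := fun a ha => by rw [g a (by omega), f' a ha]
        refine Exec.assign (ev _ f₁ (g 51 (by omega))) (ej _ (g 50 (by omega)))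
          (v := u i - x i j) ?_ (fun _ => hu j i hmem) ?_
        · rw [eval_sub, ex _ f₁ (g 50 (by omega)) (g 51 (by omega)),
            heu ν₁ f₁ i (by rw [g 51 (by omega), hvl])]
        · refine ⟨fun a b => ?_, ?_⟩
          · by_cases h2 : a = nJ + l ∧ b = k
            · obtain ⟨rfl, rfl⟩ := h2
              rw [if_pos (by omega), hrm, if_pos hmem]
              simp [Store.write]
            · by_cases h3 : a = k ∧ b = nJ + l
              · obtain ⟨rfl, rfl⟩ := h3
                rw [if_pos (by omega), hrj, if_pos hmem]
                have : ¬ (a = nJ + l) := by omega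
                simp [hν₁, Store.write, this]
              · simp only [hiff a b h3 h2]
                rw [← hJ a b]
                simp only [hν₁, Store.write, true_and]
                rw [if_neg h2, if_neg h3]
          · rw [← hJ']
            simp [hν₁, Store.write]
      · rw [einc, eval_lit] at h1
        have hmem : i ∉ inc j := by
          intro hc
          rw [if_pos hc] at h1
          exact h1 le_rfl
        refine ⟨fun a b => ?_, hJ'⟩
        rw [hJ a b]
        by_cases h2 : a = nJ + l ∧ b = k
        · obtain ⟨rfl, rfl⟩ := h2
          rw [if_neg hnot2, hrm, if_neg hmem, ite_self]
        · by_cases h3 : a = k ∧ b = nJ + l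
          · obtain ⟨rfl, rfl⟩ := h3
            rw [if_neg hnot1, hrj, if_neg hmem, ite_self]
          · simp only [hiff a b h3 h2]
    · rintro μ'' hfr' ⟨hJ, hJ'⟩
      refine ⟨fun a b => ?_, hJ'⟩
      rw [hJ]
      by_cases h1 : nJ + m ≤ max a b
      · have : residual inc x u a b = 0 := by
          rcases le_max_iff.mp h1 with h | h
          · exact (residual_supported a b (Or.inl h)).1
          · exact (residual_supported b a (Or.inl h)).2
        rw [this, ite_self, ite_self]
      · congr 1
        apply propext
        omega
  · rintro μ' hfr ⟨hJ, hJ'⟩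
    refine ⟨?_, hJ'⟩
    funext a b
    rw [hJ]
    split_ifs with h
    · rfl
    · -- pairs of machines have no capacity
      by_cases h1 : nJ + m ≤ max a b
      · rcases le_max_iff.mp h1 with h | h
        · exact (residual_supported a b (Or.inl h)).1.symm
        · exact (residual_supported b a (Or.inl h)).2.symm
      · obtain ⟨i, rfl⟩ : ∃ i : Fin m, a = nJ + i := ⟨⟨a - nJ, by omega⟩, by simp; omega⟩
        obtain ⟨i', rfl⟩ : ∃ i : Fin m, b = nJ + i := ⟨⟨b - nJ, by omega⟩, by simp; omega⟩
        exact (residual_mach_mach i i').1.symm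

end

section

variable {N B : ℕ} {μ : Store} {P : Program} {Q : Store → Prop} {e e' : Expr}

/-- The rule for two nested loops over `v = 0, …, n - 1` and `w = 0, …, m - 1`. -/
theorem Exec.forLoop_forLoop {v w n m : ℕ} (J : ℕ → ℕ → Store → Prop) (hn : n ≤ N) (hm : m ≤ N)
    (hnbits : ∀ k ≤ n, bitSize (k : ℚ) ≤ B) (hmbits : ∀ k ≤ m, bitSize (k : ℚ) ≤ B)
    (hv : v ∉ P.writes) (hw : w ∉ P.writes) (hvw : v ≠ w)
    (he : ∀ μ', (∀ a, a ∉ P.writes → a ≠ v → a ≠ w → μ' a = μ a) → e.eval μ' = n)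
    (he' : ∀ μ', (∀ a, a ∉ P.writes → a ≠ v → a ≠ w → μ' a = μ a) → e'.eval μ' = m)
    (hJ : ∀ k l μ' μ'', (∀ a, a ≠ v → a ≠ w → μ'' a = μ' a) → J k l μ' → J k l μ'')
    (h₀ : J 0 0 μ)
    (hbody : ∀ k l μ', k < n → l < m → (∀ a, a ∉ P.writes → a ≠ v → a ≠ w → μ' a = μ a) →
      μ' v 0 0 = (k : ℚ) → μ' w 0 0 = (l : ℚ) → J k l μ' → Exec N B μ' P (J k (l + 1)))
    (hnext : ∀ k μ', J k m μ' → J (k + 1) 0 μ')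
    (hQ : ∀ μ', J n 0 μ' → Q μ') : Exec N B μ
      (RestrictedAssignment.forLoop v e (RestrictedAssignment.forLoop w e' P)) Q := by
  have hmem : ∀ a, a ∈ (RestrictedAssignment.forLoop w e' P).writes ↔ a = w ∨ a ∈ P.writes := by
    intro a
    simp only [RestrictedAssignment.forLoop, RestrictedAssignment.setScalar, Program.writes,
      List.mem_append, List.mem_singleton]
    tauto
  have hwr : ∀ (u : ℕ) (μ' : Store) q a, a ≠ u → (μ'.write u 0 0 q) a = μ' a := by
    intro u μ' q a ha
    funext r c
    simp [Store.write, ha]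
  refine Exec.forLoop (fun k => J k 0) hn hnbits ?_ ?_ ?_ h₀ ?_ fun μ' _ h => hQ μ' h
  · simp [hmem, hv, hvw]
  · exact fun μ' hfr => he μ' fun a h1 h2 h3 => hfr a (by simp [hmem, h1, h3]) h2
  · exact fun k μ' q => hJ k 0 _ _ fun a h1 _ => hwr _ _ _ _ h1
  · intro k μ' hk hfr hvk hJk
    refine Exec.forLoop (fun l => J k l) hm hmbits hw ?_ ?_ hJk ?_ fun μ' _ h => hnext k μ' h
    · exact fun μ'' hfr' => he' μ'' fun a h1 h2 h3 => by
        rw [hfr' a h1 h3, hfr a (by simp [hmem, h1, h3]) h2]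
    · exact fun l μ' q => hJ k l _ _ fun a _ h2 => hwr _ _ _ _ h2
    · intro l μ'' hl hfr' hwl hJl
      refine hbody k l μ'' hk hl (fun a h1 h2 h3 => ?_) ?_ hwl hJl
      · rw [hfr' a h1 h3, hfr a (by simp [hmem, h1, h3]) h2]
      · rw [hfr' v hv hvw, hvk]

/-- The program that computes the tops of the clusters of all heavy jobs in the array `53`. -/
def clusterTops : Program :=
  .seq (setEntry 53 (scalar 21) (scalar 21))
    (forLoop 50 (entry 0 (.lit 1)) (.seq (setEntry 53 (scalar 50) (scalar 50))
      (forLoop 51 (scalar 21)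
        (whenLt (.lit (1 / 2))
          (.read 10 (entry 53 (scalar 50)) (entry 12 (entry 53 (scalar 50))))
          (setEntry 53 (scalar 50) (entry 12 (entry 12 (entry 53 (scalar 50)))))))))

theorem exec_clusterTops {V nH : ℕ} {y : ℕ → ℕ → ℚ} {par : ℕ → ℕ} (hV : μ 21 0 0 = V)
    (hn : μ 0 0 1 = nH) (hnV : nH ≤ V) (hVN : V ≤ N) (hbits : ∀ k ≤ V, bitSize (k : ℚ) ≤ B)
    (hy : μ 10 = y) (hpar : ∀ a, μ 12 0 a = par a) :
    Exec N B μ clusterTops fun μ' =>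
      (∀ j < nH, μ' 53 0 j = clusterTop V y par j) ∧ μ' 53 0 V = V := by
  refine Exec.seq (Exec.setEntry (c' := V) (v := V) (by simp [hV]) (by simp [hV])
    (fun _ => hbits V le_rfl) ?_)
  have hw : ∀ {a' r c : ℕ} {q : ℚ} {μ : Store}, ∀ a, a ≠ a' → (μ.write a' r c q) a = μ a := by
    intro a' r c q μ a ha
    funext r c
    simp [Store.write, ha]
  refine Exec.forLoop (n := nH) (fun k μ' => (∀ j < k, μ' 53 0 j = clusterTop V y par j) ∧
    μ' 53 0 V = V) (hnV.trans hVN) (fun k hk => hbits k (hk.trans hnV)) ?_ ?_ ?_ ?_ ?_ ?_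
  · simp [forLoop, whenLt, setScalar, setEntry, Program.writes]
  · intro μ' hfr
    rw [eval_entry (c' := 1) (by simp), hfr 0 ?_ (by omega), hw 0 (by omega), hn]
    simp [forLoop, whenLt, setScalar, setEntry, Program.writes]
  · intro k μ' q h
    rwa [hw 53 (by omega)]
  · exact ⟨by simp, by simp [Store.write]⟩
  · rintro k μ' hk hfr hvk ⟨hT, hTV⟩
    refine Exec.seq (Exec.setEntry (c' := k) (v := k) (by simp [hvk]) (by simp [hvk])
      (fun _ => hbits k (by omega)) ?_)
    refine Exec.forLoop (n := V) (fun l μ'' => (∀ j < k, μ'' 53 0 j = clusterTop V y par j) ∧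
      μ'' 53 0 V = V ∧ μ'' 53 0 k = ((nextJob y par)^[l] k : ℕ)) hVN hbits ?_ ?_ ?_ ?_ ?_ ?_
    · simp [whenLt, setEntry, Program.writes]
    · intro μ'' hfr'
      rw [eval_scalar, hfr' 21 ?_ (by omega), hw 21 (by omega), hfr 21 ?_ (by omega),
        hw 21 (by omega), hV]
      · simp [forLoop, whenLt, setScalar, setEntry, Program.writes]
      · simp [whenLt, setEntry, Program.writes]
    · intro l μ'' q h
      rwa [hw 53 (by omega)]
    · refine ⟨fun j hj => ?_, ?_, ?_⟩
      · simpa [Store.write, hj.ne] using hT j hj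
      · simpa [Store.write, show V ≠ k by omega] using hTV
      · simp [Store.write]
    · rintro l μ'' hl hfr' - ⟨hT, hTV, hTk⟩
      have f : ∀ a, a ≠ 50 → a ≠ 51 → a ≠ 53 → μ'' a = μ a := by
        intro a h1 h2 h3
        rw [hfr' a ?_ h2, hw a h3, hfr a ?_ h1, hw a h3]
        · simp [forLoop, whenLt, setScalar, setEntry, Program.writes, h2, h3]
        · simp [whenLt, setEntry, Program.writes, h3]
      have h50 : μ'' 50 0 0 = k := by
        rw [hfr' 50 ?_ (by omega), hw 50 (by omega), hvk]
        simp [whenLt, setEntry, Program.writes]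
      set t := (nextJob y par)^[l] k with ht
      have e1 : (entry 53 (scalar 50)).eval μ'' = t := by
        rw [eval_entry (c' := k) (by simp [h50]), hTk]
      have e2 : (entry 12 (entry 53 (scalar 50))).eval μ'' = par t := by
        rw [eval_entry e1, f 12 (by omega) (by omega) (by omega), hpar]
      have e3 : (Expr.read 10 (entry 53 (scalar 50)) (entry 12 (entry 53 (scalar 50)))).eval μ'' =
          y t (par t) := by
        rw [eval_read e1 e2, f 10 (by omega) (by omega) (by omega), hy]
      have e4 : (entry 12 (entry 12 (entry 53 (scalar 50)))).eval μ'' = par (par t) := by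
        rw [eval_entry e2, f 12 (by omega) (by omega) (by omega), hpar]
      have hsucc : (nextJob y par)^[l + 1] k = nextJob y par t := by
        rw [Function.iterate_succ_apply']
      refine Exec.whenLt (fun h => ?_) fun h => ?_
      · rw [e3, eval_lit] at h
        have hn : nextJob y par t = par (par t) := if_pos h
        refine Exec.setEntry (c' := k) (by simp [h50]) e4
          (Small.copy (a := 12) (r := 0) (c := par t)
            (by rw [f 12 (by omega) (by omega) (by omega), hpar])) ?_
        refine ⟨fun j hj => ?_, ?_, ?_⟩
        · simpa [Store.write, hj.ne] using hT j hj
        · simpa [Store.write, show V ≠ k by omega] using hTV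
        · rw [hsucc, hn]
          simp [Store.write]
      · rw [e3, eval_lit] at h
        have hn : nextJob y par t = t := if_neg h
        exact ⟨hT, hTV, by rw [hsucc, hn, hTk]⟩
    · rintro μ'' - ⟨hT, hTV, hTk⟩
      refine ⟨fun j hj => ?_, hTV⟩
      rcases Nat.lt_succ_iff_lt_or_eq.mp hj with h | rfl
      · exact hT j h
      · exact hTk
  · exact fun μ' _ h => h

/-- The program that marks the claimed machines in the array `54`. -/
def markClaimed : Program :=
  forLoop 50 (entry 0 (.lit 1))
    (whenLt (.lit (1 / 2)) (.read 10 (scalar 50) (entry 12 (scalar 50)))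
      (setEntry 54 (entry 12 (scalar 50)) (.lit 1)))

open Classical in
theorem exec_markClaimed {nH : ℕ} {y : ℕ → ℕ → ℚ} {par : ℕ → ℕ}
    (hn : μ 0 0 1 = nH) (hN : nH ≤ N) (hbits : ∀ k ≤ nH, bitSize (k : ℚ) ≤ B)
    (hy : μ 10 = y) (hpar : ∀ a, μ 12 0 a = par a) (h0 : μ 54 = 0) :
    Exec N B μ markClaimed fun μ' =>
      ∀ v, μ' 54 0 v = if Claimed nH y par v then 1 else 0 := by
  refine Exec.forLoop (n := nH) (fun k μ' =>
    ∀ v, μ' 54 0 v = if Claimed k y par v then 1 else 0) hN hbits ?_ ?_ ?_ ?_ ?_ ?_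
  · simp [whenLt, setEntry, Program.writes]
  · intro μ' hfr
    rw [eval_entry (c' := 1) (by simp), hfr 0 ?_ (by omega), hn]
    simp [whenLt, setEntry, Program.writes]
  · intro k μ' q h v
    rw [← h v]
    simp [Store.write]
  · simp [h0, Claimed]
  · intro k μ' hk hfr hvk h
    have f : ∀ a, a ≠ 50 → a ≠ 54 → μ' a = μ a := by
      intro a h1 h2
      exact hfr a (by simp [whenLt, setEntry, Program.writes, h2]) h1
    have e1 : (entry 12 (scalar 50)).eval μ' = par k := by
      rw [eval_entry (c' := k) (by simp [hvk]), f 12 (by omega) (by omega), hpar]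
    have e2 : (Expr.read 10 (scalar 50) (entry 12 (scalar 50))).eval μ' = y k (par k) := by
      rw [eval_read (r' := k) (by simp [hvk]) e1, f 10 (by omega) (by omega), hy]
    have hiff : ∀ v, Claimed (k + 1) y par v ↔
        Claimed k y par v ∨ (Linked y par k ∧ par k = v) := by
      intro v
      unfold Claimed
      constructor
      · rintro ⟨c, hc, hl⟩
        rcases Nat.lt_succ_iff_lt_or_eq.mp hc with hc' | rfl
        · exact Or.inl ⟨c, hc', hl⟩
        · exact Or.inr hl
      · rintro (⟨c, hc, hl⟩ | hl)
        · exact ⟨c, by omega, hl⟩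
        · exact ⟨k, by omega, hl⟩
    refine Exec.whenLt (fun hl => ?_) fun hl => ?_
    · rw [e2, eval_lit] at hl
      refine Exec.setEntry e1 (eval_lit 1) (fun _ => by simpa using hbits 1 (by omega)) ?_
      intro v
      by_cases hv : v = par k
      · rw [if_pos ((hiff v).mpr (Or.inr ⟨hl, hv.symm⟩))]
        simp [Store.write, hv]
      · have : Claimed (k + 1) y par v ↔ Claimed k y par v := by
          rw [hiff]
          exact ⟨fun h => h.resolve_right fun h' => hv h'.2.symm, Or.inl⟩
        simp only [this]
        rw [← h v]
        simp [Store.write, hv]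
    · rw [e2, eval_lit] at hl
      intro v
      have : Claimed (k + 1) y par v ↔ Claimed k y par v := by
        rw [hiff]
        exact ⟨fun h => h.resolve_right fun h' => hl h'.1, Or.inl⟩
      simp only [this]
      exact h v
  · exact fun μ' _ h => h

end

section

variable {N B : ℕ} {μ : Store}

theorem Store.write_of_ne {μ : Store} {a a' r c : ℕ} {q : ℚ} (h : a ≠ a') :
    (μ.write a' r c q) a = μ a := by
  funext r c
  simp [Store.write, h]

/-- The program that writes the canonical heavy jobs and the vector `z` of the canonical
instance. -/
def writeHeavy : Program :=
  .seq (setScalar 6 (entry 0 (.lit 1)))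
    (forLoop 50 (entry 0 (.lit 1)) (forLoop 51 (entry 0 (.lit 0))
      (.ite (.read 10 (scalar 50) (entry 12 (scalar 50))) (.lit (1 / 2))
        (whenLe (entry 54 (.add (entry 0 (.lit 1)) (scalar 51))) (.lit 0)
          (whenEq (entry 53 (entry 12 (.add (entry 0 (.lit 1)) (scalar 51)))) (scalar 50)
            (whenLe (.mul (.lit (3 / 5)) (entry 0 (.lit 4)))
              (.mul (entry 0 (.lit 0)) (.mul (.lit (2 / 5)) (entry 5 (scalar 51))))
              (.seq (.assign 7 (scalar 50) (scalar 51) (.lit 1))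
                (setEntry 9 (scalar 51) (.mul (.lit (2 / 5)) (entry 5 (scalar 51))))))))
        (whenEq (entry 12 (scalar 50)) (.add (entry 0 (.lit 1)) (scalar 51))
          (.seq (.assign 7 (scalar 50) (scalar 51) (.lit 1))
            (setEntry 9 (scalar 51) (.mul (.lit (2 / 5)) (entry 5 (scalar 51)))))))))

open Classical in
theorem exec_writeHeavy {nH m : ℕ} {y : ℕ → ℕ → ℚ} {par : ℕ → ℕ} {δ : ℚ} {z : Fin m → ℚ}
    (hm : μ 0 0 0 = m) (hn : μ 0 0 1 = nH) (hδ : μ 0 0 4 = δ) (hz : ∀ i : Fin m, μ 5 0 i = z i)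
    (hnN : nH ≤ N) (hmN : m ≤ N) (hbits : ∀ k ≤ nH + m, bitSize (k : ℚ) ≤ B)
    (hzB : ∀ i, bitSize (2 / 5 * z i) ≤ B) (hy : μ 10 = y) (hpar : ∀ a, μ 12 0 a = par a)
    (hp : ∀ i < m, par (nH + i) = nH + m ∨ par (nH + i) < nH)
    (hT : ∀ j, j = nH + m ∨ j < nH → μ 53 0 j = clusterTop (nH + m) y par j)
    (hc : ∀ v, μ 54 0 v = if Claimed nH y par v then 1 else 0)
    (h7 : μ 7 = 0) (h9 : μ 9 = 0) :
    Exec N B μ writeHeavy fun μ' => μ' 6 0 0 = nH ∧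
      (∀ (j : Fin nH) (i : Fin m),
        μ' 7 j i = if HeavyMem nH (nH + m) y par (BigMachine δ z) j i then 1 else 0) ∧
      ∀ i : Fin m, μ' 9 0 i = canonicalZ nH δ z y par i := by
  refine Exec.seq (Exec.setScalar (v := nH) (by rw [eval_entry (c' := 1) (by simp), hn])
    (fun _ => hbits nH (by omega)) ?_)
  set mem : ℕ → ℕ → Prop := HeavyMem nH (nH + m) y par (BigMachine δ z) with hmem
  set D : ℕ → ℕ → ℕ → ℕ → Prop := fun k l j i => (j < k ∧ i < m) ∨ (j = k ∧ i < l) with hD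
  refine Exec.forLoop_forLoop (n := nH) (m := m) (fun k l μ' => μ' 6 0 0 = nH ∧
    (∀ j i, μ' 7 j i = if D k l j i ∧ mem j i then 1 else 0) ∧
    (∀ i : Fin m, μ' 9 0 i = if ∃ j, D k l j i ∧ mem j i then 2 / 5 * z i else 0)) hnN hmN
    (fun k hk => hbits k (by omega)) (fun k hk => hbits k (by omega)) ?_ ?_ (by omega)
    ?_ ?_ ?_ ?_ ?_ ?_ ?_
  · simp [whenLe, whenEq, iteEq, setEntry, Program.writes]
  · simp [whenLe, whenEq, iteEq, setEntry, Program.writes]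
  · intro μ' hfr
    rw [eval_entry (c' := 1) (by simp), hfr 0 ?_ (by omega) (by omega),
      Store.write_of_ne (by omega), hn]
    simp [whenLe, whenEq, iteEq, setEntry, Program.writes]
  · intro μ' hfr
    rw [eval_entry (c' := 0) (by simp), hfr 0 ?_ (by omega) (by omega),
      Store.write_of_ne (by omega), hm]
    simp [whenLe, whenEq, iteEq, setEntry, Program.writes]
  · intro k l μ' μ'' h
    rw [h 6 (by omega) (by omega), h 7 (by omega) (by omega), h 9 (by omega) (by omega)]
    exact id
  · refine ⟨by simp [Store.write], fun j i => ?_, fun i => ?_⟩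
    · rw [Store.write_of_ne (by omega), h7]
      simp [hD]
    · rw [Store.write_of_ne (by omega), h9]
      simp [hD]
  · rintro k l μ' hk hl hfr h50 h51 ⟨i6, i7, i9⟩
    have f : ∀ a, a ≠ 6 → a ≠ 7 → a ≠ 9 → a ≠ 50 → a ≠ 51 → μ' a = μ a := by
      intro a h1 h2 h3 h4 h5
      rw [hfr a ?_ h4 h5, Store.write_of_ne h1]
      simp [whenLe, whenEq, iteEq, setEntry, Program.writes, h2, h3]
    have hDs : ∀ j i, D k (l + 1) j i ↔ D k l j i ∨ (j = k ∧ i = l) := by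
      intro j i
      simp only [hD]
      omega
    have ej : (scalar 50).eval μ' = (k : ℕ) := by rw [eval_scalar, h50]
    have ei : (scalar 51).eval μ' = (l : ℕ) := by rw [eval_scalar, h51]
    have ep : (entry 12 (scalar 50)).eval μ' = (par k : ℕ) := by
      rw [eval_entry ej, f 12 (by omega) (by omega) (by omega) (by omega) (by omega), hpar]
    have ev : (Expr.add (entry 0 (.lit 1)) (scalar 51)).eval μ' = (nH + l : ℕ) := by
      rw [eval_add, eval_entry (c' := 1) (by simp), ei,
        f 0 (by omega) (by omega) (by omega) (by omega) (by omega), hn]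
      push_cast
      rfl
    have ey : (Expr.read 10 (scalar 50) (entry 12 (scalar 50))).eval μ' = y k (par k) := by
      rw [eval_read ej ep, f 10 (by omega) (by omega) (by omega) (by omega) (by omega), hy]
    have ez : ∀ ν : Store, ν 5 = μ' 5 → ν 51 = μ' 51 →
        (Expr.mul (.lit (2 / 5)) (entry 5 (scalar 51))).eval ν = 2 / 5 * z ⟨l, hl⟩ := by
      intro ν h1 h2
      rw [eval_mul, eval_entry (c' := l) (by rw [eval_scalar, h2, h51]), h1,
        f 5 (by omega) (by omega) (by omega) (by omega) (by omega), eval_lit]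
      congr 1
      exact hz ⟨l, hl⟩
    have hset : mem k l → Exec N B μ' (.seq (.assign 7 (scalar 50) (scalar 51) (.lit 1))
        (setEntry 9 (scalar 51) (.mul (.lit (2 / 5)) (entry 5 (scalar 51))))) fun μ' =>
        μ' 6 0 0 = nH ∧
        (∀ j i, μ' 7 j i = if D k (l + 1) j i ∧ mem j i then 1 else 0) ∧
        (∀ i : Fin m, μ' 9 0 i = if ∃ j, D k (l + 1) j i ∧ mem j i then 2 / 5 * z i else 0) := by
      intro hkl
      refine Exec.seq (Exec.assign ej ei (eval_lit 1)
        (fun _ => by simpa using hbits 1 (by omega)) ?_)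
      refine Exec.setEntry (c' := l)
        (by rw [eval_scalar, Store.write_of_ne (by omega), h51])
        (ez _ (Store.write_of_ne (by omega)) (Store.write_of_ne (by omega)))
        (fun _ => hzB _) ?_
      refine ⟨?_, fun j i => ?_, fun i => ?_⟩
      · rw [Store.write_of_ne (by omega), Store.write_of_ne (by omega), i6]
      · rw [Store.write_of_ne (by omega)]
        by_cases h : j = k ∧ i = l
        · rw [if_pos ⟨(hDs j i).mpr (Or.inr h), by rw [h.1, h.2]; exact hkl⟩]
          simp [Store.write, h]
        · simp only [hDs, h, or_false]
          rw [← i7 j i]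
          simp [Store.write, h]
      · by_cases h : (i : ℕ) = l
        · rw [if_pos ⟨k, (hDs _ _).mpr (Or.inr ⟨rfl, h⟩), by rw [h]; exact hkl⟩]
          have : (⟨l, hl⟩ : Fin m) = i := Fin.ext h.symm
          simp [Store.write, h, this]
        · simp only [hDs, h, and_false, or_false]
          rw [← i9 i]
          simp [Store.write, h]
    have hskip : ¬ mem k l → μ' 6 0 0 = nH ∧
        (∀ j i, μ' 7 j i = if D k (l + 1) j i ∧ mem j i then 1 else 0) ∧
        (∀ i : Fin m, μ' 9 0 i = if ∃ j, D k (l + 1) j i ∧ mem j i then 2 / 5 * z i else 0) := by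
      intro hkl
      have : ∀ j i, (D k (l + 1) j i ∧ mem j i) ↔ (D k l j i ∧ mem j i) := by
        intro j i
        rw [hDs]
        constructor
        · rintro ⟨h | ⟨rfl, rfl⟩, h2⟩
          · exact ⟨h, h2⟩
          · exact absurd h2 hkl
        · rintro ⟨h, h2⟩
          exact ⟨Or.inl h, h2⟩
      simp only [this]
      exact ⟨i6, i7, i9⟩
    refine Exec.ite (fun h => ?_) fun h => ?_
    · rw [ey, eval_lit] at h
      have hnl : ¬ Linked y par k := not_lt.mpr h
      have ec : (entry 54 (.add (entry 0 (.lit 1)) (scalar 51))).eval μ' =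
          if Claimed nH y par (nH + l) then 1 else 0 := by
        rw [eval_entry ev, f 54 (by omega) (by omega) (by omega) (by omega) (by omega), hc]
      have et : (entry 53 (entry 12 (.add (entry 0 (.lit 1)) (scalar 51)))).eval μ' =
          clusterTop (nH + m) y par (par (nH + l)) := by
        rw [eval_entry (c' := par (nH + l)),
          f 53 (by omega) (by omega) (by omega) (by omega) (by omega), hT _ (hp l hl)]
        rw [eval_entry ev, f 12 (by omega) (by omega) (by omega) (by omega) (by omega), hpar]
      refine Exec.whenLe (fun h1 => ?_) fun h1 => hskip ?_
      · have h1' : ¬ Claimed nH y par (nH + l) := by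
          intro hcl
          rw [ec, if_pos hcl, eval_lit] at h1
          norm_num at h1
        refine Exec.whenEq (fun h2 => ?_) fun h2 => hskip ?_
        · rw [et, ej] at h2
          have eδ : (Expr.mul (.lit (3 / 5)) (entry 0 (.lit 4))).eval μ' = 3 / 5 * δ := by
            rw [eval_mul, eval_entry (c' := 4) (by simp),
              f 0 (by omega) (by omega) (by omega) (by omega) (by omega), hδ, eval_lit]
          have em : (Expr.mul (entry 0 (.lit 0))
              (.mul (.lit (2 / 5)) (entry 5 (scalar 51)))).eval μ' =
              m * (2 / 5 * z ⟨l, hl⟩) := by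
            rw [eval_mul, eval_entry (c' := 0) (by simp), ez μ' rfl rfl,
              f 0 (by omega) (by omega) (by omega) (by omega) (by omega), hm]
          refine Exec.whenLe (fun h3 => hset ?_) fun h3 => hskip ?_
          · rw [eδ, em] at h3
            exact Or.inr ⟨hnl, h1', by exact_mod_cast h2, hl, h3⟩
          · rw [eδ, em] at h3
            rintro (h4 | ⟨-, -, -, _, h4⟩)
            · exact hnl h4.1
            · exact h3 h4
        · rw [et, ej] at h2
          rintro (h4 | ⟨-, -, h4, -⟩)
          · exact hnl h4.1
          · exact h2 (by rw [h4])
      · rintro (h4 | ⟨-, h4, -⟩)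
        · exact hnl h4.1
        · rw [ec, if_neg h4, eval_lit] at h1
          exact h1 le_rfl
    · rw [ey, eval_lit] at h
      have hlk : Linked y par k := not_le.mp h
      refine Exec.whenEq (fun h1 => hset ?_) fun h1 => hskip ?_
      · rw [ep, ev] at h1
        exact Or.inl ⟨hlk, by exact_mod_cast h1⟩
      · rw [ep, ev] at h1
        rintro (⟨-, h4⟩ | ⟨h4, -⟩)
        · exact h1 (by rw [h4])
        · exact h4 hlk
  · intro k μ'
    have : ∀ j i, D (k + 1) 0 j i ↔ D k m j i := by
      intro j i
      simp only [hD]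
      omega
    simp only [this]
    exact id
  · rintro μ' ⟨i6, i7, i9⟩
    refine ⟨i6, fun j i => ?_, fun i => ?_⟩
    · rw [i7]
      simp [hD]
    · rw [i9, canonicalZ]
      congr 1
      apply propext
      constructor
      · rintro ⟨j, h1, h2⟩
        have : j < nH := by
          simp only [hD] at h1
          omega
        exact ⟨⟨j, this⟩, h2⟩
      · rintro ⟨j, h⟩
        exact ⟨j, Or.inl ⟨j.2, i.2⟩, h⟩

/-- The program that counts in the array `55`, for each light job, the machines with which it
forms a free pair. -/
def countFree : Program :=
  forLoop 50 (entry 0 (.lit 2)) (forLoop 51 (entry 0 (.lit 0))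
    (whenLt (.lit 0) (.read 30 (scalar 50) (.add (entry 0 (.lit 2)) (scalar 51)))
      (whenLt (.lit 0) (.read 30 (.add (entry 0 (.lit 2)) (scalar 51)) (scalar 50))
        (setEntry 55 (scalar 50) (.add (entry 55 (scalar 50)) (.lit 1))))))

theorem freeDegree_succ (nJ l : ℕ) (y : ℕ → ℕ → ℚ) (j : ℕ) [Decidable (Free y j (nJ + l))] :
    freeDegree nJ (l + 1) y j = freeDegree nJ l y j + if Free y j (nJ + l) then 1 else 0 := by
  unfold freeDegree
  rw [Finset.range_add_one, Finset.filter_insert]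
  split_ifs with h
  · rw [Finset.card_insert_of_notMem (by simp)]
  · rfl

theorem freeDegree_le (nJ l : ℕ) (y : ℕ → ℕ → ℚ) (j : ℕ) : freeDegree nJ l y j ≤ l := by
  classical
  unfold freeDegree
  exact (Finset.card_filter_le _ _).trans (by simp)

theorem exec_countFree {nL m : ℕ} {y : ℕ → ℕ → ℚ} (hm : μ 0 0 0 = m) (hn : μ 0 0 2 = nL)
    (hnN : nL ≤ N) (hmN : m ≤ N) (hbits : ∀ k ≤ nL + m, bitSize (k : ℚ) ≤ B)
    (hy : μ 30 = y) (h0 : μ 55 = 0) :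
    Exec N B μ countFree fun μ' => ∀ j < nL, μ' 55 0 j = freeDegree nL m y j := by
  refine Exec.forLoop_forLoop (n := nL) (m := m) (fun k l μ' =>
    ∀ j, μ' 55 0 j = if j < k then (freeDegree nL m y j : ℚ) else if j = k then
      (freeDegree nL l y j : ℚ) else 0) hnN hmN
    (fun k hk => hbits k (by omega)) (fun k hk => hbits k (by omega)) ?_ ?_ (by omega)
    ?_ ?_ ?_ ?_ ?_ ?_ ?_
  · simp [whenLt, setEntry, Program.writes]
  · simp [whenLt, setEntry, Program.writes]
  · intro μ' hfr
    rw [eval_entry (c' := 2) (by simp), hfr 0 ?_ (by omega) (by omega), hn]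
    simp [whenLt, setEntry, Program.writes]
  · intro μ' hfr
    rw [eval_entry (c' := 0) (by simp), hfr 0 ?_ (by omega) (by omega), hm]
    simp [whenLt, setEntry, Program.writes]
  · intro k l μ' μ'' h
    rw [h 55 (by omega) (by omega)]
    exact id
  · simp [h0, freeDegree]
  · rintro k l μ' hk hl hfr h50 h51 hJ
    have f : ∀ a, a ≠ 55 → a ≠ 50 → a ≠ 51 → μ' a = μ a := by
      intro a h1 h2 h3
      exact hfr a (by simp [whenLt, setEntry, Program.writes, h1]) h2 h3
    have ej : (scalar 50).eval μ' = (k : ℕ) := by rw [eval_scalar, h50]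
    have ev : (Expr.add (entry 0 (.lit 2)) (scalar 51)).eval μ' = (nL + l : ℕ) := by
      rw [eval_add, eval_entry (c' := 2) (by simp), eval_scalar, h51,
        f 0 (by omega) (by omega) (by omega), hn]
      push_cast
      rfl
    have e1 : (Expr.read 30 (scalar 50) (.add (entry 0 (.lit 2)) (scalar 51))).eval μ' =
        y k (nL + l) := by
      rw [eval_read ej ev, f 30 (by omega) (by omega) (by omega), hy]
    have e2 : (Expr.read 30 (.add (entry 0 (.lit 2)) (scalar 51)) (scalar 50)).eval μ' =
        y (nL + l) k := by
      rw [eval_read ev ej, f 30 (by omega) (by omega) (by omega), hy]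
    have hskip : ¬ Free y k (nL + l) → ∀ j, μ' 55 0 j =
        if j < k then (freeDegree nL m y j : ℚ) else if j = k then
        (freeDegree nL (l + 1) y j : ℚ) else 0 := by
      intro h j
      rw [hJ j]
      by_cases h1 : j = k
      · subst h1
        classical
        rw [freeDegree_succ, if_neg h, add_zero]
      · simp [h1]
    refine Exec.whenLt (fun h => ?_) fun h => hskip fun h' => h (by rw [e1]; exact h'.1)
    refine Exec.whenLt (fun h1 => ?_) fun h1 => hskip fun h' => h1 (by rw [e2]; exact h'.2)
    rw [e1] at h
    rw [e2] at h1
    have hsucc : freeDegree nL (l + 1) y k = freeDegree nL l y k + 1 := by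
      classical
      rw [freeDegree_succ, if_pos ⟨h, h1⟩]
    refine Exec.setEntry ej (v := ((freeDegree nL (l + 1) y k : ℕ) : ℚ)) ?_
      (fun _ => hbits _ ((freeDegree_le _ _ _ _).trans (by omega))) ?_
    · rw [eval_add, eval_entry ej, hJ k, eval_lit, hsucc]
      simp
    · intro j
      by_cases h2 : j = k
      · simp [Store.write, h2]
      · have := hJ j
        simp only [h2, if_false] at this ⊢
        rw [← this]
        simp [Store.write, h2]
  · intro k μ' h j
    rw [h j]
    rcases lt_trichotomy j k with h1 | rfl | h1
    · rw [if_pos h1, if_pos (by omega)]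
    · simp
    · rw [if_neg (by omega), if_neg (by omega), if_neg (by omega)]
      split_ifs <;> simp [freeDegree]
  · intro μ' h j hj
    rw [h j, if_pos hj]

end

section

variable {N B : ℕ} {μ : Store}

/-- The program that computes the light loads of the canonical instance. -/
def writeLight : Program :=
  forLoop 50 (entry 0 (.lit 0)) (forLoop 51 (entry 0 (.lit 0)) (forLoop 52 (entry 0 (.lit 2))
    (whenLe (entry 55 (scalar 52)) (.lit 1) (whenLe (.lit 1) (.read 2 (scalar 52) (scalar 51))
      (whenLe (.read 30 (.add (entry 0 (.lit 2)) (scalar 51)) (scalar 52)) (.lit 0)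
        (iteEq (scalar 50) (scalar 51)
          (whenLe (entry 55 (scalar 52)) (.lit 0)
            (.assign 8 (scalar 50) (scalar 51)
              (.add (.read 8 (scalar 50) (scalar 51)) (entry 0 (.lit 3)))))
          (whenLt (.lit 0) (.read 30 (scalar 52) (.add (entry 0 (.lit 2)) (scalar 50)))
            (whenLt (.lit 0) (.read 30 (.add (entry 0 (.lit 2)) (scalar 50)) (scalar 52))
              (.assign 8 (scalar 50) (scalar 51)
                (.add (.read 8 (scalar 50) (scalar 51)) (entry 0 (.lit 3)))))))))))) 

open Classical in
theorem exec_writeLight {nL m : ℕ} {y : ℕ → ℕ → ℚ} {inc : Fin nL → Finset (Fin m)} {ε : ℚ}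
    (hm : μ 0 0 0 = m) (hn : μ 0 0 2 = nL) (hε : μ 0 0 3 = ε)
    (hinc : ∀ (j : Fin nL) (i : Fin m), μ 2 j i = if i ∈ inc j then 1 else 0)
    (hnN : nL ≤ N) (hmN : m ≤ N) (hbits : ∀ k ≤ nL + m, bitSize (k : ℚ) ≤ B)
    (hεB : ∀ k ≤ nL, bitSize (ε * k) ≤ B) (hy : μ 30 = y) (hy0 : ∀ a b, 0 ≤ y a b)
    (hd : ∀ j < nL, μ 55 0 j = freeDegree nL m y j) (h8 : μ 8 = 0) :
    Exec N B μ writeLight fun μ' =>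
      ∀ h k : Fin m, μ' 8 h k = ε * typeCount inc y h k := by
  refine Exec.forLoop_forLoop (n := m) (m := m) (fun k l μ' => ∀ h c : Fin m, μ' 8 h c =
    if (h : ℕ) < k ∨ (h : ℕ) = k ∧ (c : ℕ) < l then ε * typeCount inc y h c else 0) hmN hmN
    (fun k hk => hbits k (by omega)) (fun k hk => hbits k (by omega)) ?_ ?_ (by omega)
    ?_ ?_ ?_ ?_ ?_ ?_ ?_
  · simp [forLoop, whenLe, whenLt, iteEq, setScalar, Program.writes]
  · simp [forLoop, whenLe, whenLt, iteEq, setScalar, Program.writes]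
  · intro μ' hfr
    rw [eval_entry (c' := 0) (by simp), hfr 0 ?_ (by omega) (by omega), hm]
    simp [forLoop, whenLe, whenLt, iteEq, setScalar, Program.writes]
  · intro μ' hfr
    rw [eval_entry (c' := 0) (by simp), hfr 0 ?_ (by omega) (by omega), hm]
    simp [forLoop, whenLe, whenLt, iteEq, setScalar, Program.writes]
  · intro k l μ' μ'' h
    rw [h 8 (by omega) (by omega)]
    exact id
  · simp [h8]
  · rintro k l μ' hk hl hfr h50 h51 hJ
    have f : ∀ a, a ≠ 8 → a ≠ 50 → a ≠ 51 → a ≠ 52 → μ' a = μ a := by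
      intro a h1 h2 h3 h4
      refine hfr a ?_ h2 h3
      simp [forLoop, whenLe, whenLt, iteEq, setScalar, Program.writes, h1, h4]
    -- the number of jobs of the current type among the first jobs
    set cnt : ℕ → ℕ := fun n => (Finset.univ.filter fun j : Fin nL =>
      (j : ℕ) < n ∧ HasType inc y j ⟨k, hk⟩ ⟨l, hl⟩).card with hcnt
    have cnt_zero : cnt 0 = 0 := by simp [hcnt]
    have cnt_top : cnt nL = typeCount inc y ⟨k, hk⟩ ⟨l, hl⟩ := by
      simp [hcnt, typeCount]
    have cnt_le : ∀ n, cnt n ≤ nL := fun n => by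
      simpa using Finset.card_le_univ (Finset.univ.filter fun j : Fin nL =>
        (j : ℕ) < n ∧ HasType inc y j ⟨k, hk⟩ ⟨l, hl⟩)
    have cnt_pos : ∀ n (hn : n < nL), HasType inc y ⟨n, hn⟩ ⟨k, hk⟩ ⟨l, hl⟩ →
        cnt (n + 1) = cnt n + 1 := by
      intro n hn h
      have : (Finset.univ.filter fun j : Fin nL =>
          (j : ℕ) < n + 1 ∧ HasType inc y j ⟨k, hk⟩ ⟨l, hl⟩) = insert ⟨n, hn⟩
          (Finset.univ.filter fun j : Fin nL =>
            (j : ℕ) < n ∧ HasType inc y j ⟨k, hk⟩ ⟨l, hl⟩) := by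
        ext j
        simp only [Finset.mem_filter, Finset.mem_univ, true_and, Finset.mem_insert]
        constructor
        · rintro ⟨h1, h2⟩
          rcases Nat.lt_succ_iff_lt_or_eq.mp h1 with h3 | h3
          · exact Or.inr ⟨h3, h2⟩
          · exact Or.inl (Fin.ext h3)
        · rintro (rfl | ⟨h1, h2⟩)
          · exact ⟨Nat.lt_succ_self n, h⟩
          · exact ⟨by omega, h2⟩
      simp only [hcnt]
      rw [this, Finset.card_insert_of_notMem (by simp)]
    have cnt_neg : ∀ n (hn : n < nL), ¬ HasType inc y ⟨n, hn⟩ ⟨k, hk⟩ ⟨l, hl⟩ →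
        cnt (n + 1) = cnt n := by
      intro n hn h
      simp only [hcnt]
      congr 1
      ext j
      simp only [Finset.mem_filter, Finset.mem_univ, true_and]
      constructor
      · rintro ⟨h1, h2⟩
        rcases Nat.lt_succ_iff_lt_or_eq.mp h1 with h3 | h3
        · exact ⟨h3, h2⟩
        · exact absurd (by rwa [show j = ⟨n, hn⟩ from Fin.ext h3] at h2) h
      · exact fun h1 => ⟨by omega, h1.2⟩
    clear_value cnt
    refine Exec.forLoop (n := nL) (fun n μ'' => ∀ h c : Fin m, μ'' 8 h c =
      if (h : ℕ) = k ∧ (c : ℕ) = l then ε * cnt n else μ' 8 h c) hnN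
      (fun k hk => hbits k (by omega)) ?_ ?_ ?_ ?_ ?_ ?_
    · simp [whenLe, whenLt, iteEq, Program.writes]
    · intro μ'' hfr'
      rw [eval_entry (c' := 2) (by simp), hfr' 0 ?_ (by omega),
        f 0 (by omega) (by omega) (by omega) (by omega), hn]
      simp [whenLe, whenLt, iteEq, Program.writes]
    · intro n μ'' q h
      rwa [Store.write_of_ne (by omega)]
    · intro h c
      split_ifs with h1
      · rw [hJ, if_neg (by omega), cnt_zero]
        simp
      · rfl
    · rintro n μ'' hnL hfr' h52 hI
      have g : ∀ a, a ≠ 8 → a ≠ 52 → μ'' a = μ' a := by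
        intro a h1 h2
        exact hfr' a (by simp [whenLe, whenLt, iteEq, Program.writes, h1]) h2
      set J : Fin nL := ⟨n, hnL⟩ with hJn
      have g' : ∀ a, a ≠ 8 → a ≠ 50 → a ≠ 51 → a ≠ 52 → μ'' a = μ a := by
        intro a h1 h2 h3 h4
        rw [g a h1 h4, f a h1 h2 h3 h4]
      have eh : (scalar 50).eval μ'' = (k : ℕ) := by
        rw [eval_scalar, g 50 (by omega) (by omega), h50]
      have ek : (scalar 51).eval μ'' = (l : ℕ) := by
        rw [eval_scalar, g 51 (by omega) (by omega), h51]
      have ej : (scalar 52).eval μ'' = (n : ℕ) := by rw [eval_scalar, h52]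
      have evh : (Expr.add (entry 0 (.lit 2)) (scalar 50)).eval μ'' = (nL + k : ℕ) := by
        rw [eval_add, eval_entry (c' := 2) (by simp), eh,
          g' 0 (by omega) (by omega) (by omega) (by omega), hn]
        push_cast
        rfl
      have evk : (Expr.add (entry 0 (.lit 2)) (scalar 51)).eval μ'' = (nL + l : ℕ) := by
        rw [eval_add, eval_entry (c' := 2) (by simp), ek,
          g' 0 (by omega) (by omega) (by omega) (by omega), hn]
        push_cast
        rfl
      have e30 : μ'' 30 = y := by
        rw [g' 30 (by omega) (by omega) (by omega) (by omega), hy]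
      have ed : (entry 55 (scalar 52)).eval μ'' = freeDegree nL m y n := by
        rw [eval_entry ej, g' 55 (by omega) (by omega) (by omega) (by omega), hd n hnL]
      have ei : (Expr.read 2 (scalar 52) (scalar 51)).eval μ'' =
          if (⟨l, hl⟩ : Fin m) ∈ inc J then 1 else 0 := by
        rw [eval_read ej ek, g' 2 (by omega) (by omega) (by omega) (by omega)]
        exact hinc J ⟨l, hl⟩
      have ekj : (Expr.read 30 (.add (entry 0 (.lit 2)) (scalar 51)) (scalar 52)).eval μ'' =
          y (nL + l) n := by
        rw [eval_read evk ej, e30]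
      have ejh : (Expr.read 30 (scalar 52) (.add (entry 0 (.lit 2)) (scalar 50))).eval μ'' =
          y n (nL + k) := by
        rw [eval_read ej evh, e30]
      have ehj : (Expr.read 30 (.add (entry 0 (.lit 2)) (scalar 50)) (scalar 52)).eval μ'' =
          y (nL + k) n := by
        rw [eval_read evh ej, e30]
      have hskip : ¬ HasType inc y J ⟨k, hk⟩ ⟨l, hl⟩ → ∀ h c : Fin m, μ'' 8 h c =
          if (h : ℕ) = k ∧ (c : ℕ) = l then ε * cnt (n + 1) else μ' 8 h c := by
        intro h
        rw [cnt_neg n hnL h]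
        exact hI
      have hadd : HasType inc y J ⟨k, hk⟩ ⟨l, hl⟩ → Exec N B μ'' (.assign 8 (scalar 50) (scalar 51)
          (.add (.read 8 (scalar 50) (scalar 51)) (entry 0 (.lit 3)))) fun ν =>
          ∀ h c : Fin m, ν 8 h c =
          if (h : ℕ) = k ∧ (c : ℕ) = l then ε * cnt (n + 1) else μ' 8 h c := by
        intro h
        refine Exec.assign eh ek (v := ε * cnt (n + 1)) ?_ (fun _ => hεB _ (cnt_le _)) ?_
        · have := hI ⟨k, hk⟩ ⟨l, hl⟩
          simp only [and_self, if_true] at this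
          rw [eval_add, eval_read eh ek, this, eval_entry (c' := 3) (by simp),
            g' 0 (by omega) (by omega) (by omega) (by omega), hε, cnt_pos n hnL h]
          push_cast
          ring
        · intro a c
          by_cases h1 : (a : ℕ) = k ∧ (c : ℕ) = l
          · simp [Store.write, h1]
          · have := hI a c
            rw [if_neg h1] at this ⊢
            rw [← this]
            simp [Store.write, h1]
      have hy0' : y (nL + l) n ≤ 0 ↔ y (nL + l) n = 0 :=
        ⟨fun h => le_antisymm h (hy0 _ _), fun h => h.le⟩
      have c1 : freeDegree nL m y n ≤ 1 ↔ (freeDegree nL m y n : ℚ) ≤ 1 := by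
        exact_mod_cast Iff.rfl
      have c0 : freeDegree nL m y n = 0 ↔ (freeDegree nL m y n : ℚ) ≤ 0 := by
        rw [← Nat.le_zero]
        exact_mod_cast Iff.rfl
      refine Exec.whenLe (fun h1 => ?_) fun h1 => hskip fun h' => h1 ?_
      swap
      · rw [ed, eval_lit]
        exact c1.mp h'.1
      rw [ed, eval_lit] at h1
      refine Exec.whenLe (fun h2 => ?_) fun h2 => hskip fun h' => h2 ?_
      swap
      · rw [ei, eval_lit, if_pos h'.2.1]
      rw [ei, eval_lit] at h2
      have h2' : (⟨l, hl⟩ : Fin m) ∈ inc J := by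
        by_contra hc
        rw [if_neg hc] at h2
        norm_num at h2
      refine Exec.whenLe (fun h3 => ?_) fun h3 => hskip fun h' => h3 ?_
      swap
      · rw [ekj, eval_lit]
        exact hy0'.mpr h'.2.2.1
      rw [ekj, eval_lit] at h3
      have h3' := hy0'.mp h3
      refine Exec.iteEq (fun h4 => ?_) fun h4 => ?_
      · rw [eh, ek] at h4
        have h4' : k = l := by exact_mod_cast h4
        refine Exec.whenLe (fun h5 => hadd ?_) fun h5 => hskip fun h' => h5 ?_
        · rw [ed, eval_lit] at h5
          exact ⟨c1.mpr h1, h2', h3', Or.inl ⟨Fin.ext h4', c0.mpr h5⟩⟩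
        · rw [ed, eval_lit]
          rcases h'.2.2.2 with h6 | h6
          · exact c0.mp h6.2
          · exact absurd (Fin.ext h4') h6.1
      · rw [eh, ek] at h4
        have h4' : (⟨k, hk⟩ : Fin m) ≠ ⟨l, hl⟩ := fun h => h4 (by rw [Fin.mk.inj h])
        have hfree : HasType inc y J ⟨k, hk⟩ ⟨l, hl⟩ → Free y n (nL + k) := by
          intro h'
          rcases h'.2.2.2 with h6 | h6
          · exact absurd h6.1 h4'
          · exact h6.2
        refine Exec.whenLt (fun h5 => ?_) fun h5 => hskip fun h' => h5 ?_
        swap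
        · rw [ejh, eval_lit]
          exact (hfree h').1
        refine Exec.whenLt (fun h6 => hadd ?_) fun h6 => hskip fun h' => h6 ?_
        · rw [ejh, eval_lit] at h5
          rw [ehj, eval_lit] at h6
          exact ⟨c1.mpr h1, h2', h3', Or.inr ⟨h4', h5, h6⟩⟩
        · rw [ehj, eval_lit]
          exact (hfree h').2
    · rintro μ'' - hI h c
      rw [hI h c, hJ h c]
      by_cases h1 : (h : ℕ) = k ∧ (c : ℕ) = l
      · rw [if_pos h1, if_pos (by omega), cnt_top]
        congr 3
        · exact Fin.ext h1.1.symm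
        · exact Fin.ext h1.2.symm
      · rw [if_neg h1]
        congr 1
        apply propext
        omega
  · intro k μ' h a c
    rw [h a c]
    congr 1
    apply propext
    omega
  · intro μ' h a c
    rw [h a c, if_pos (Or.inl a.2)]

end

/-! ### Rational and real data -/

section

variable {nJ m : ℕ} {y : ℕ → ℕ → ℚ} {rk par : ℕ → ℕ}

theorem free_cast {a b : ℕ} : Free (fun a b => (y a b : ℝ)) a b ↔ Free y a b := by
  simp [Free]

theorem IsForest.cast {V : ℕ} (h : IsForest V y rk par) :
    IsForest V (fun a b => (y a b : ℝ)) rk par where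
  rk_ne a b hf := h.rk_ne a b (free_cast.mp hf)
  par_eq a b hf := h.par_eq a b (free_cast.mp hf)
  par_root a ha := by simpa only [free_cast] using h.par_root a ha
  rk_le := h.rk_le
  par_top := h.par_top

theorem AcyclicAssignment.cast {inc : Fin nJ → Finset (Fin m)} {x : Fin m → Fin nJ → ℚ}
    {u : Fin m → ℚ} (h : AcyclicAssignment inc x u y rk par) :
    AcyclicAssignment inc (fun i j => (x i j : ℝ)) (fun i => (u i : ℝ)) (fun a b => (y a b : ℝ))
      rk par where
  nonneg a b := by exact_mod_cast h.nonneg a b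
  range a b hab := by exact_mod_cast h.range a b hab
  pair j i hi := by exact_mod_cast h.pair j i hi
  out j i hi := by exact_mod_cast h.out j i hi
  out' j i hi := by exact_mod_cast h.out' j i hi
  row j := by exact_mod_cast h.row j
  col i := by exact_mod_cast h.col i
  free a b hf := h.free a b (free_cast.mp hf)
  forest := h.forest.cast

theorem linked_cast {j : ℕ} : Linked (fun a b => (y a b : ℝ)) par j ↔ Linked y par j := by
  unfold Linked
  rw [← Rat.cast_lt (K := ℝ)]
  norm_num

theorem nextJob_cast : nextJob (fun a b => (y a b : ℝ)) par = nextJob y par := by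
  classical
  funext j
  simp only [nextJob]
  exact if_congr linked_cast rfl rfl

theorem clusterTop_cast {V j : ℕ} :
    clusterTop V (fun a b => (y a b : ℝ)) par j = clusterTop V y par j := by
  simp only [clusterTop, nextJob_cast]

theorem bigMachine_cast {δ : ℚ} {z : Fin m → ℚ} {i : ℕ} :
    BigMachine (δ : ℝ) (fun i => (z i : ℝ)) i ↔ BigMachine δ z i := by
  unfold BigMachine
  refine exists_congr fun h => ?_
  rw [← Rat.cast_le (K := ℝ)]
  push_cast
  rfl

theorem heavyMem_cast {V : ℕ} {δ : ℚ} {z : Fin m → ℚ} {j i : ℕ} :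
    HeavyMem nJ V (fun a b => (y a b : ℝ)) par (BigMachine (δ : ℝ) fun i => (z i : ℝ)) j i ↔
      HeavyMem nJ V y par (BigMachine δ z) j i := by
  simp only [HeavyMem, Claimed, linked_cast, clusterTop_cast, bigMachine_cast]

theorem canonicalZ_cast {δ : ℚ} {z : Fin m → ℚ} {i : Fin m} :
    canonicalZ nJ (δ : ℝ) (fun i => (z i : ℝ)) (fun a b => (y a b : ℝ)) par i =
      (canonicalZ nJ δ z y par i : ℚ) := by
  classical
  simp only [canonicalZ]
  rw [if_congr (exists_congr fun _ => heavyMem_cast) rfl rfl]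
  split_ifs <;> simp

theorem freeDegree_cast {j : ℕ} :
    freeDegree nJ m (fun a b => (y a b : ℝ)) j = freeDegree nJ m y j := by
  unfold freeDegree
  congr 1
  ext i
  simp only [Finset.mem_filter, free_cast]

theorem typeCount_cast {inc : Fin nJ → Finset (Fin m)} {h k : Fin m} :
    typeCount inc (fun a b => (y a b : ℝ)) h k = typeCount inc y h k := by
  classical
  unfold typeCount
  congr 1
  ext j
  rw [Finset.mem_filter, Finset.mem_filter]
  simp only [HasType, freeDegree_cast, free_cast, Rat.cast_eq_zero]

end

section

variable {K : Type} [Field K] [LinearOrder K] [IsStrictOrderedRing K] {nJ m : ℕ}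
  {inc : Fin nJ → Finset (Fin m)} {x : Fin m → Fin nJ → K} {u : Fin m → K}

theorem residual_mem {A : AddSubgroup K} (hx : ∀ j, ∀ i ∈ inc j, x i j ∈ A) (hu : ∀ i, u i ∈ A)
    (a b : ℕ) : residual inc x u a b ∈ A := by
  rcases residual_cases (inc := inc) (x := x) (u := u) a b with
    h | ⟨j, i, hi, rfl, rfl⟩ | ⟨j, i, hi, rfl, rfl⟩
  · rw [h.1]
    exact A.zero_mem
  · rw [residual_job, if_pos hi]
    exact hx j i hi
  · rw [residual_mach, if_pos hi]
    exact A.sub_mem (hu i) (hx j i hi)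

theorem residual_add_le {c : K} (hc : 0 ≤ c) (hu : ∀ i, u i ≤ c) (a b : ℕ) :
    residual inc x u a b + residual inc x u b a ≤ c := by
  rcases residual_cases (inc := inc) (x := x) (u := u) a b with
    h | ⟨j, i, hi, rfl, rfl⟩ | ⟨j, i, hi, rfl, rfl⟩
  · rw [h.1, h.2, add_zero]
    exact hc
  · rw [residual_job, residual_mach, if_pos hi, if_pos hi]
    linarith [hu i]
  · rw [residual_job, residual_mach, if_pos hi, if_pos hi]
    linarith [hu i]

end

/-! ### The program and its correctness -/

/-- The program that computes a canonical instance. The arrays `10` to `21` are used for the forest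
of the heavy jobs, those from `30` to `41` for the forest of the light jobs; the residual capacities
are in the first of them, and the parents in the third. The arrays `50`, `51`, `52` are loop
variables. -/
def canonicalProgram : Program :=
  .seq (buildResidual 10 1 3 (entry 0 (.lit 1)) (entry 0 (.lit 0)) (.lit 2))
    (.seq (cancelCycles 10) (.seq clusterTops (.seq markClaimed (.seq writeHeavy
      (.seq (buildResidual 30 2 4 (entry 0 (.lit 2)) (entry 0 (.lit 0))
          (.sub (.lit 1) (entry 9 (scalar 51))))
        (.seq (cancelCycles 30) (.seq countFree writeLight)))))))

theorem writes_buildResidual {o inc x : ℕ} {nJ m u : Expr} {a : ℕ} (h1 : a ≠ o)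
    (h2 : a ≠ o + 11) (h3 : a ≠ 50) (h4 : a ≠ 51) :
    a ∉ (buildResidual o inc x nJ m u).writes := by
  simp [buildResidual, forLoop, whenLe, setScalar, Program.writes, h1, h2, h3, h4]

theorem writes_cancelCycles {o a : ℕ} (h : a < o ∨ o + 10 < a) :
    a ∉ (cancelCycles o).writes := by
  have h0 : ∀ c ≤ 10, a ≠ o + c := by
    intro c hc
    omega
  have h00 := h0 0 (by omega)
  simp only [add_zero] at h00
  simp [cancelCycles, searchStep, findNext, findRepeat, findMin, peelLast, pushCycle, forLoop,
    whenLe, whenLt, whenEq, whenNe, iteEq, setScalar, setEntry, Program.writes, h0, h00]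

section

variable {m nH nL : ℕ} {I : Instance ℚ m nH nL} {δ : ℚ} {s : LPPoint ℚ m nH nL}

theorem canonicalZ_mem_pair {z : Fin m → ℚ} {y : ℕ → ℕ → ℚ} {par : ℕ → ℕ} (i : Fin m) :
    canonicalZ nH δ z y par i = 0 ∨ canonicalZ nH δ z y par i = 2 / 5 * z i := by
  unfold canonicalZ
  split_ifs
  · exact Or.inr rfl
  · exact Or.inl rfl

open Classical in
/-- The program computes the canonical instance for acyclic assignments of the heavy and of the
light jobs. Cancelling cycles keeps all residual capacities in the subgroup `A`, and this bounds
their bit lengths. -/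
theorem exec_canonicalProgram {N B : ℕ} {A : AddSubgroup ℚ}
    (hH : ∀ j, ∀ i ∈ I.heavyMach j, 0 ≤ s.xH i j ∧ s.xH i j ≤ 1)
    (hL : ∀ j, ∀ i ∈ I.lightMach j, 0 ≤ s.xL i j ∧ s.xL i j ≤ 1 - 2 / 5 * s.z i)
    (hz : ∀ i, 0 ≤ s.z i ∧ s.z i ≤ 1) (h1A : (1 : ℚ) ∈ A)
    (hHA : ∀ i j, s.xH i j ∈ A) (hLA : ∀ i j, s.xL i j ∈ A) (hzA : ∀ i, 2 / 5 * s.z i ∈ A)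
    (hA : ∀ q ∈ A, 0 ≤ q → q ≤ 2 → bitSize q ≤ B)
    (hεB : ∀ k ≤ nL, bitSize (I.eps * k) ≤ B)
    (hN : ∀ V ≤ nH + nL + m, (V + 1) * (V * V + V) + V ≤ N)
    (hbits : ∀ k ≤ nH + nL + m + 1, bitSize (k : ℚ) ≤ B) :
    Exec N B (encodeInput I δ s) canonicalProgram fun μ => ∃ yH yL rkH parH rkL parL,
      AcyclicAssignment I.heavyMach s.xH (fun _ => 2) yH rkH parH ∧
      AcyclicAssignment I.lightMach s.xL (fun i => 1 - canonicalZ nH δ s.z yH parH i)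
        yL rkL parL ∧ μ 6 0 0 = nH ∧
      (∀ (j : Fin nH) (i : Fin m), μ 7 j i =
        if HeavyMem nH (nH + m) yH parH (BigMachine δ s.z) j i then 1 else 0) ∧
      (∀ h k : Fin m, μ 8 h k = I.eps * typeCount I.lightMach yL h k) ∧
      ∀ i : Fin m, μ 9 0 i = canonicalZ nH δ s.z yH parH i := by
  have hNle : ∀ V ≤ nH + nL + m, V ≤ N := fun V hV => (Nat.le_add_left _ _).trans (hN V hV)
  have h2A : (2 : ℚ) ∈ A := by
    have := A.add_mem h1A h1A
    norm_num at this
    exact this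
  have em : encodeInput I δ s 0 0 0 = m := rfl
  have enH : encodeInput I δ s 0 0 1 = nH := rfl
  have enL : encodeInput I δ s 0 0 2 = nL := rfl
  have eε : encodeInput I δ s 0 0 3 = I.eps := rfl
  have eδ : encodeInput I δ s 0 0 4 = δ := rfl
  have e1 : ∀ (j : Fin nH) (i : Fin m), encodeInput I δ s 1 j i =
      if i ∈ I.heavyMach j then 1 else 0 := fun j i => by simp [encodeInput]
  have e2 : ∀ (j : Fin nL) (i : Fin m), encodeInput I δ s 2 j i =
      if i ∈ I.lightMach j then 1 else 0 := fun j i => by simp [encodeInput]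
  have e3 : ∀ (j : Fin nH) (i : Fin m), encodeInput I δ s 3 j i = s.xH i j :=
    fun j i => by simp [encodeInput]
  have e4 : ∀ (j : Fin nL) (i : Fin m), encodeInput I δ s 4 j i = s.xL i j :=
    fun j i => by simp [encodeInput]
  have e5 : ∀ i : Fin m, encodeInput I δ s 5 0 i = s.z i := fun i => by simp [encodeInput]
  have e0 : ∀ a, 6 ≤ a → encodeInput I δ s a = 0 := by
    intro a ha
    obtain ⟨b, rfl⟩ := Nat.exists_eq_add_of_le' ha
    rfl
  generalize encodeInput I δ s = μ₀ at em enH enL eε eδ e1 e2 e3 e4 e5 e0 ⊢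
  -- the forest for the heavy jobs
  refine Exec.seq ((exec_buildResidual (nJ := nH) (m := m) (inc := I.heavyMach) (x := s.xH)
    (u := fun _ => 2) (by omega) (by omega) (by omega) (hNle _ (by omega)) (hNle _ (by omega))
    (fun k hk => hbits k (by omega)) (fun j i hi => ?_) (fun ν hν => ?_) (fun ν hν => ?_)
    (fun ν hν i hi => rfl) e1 e3 (e0 10 (by omega))).frame ?_)
  · exact hA _ (A.sub_mem h2A (hHA i j)) (by linarith [hH j i hi]) (by linarith [hH j i hi])
  · rw [eval_entry (c' := 1) (by simp), hν 0 (by omega), enH]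
  · rw [eval_entry (c' := 0) (by simp), hν 0 (by omega), em]
  rintro μ₁ ⟨y₁, V₁⟩ f₁
  have g₁ : ∀ a, a ≠ 10 → a ≠ 21 → a ≠ 50 → a ≠ 51 → μ₁ a = μ₀ a :=
    fun a h1 h2 h3 h4 => f₁ a (writes_buildResidual h1 h2 h3 h4)
  refine Exec.seq ((exec_cancelCycles (A := A) V₁ (fun a h1 h2 => ?_) y₁ residual_supported
    (residual_mem (fun j i _ => hHA i j) fun _ => h2A)
    (residual_nonneg fun j i hi => ⟨(hH j i hi).1, (hH j i hi).2.trans one_le_two⟩)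
    (residual_add_le zero_le_two fun _ => le_rfl) (hN _ (by omega))
    (fun k hk => hbits k (by omega)) hA).frame ?_)
  · rw [g₁ _ (by omega) (by omega) (by omega) (by omega), e0 _ (by omega)]
  rintro μ₂ ⟨rkH, parH, c₂, hf₂, par₂⟩ f₂
  have acH := c₂.acyclicAssignment hf₂
  set yH := μ₂ 10 with hyH
  have g₂ : ∀ a, a < 10 ∨ 21 < a → a ≠ 50 → a ≠ 51 → μ₂ a = μ₀ a := fun a h1 h2 h3 => by
    rw [f₂ a (writes_cancelCycles (by omega)), g₁ a (by omega) (by omega) h2 h3]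
  have V₂ : μ₂ 21 0 0 = ((nH + m : ℕ) : ℚ) := by rw [f₂ 21 (writes_cancelCycles (by omega)), V₁]
  have hp : ∀ i < m, parH (nH + i) = nH + m ∨ parH (nH + i) < nH := by
    intro i hi
    rcases acH.cast.par_mach ⟨i, hi⟩ with h | ⟨j, h, -⟩
    · exact Or.inl h
    · exact Or.inr (by simp only at h; omega)
  -- the canonical heavy jobs
  refine Exec.seq ((exec_clusterTops V₂
    (by rw [g₂ 0 (by omega) (by omega) (by omega), enH]) (by omega) (hNle _ (by omega))
    (fun k hk => hbits k (by omega)) hyH.symm par₂).frame ?_)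
  rintro μ₃ ⟨T₃, T₃'⟩ f₃
  have g₃ : ∀ a, a ≠ 50 → a ≠ 51 → a ≠ 53 → μ₃ a = μ₂ a := fun a h1 h2 h3 =>
    f₃ a (by simp [clusterTops, forLoop, whenLt, setScalar, setEntry, Program.writes, h1, h2, h3])
  refine Exec.seq ((exec_markClaimed
    (by rw [g₃ 0 (by omega) (by omega) (by omega), g₂ 0 (by omega) (by omega) (by omega), enH])
    (hNle _ (by omega)) (fun k hk => hbits k (by omega))
    (by rw [g₃ 10 (by omega) (by omega) (by omega)])
    (by rwa [g₃ 12 (by omega) (by omega) (by omega)])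
    (by rw [g₃ 54 (by omega) (by omega) (by omega), g₂ 54 (by omega) (by omega) (by omega),
      e0 54 (by omega)])).frame ?_)
  rintro μ₄ c₄ f₄
  have g₄ : ∀ a, a ≠ 50 → a ≠ 51 → a ≠ 53 → a ≠ 54 → μ₄ a = μ₂ a := fun a h1 h2 h3 h4 => by
    rw [f₄ a (by simp [markClaimed, forLoop, whenLt, setScalar, setEntry, Program.writes, h1, h4]),
      g₃ a h1 h2 h3]
  have g₄' : ∀ a, a < 10 → μ₄ a = μ₀ a := fun a h => by
    rw [g₄ a (by omega) (by omega) (by omega) (by omega), g₂ a (by omega) (by omega) (by omega)]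
  refine Exec.seq ((exec_writeHeavy (nH := nH) (m := m) (y := yH) (par := parH) (δ := δ)
    (z := s.z) (by rw [g₄' 0 (by omega), em]) (by rw [g₄' 0 (by omega), enH])
    (by rw [g₄' 0 (by omega), eδ]) (by rwa [g₄' 5 (by omega)])
    (hNle _ (by omega)) (hNle _ (by omega)) (fun k hk => hbits k (by omega))
    (fun i => hA _ (hzA i) (by linarith [hz i]) (by linarith [hz i]))
    (by rw [g₄ 10 (by omega) (by omega) (by omega) (by omega)])
    (by rwa [g₄ 12 (by omega) (by omega) (by omega) (by omega)]) hp ?_ c₄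
    (by rw [g₄' 7 (by omega), e0 7 (by omega)]) (by rw [g₄' 9 (by omega), e0 9 (by omega)])).frame ?_)
  · intro j hj
    rw [f₄ 53 (by simp [markClaimed, forLoop, whenLt, setScalar, setEntry, Program.writes])]
    rcases hj with rfl | hj
    · rw [T₃', ← clusterTop_cast, clusterTop_of_not_linked acH.cast.not_linked_top]
    · exact T₃ j hj
  rintro μ₅ ⟨o6, o7, o9⟩ f₅
  set ζ := canonicalZ nH δ s.z yH parH with hζ
  have hζA : ∀ i, ζ i ∈ A := by
    intro i
    rcases canonicalZ_mem_pair (δ := δ) (z := s.z) (y := yH) (par := parH) i with h | h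
    · rw [hζ, h]
      exact A.zero_mem
    · rw [hζ, h]
      exact hzA i
  have hζ0 : ∀ i, 0 ≤ ζ i ∧ ζ i ≤ 2 / 5 * s.z i := by
    intro i
    have := hz i
    rcases canonicalZ_mem_pair (δ := δ) (z := s.z) (y := yH) (par := parH) i with h | h
    · rw [hζ, h]
      exact ⟨le_rfl, by linarith⟩
    · rw [hζ, h]
      exact ⟨by linarith, le_rfl⟩
  have hLζ : ∀ j, ∀ i ∈ I.lightMach j, 0 ≤ s.xL i j ∧ s.xL i j ≤ 1 - ζ i := fun j i hi =>
    ⟨(hL j i hi).1, (hL j i hi).2.trans (by linarith [hζ0 i])⟩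
  have huA : ∀ i, 1 - ζ i ∈ A := fun i => A.sub_mem h1A (hζA i)
  have g₅ : ∀ a, a ≠ 6 → a ≠ 7 → a ≠ 9 → a < 10 ∨ 21 < a → a ≠ 50 → a ≠ 51 → a ≠ 53 → a ≠ 54 →
      μ₅ a = μ₀ a := fun a h1 h2 h3 h4 h5 h6 h7 h8 => by
    rw [f₅ a (by simp [writeHeavy, forLoop, whenLe, whenEq, iteEq, setScalar, setEntry,
      Program.writes, h1, h2, h3, h5, h6]), g₄ a h5 h6 h7 h8, g₂ a h4 h5 h6]
  -- the forest for the light jobs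
  refine Exec.seq ((exec_buildResidual (nJ := nL) (m := m) (inc := I.lightMach) (x := s.xL)
    (u := fun i => 1 - ζ i) (by omega) (by omega) (by omega) (hNle _ (by omega))
    (hNle _ (by omega)) (fun k hk => hbits k (by omega)) (fun j i hi => ?_) (fun ν hν => ?_)
    (fun ν hν => ?_) (fun ν hν i hi => ?_)
    (by rwa [g₅ 2 (by omega) (by omega) (by omega) (by omega) (by omega) (by omega) (by omega)
      (by omega)])
    (by rwa [g₅ 4 (by omega) (by omega) (by omega) (by omega) (by omega) (by omega) (by omega)
      (by omega)])
    (by rw [g₅ 30 (by omega) (by omega) (by omega) (by omega) (by omega) (by omega) (by omega)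
      (by omega), e0 30 (by omega)])).frame ?_)
  · exact hA _ (A.sub_mem (huA i) (hLA i j)) (by linarith [hLζ j i hi])
      (by linarith [hLζ j i hi, hζ0 i])
  · rw [eval_entry (c' := 2) (by simp), hν 0 (by omega), g₅ 0 (by omega) (by omega) (by omega)
      (by omega) (by omega) (by omega) (by omega) (by omega), enL]
  · rw [eval_entry (c' := 0) (by simp), hν 0 (by omega), g₅ 0 (by omega) (by omega) (by omega)
      (by omega) (by omega) (by omega) (by omega) (by omega), em]
  · rw [eval_sub, eval_lit, eval_entry (c' := (i : ℕ)) (by rw [eval_scalar, hi]),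
      hν 9 (by omega), o9]
  rintro μ₆ ⟨y₆, V₆⟩ f₆
  have g₆ : ∀ a, a ≠ 30 → a ≠ 41 → a ≠ 50 → a ≠ 51 → μ₆ a = μ₅ a :=
    fun a h1 h2 h3 h4 => f₆ a (writes_buildResidual h1 h2 h3 h4)
  refine Exec.seq ((exec_cancelCycles (A := A) V₆ (fun a h1 h2 => ?_) y₆ residual_supported
    (residual_mem (fun j i _ => hLA i j) huA) (residual_nonneg hLζ)
    (residual_add_le zero_le_two fun i => by linarith [hζ0 i]) (hN _ (by omega))
    (fun k hk => hbits k (by omega)) hA).frame ?_)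
  · rw [g₆ _ (by omega) (by omega) (by omega) (by omega), g₅ _ (by omega) (by omega) (by omega)
      (by omega) (by omega) (by omega) (by omega) (by omega), e0 _ (by omega)]
  rintro μ₇ ⟨rkL, parL, c₇, hf₇, -⟩ f₇
  have acL := c₇.acyclicAssignment hf₇
  set yL := μ₇ 30 with hyL
  have g₇ : ∀ a, a < 30 ∨ 41 < a → a ≠ 50 → a ≠ 51 → μ₇ a = μ₅ a := fun a h1 h2 h3 => by
    rw [f₇ a (writes_cancelCycles (by omega)), g₆ a (by omega) (by omega) h2 h3]
  have g₇' : ∀ a, a < 6 ∨ a = 8 ∨ a = 55 → μ₇ a = μ₀ a := fun a h => by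
    rw [g₇ a (by omega) (by omega) (by omega), g₅ a (by omega) (by omega) (by omega)
      (by omega) (by omega) (by omega) (by omega) (by omega)]
  -- the light loads
  refine Exec.seq ((exec_countFree (by rw [g₇' 0 (by omega), em]) (by rw [g₇' 0 (by omega), enL])
    (hNle nL (by omega)) (hNle m (by omega)) (fun k hk => hbits k (by omega)) hyL.symm
    (by rw [g₇' 55 (by omega), e0 55 (by omega)])).frame ?_)
  rintro μ₈ d₈ f₈
  have g₈ : ∀ a, a ≠ 50 → a ≠ 51 → a ≠ 55 → μ₈ a = μ₇ a := fun a h1 h2 h3 =>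
    f₈ a (by simp [countFree, forLoop, whenLt, setScalar, setEntry, Program.writes, h1, h2, h3])
  have g₈' : ∀ a, a < 6 ∨ a = 8 → μ₈ a = μ₀ a := fun a h => by
    rw [g₈ a (by omega) (by omega) (by omega), g₇' a (by omega)]
  refine (exec_writeLight (y := yL) (inc := I.lightMach) (by rw [g₈' 0 (by omega), em])
    (by rw [g₈' 0 (by omega), enL]) (by rw [g₈' 0 (by omega), eε]) (by rwa [g₈' 2 (by omega)])
    (hNle nL (by omega)) (hNle m (by omega)) (fun k hk => hbits k (by omega)) hεB
    (by rw [g₈ 30 (by omega) (by omega) (by omega)]) acL.nonneg d₈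
    (by rw [g₈' 8 (by omega), e0 8 (by omega)])).frame ?_
  intro μ₉ o8 f₉
  have g₉ : ∀ a, a = 6 ∨ a = 7 ∨ a = 9 → μ₉ a = μ₅ a := fun a h => by
    rw [f₉ a ?_, g₈ a (by omega) (by omega) (by omega), g₇ a (by omega) (by omega) (by omega)]
    rcases h with rfl | rfl | rfl <;>
    simp [writeLight, forLoop, whenLe, whenLt, iteEq, setScalar, Program.writes]
  refine ⟨yH, yL, rkH, parH, rkL, parL, acH, acL, ?_, ?_, o8, ?_⟩
  · rw [g₉ 6 (by omega), o6]
  · rw [g₉ 7 (by omega)]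
    exact o7
  · rw [g₉ 9 (by omega)]
    exact o9

end

/-! ### The running time in terms of the length of the input -/

/-- The rational numbers whose product with `D` is an integer. -/
def multiples (D : ℕ) : AddSubgroup ℚ where
  carrier := {q | ∃ n : ℤ, q * D = n}
  zero_mem' := ⟨0, by simp⟩
  add_mem' := by
    rintro p q ⟨a, ha⟩ ⟨b, hb⟩
    exact ⟨a + b, by rw [add_mul, ha, hb]; push_cast; rfl⟩
  neg_mem' := by
    rintro p ⟨a, ha⟩
    exact ⟨-a, by rw [neg_mul, ha]; push_cast; rfl⟩

theorem mem_multiples {D : ℕ} {q : ℚ} (h : q.den ∣ D) : q ∈ multiples D := by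
  obtain ⟨e, rfl⟩ := h
  refine ⟨q.num * e, ?_⟩
  push_cast
  rw [← mul_assoc, Rat.mul_den_eq_num]

theorem two_fifths_mul_mem_multiples {D : ℕ} {q : ℚ} (h : q.den ∣ D) :
    2 / 5 * q ∈ multiples (5 * D) := by
  obtain ⟨e, rfl⟩ := h
  refine ⟨2 * q.num * e, ?_⟩
  push_cast
  rw [← Rat.mul_den_eq_num q]
  ring

theorem bitSize_le_of_mem_multiples {D : ℕ} (hD : D ≠ 0) {q : ℚ} (hq : q ∈ multiples D)
    (h0 : 0 ≤ q) (h2 : q ≤ 2) : bitSize q ≤ 2 * Nat.size D + 3 := by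
  obtain ⟨n, hn⟩ := hq
  have h := bitSize_le_of_mul_eq hD hn
  have hD0 : (0 : ℚ) ≤ D := Nat.cast_nonneg D
  have h3 : (0 : ℚ) ≤ n := by rw [← hn]; positivity
  have h4 : (n : ℚ) ≤ ((2 * D : ℕ) : ℤ) := by
    rw [← hn]
    push_cast
    exact mul_le_mul_of_nonneg_right h2 hD0
  have h3' : 0 ≤ n := by exact_mod_cast h3
  have h4' : n ≤ ((2 * D : ℕ) : ℤ) := by exact_mod_cast h4
  have h5 : n.natAbs ≤ 2 * D := by omega
  have h6 := Nat.size_le_size h5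
  have h7 := size_mul_le 2 D
  have h8 : Nat.size 2 = 2 := by decide
  omega

theorem size_prod_le {ι : Type} (t : Finset ι) (f : ι → ℕ) :
    Nat.size (∏ i ∈ t, f i) ≤ ∑ i ∈ t, Nat.size (f i) + 1 := by
  classical
  induction t using Finset.induction_on with
  | empty => simp
  | insert a t ha ih =>
    rw [Finset.prod_insert ha, Finset.sum_insert ha]
    have := size_mul_le (f a) (∏ i ∈ t, f i)
    omega

section

variable {m nH nL : ℕ} {I : Instance ℚ m nH nL} {δ : ℚ} {s : LPPoint ℚ m nH nL}

/-- A common denominator of all residual capacities that occur in the computation; the factor `5`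
is due to the values `2 / 5 * z i`. -/
def denominator (s : LPPoint ℚ m nH nL) : ℕ :=
  5 * ((∏ p : Fin m × Fin nH, (s.xH p.1 p.2).den) * (∏ p : Fin m × Fin nL, (s.xL p.1 p.2).den) *
    ∏ i, (s.z i).den)

theorem denominator_ne_zero (s : LPPoint ℚ m nH nL) : denominator s ≠ 0 := by
  have h1 := Finset.prod_ne_zero_iff.mpr fun (p : Fin m × Fin nH) (_ : p ∈ Finset.univ) =>
    (s.xH p.1 p.2).den_nz
  have h2 := Finset.prod_ne_zero_iff.mpr fun (p : Fin m × Fin nL) (_ : p ∈ Finset.univ) =>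
    (s.xL p.1 p.2).den_nz
  have h3 := Finset.prod_ne_zero_iff.mpr fun (i : Fin m) (_ : i ∈ Finset.univ) => (s.z i).den_nz
  exact mul_ne_zero (by norm_num) (mul_ne_zero (mul_ne_zero h1 h2) h3)

theorem size_den_le (q : ℚ) : Nat.size q.den ≤ bitSize q := by
  unfold bitSize
  omega

theorem size_denominator_le : Nat.size (denominator s) ≤ inputSize I δ s + 6 := by
  have h1 := size_prod_le Finset.univ fun p : Fin m × Fin nH => (s.xH p.1 p.2).den
  have h2 := size_prod_le Finset.univ fun p : Fin m × Fin nL => (s.xL p.1 p.2).den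
  have h3 := size_prod_le Finset.univ fun i : Fin m => (s.z i).den
  simp only [Fintype.sum_prod_type] at h1 h2
  have h4 : ∑ i, ∑ j, Nat.size (s.xH i j).den ≤ ∑ i, ∑ j, bitSize (s.xH i j) :=
    Finset.sum_le_sum fun i _ => Finset.sum_le_sum fun j _ => size_den_le _
  have h5 : ∑ i, ∑ j, Nat.size (s.xL i j).den ≤ ∑ i, ∑ j, bitSize (s.xL i j) :=
    Finset.sum_le_sum fun i _ => Finset.sum_le_sum fun j _ => size_den_le _
  have h6 : ∑ i, Nat.size (s.z i).den ≤ ∑ i, bitSize (s.z i) :=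
    Finset.sum_le_sum fun i _ => size_den_le _
  have h7 := size_mul_le 5 ((∏ p : Fin m × Fin nH, (s.xH p.1 p.2).den) *
    (∏ p : Fin m × Fin nL, (s.xL p.1 p.2).den) * ∏ i, (s.z i).den)
  have h8 := size_mul_le ((∏ p : Fin m × Fin nH, (s.xH p.1 p.2).den) *
    (∏ p : Fin m × Fin nL, (s.xL p.1 p.2).den)) (∏ i, (s.z i).den)
  have h9 := size_mul_le (∏ p : Fin m × Fin nH, (s.xH p.1 p.2).den)
    (∏ p : Fin m × Fin nL, (s.xL p.1 p.2).den)
  have h10 : Nat.size 5 = 3 := by decide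
  unfold denominator inputSize
  omega

theorem small_encodeInput : Small (inputSize I δ s + 2) (encodeInput I δ s) := by
  have hH : ∀ i j, bitSize (s.xH i j) ≤ ∑ i, ∑ j, bitSize (s.xH i j) := fun i j =>
    (Finset.single_le_sum (f := fun j => bitSize (s.xH i j)) (fun _ _ => Nat.zero_le _)
      (Finset.mem_univ j)).trans
      (Finset.single_le_sum (f := fun i => ∑ j, bitSize (s.xH i j)) (fun _ _ => Nat.zero_le _)
        (Finset.mem_univ i))
  have hL : ∀ i j, bitSize (s.xL i j) ≤ ∑ i, ∑ j, bitSize (s.xL i j) := fun i j =>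
    (Finset.single_le_sum (f := fun j => bitSize (s.xL i j)) (fun _ _ => Nat.zero_le _)
      (Finset.mem_univ j)).trans
      (Finset.single_le_sum (f := fun i => ∑ j, bitSize (s.xL i j)) (fun _ _ => Nat.zero_le _)
        (Finset.mem_univ i))
  have hz : ∀ i, bitSize (s.z i) ≤ ∑ i, bitSize (s.z i) := fun i =>
    Finset.single_le_sum (f := fun i => bitSize (s.z i)) (fun _ _ => Nat.zero_le _)
      (Finset.mem_univ i)
  have h0 : bitSize 0 ≤ 2 := by simpa using bitSize_natCast_le 0
  have h1 : bitSize 1 ≤ 3 := by simpa using bitSize_natCast_le 1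
  have hm := bitSize_natCast_le m
  have hnH := bitSize_natCast_le nH
  have hnL := bitSize_natCast_le nL
  have hε := bitSize_pos I.eps
  intro a r c
  unfold encodeInput inputSize
  split
  · omega
  · omega
  · omega
  · omega
  · omega
  · split_ifs <;> omega
  · split_ifs <;> omega
  · split_ifs with h
    · have := hH ⟨_, h.2⟩ ⟨_, h.1⟩
      omega
    · omega
  · split_ifs with h
    · have := hL ⟨_, h.2⟩ ⟨_, h.1⟩
      omega
    · omega
  · split_ifs with h
    · have := hz ⟨_, h⟩
      omega
    · omega
  · omega

theorem Small.mono {B B' : ℕ} {μ : Store} (h : Small B μ) (hB : B ≤ B') : Small B' μ :=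
  fun a r c => (h a r c).trans hB

/-- A bound on the number of iterations of each loop in terms of the length of the input. -/
def iterationBound : Polynomial ℕ :=
  (Polynomial.X + 1) * (Polynomial.X * Polynomial.X + Polynomial.X) + Polynomial.X

/-- A bound on the bit lengths of all numbers in the memory in terms of the length of the input. -/
def bitBound : Polynomial ℕ := 4 * Polynomial.X + 20

/-- A polynomial bound on the running time of the program. -/
def timeBound : Polynomial ℕ := canonicalProgram.timePoly.comp iterationBound * bitBound

theorem exists_runs_canonicalProgram (hm : 0 < m) (hε : 0 < I.eps) (hε1 : I.eps ≤ 1) (hδ0 : 0 < δ)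
    (hδ : 0.6 * δ < 0.2) (hfeas : LPFeasible I.toReal 0.6 (δ : ℝ) s.toReal) :
    ∃ (μ : Store) (t : ℕ), Runs canonicalProgram (encodeInput I δ s) μ t ∧
      t ≤ timeBound.eval (inputSize I δ s) ∧ ∃ (k : ℕ) (C : CanonicalInstance m k),
        HoldsOutput μ C ∧ IsCanonicalReduction I.toReal 0.6 (δ : ℝ) C := by
  classical
  set S := inputSize I δ s with hS
  have hsum : nH + nL + m + bitSize I.eps ≤ S := by
    rw [hS]
    unfold inputSize
    omega
  have hH : ∀ j, ∀ i ∈ I.heavyMach j, 0 ≤ s.xH i j ∧ s.xH i j ≤ 1 := fun j i hi => by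
    have := heavy_bounds hfeas j i hi
    simp only [LPPoint.toReal] at this
    exact_mod_cast this
  have hz : ∀ i, 0 ≤ s.z i ∧ s.z i ≤ 1 := fun i => by
    have h1 := hfeas.z_nonneg i
    have h2 := hfeas.z_le_one i
    simp only [LPPoint.toReal] at h1 h2
    exact_mod_cast And.intro h1 h2
  have hL : ∀ j, ∀ i ∈ I.lightMach j, 0 ≤ s.xL i j ∧ s.xL i j ≤ 1 - 2 / 5 * s.z i :=
      fun j i hi => by
    have h1 := hfeas.xL_nonneg j i hi
    have h2 := hfeas.compact j i hi
    simp only [LPPoint.toReal] at h1 h2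
    have h3 : (s.xL i j : ℝ) ≤ ((1 - 2 / 5 * s.z i : ℚ) : ℝ) := by
      push_cast
      linarith
    exact ⟨by exact_mod_cast h1, by exact_mod_cast h3⟩
  have hden : ∀ {q : ℚ}, q.den ∣ (∏ p : Fin m × Fin nH, (s.xH p.1 p.2).den) *
      (∏ p : Fin m × Fin nL, (s.xL p.1 p.2).den) * ∏ i, (s.z i).den →
      q ∈ multiples (denominator s) := fun h => mem_multiples (h.mul_left 5)
  have hrun := exec_canonicalProgram (I := I) (δ := δ) (s := s)
    (N := iterationBound.eval S) (B := bitBound.eval S) (A := multiples (denominator s)) hH hL hz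
    (mem_multiples (by simp))
    (fun i j => hden (((Finset.dvd_prod_of_mem (fun p : Fin m × Fin nH => (s.xH p.1 p.2).den)
      (Finset.mem_univ (i, j))).mul_right _).mul_right _))
    (fun i j => hden (((Finset.dvd_prod_of_mem (fun p : Fin m × Fin nL => (s.xL p.1 p.2).den)
      (Finset.mem_univ (i, j))).mul_left _).mul_right _))
    (fun i => two_fifths_mul_mem_multiples ((Finset.dvd_prod_of_mem (fun i => (s.z i).den)
      (Finset.mem_univ i)).mul_left _))
    (fun q hq h0 h2 => ?_) (fun k hk => ?_) (fun V hV => ?_) (fun k hk => ?_)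
  · obtain ⟨μ, t, h1, h2, -, yH, yL, rkH, parH, rkL, parL, acH, acL, o6, o7, o8, o9⟩ :=
      hrun (small_encodeInput.mono (by simp [bitBound, ← hS]; omega))
    refine ⟨μ, t, h1, ?_, nH, ?_⟩
    · simpa [timeBound] using h2
    have hu : (fun _ : Fin m => ((2 : ℚ) : ℝ)) = fun _ => 2 := by simp
    have hu' : (fun i : Fin m => ((1 - canonicalZ nH δ s.z yH parH i : ℚ) : ℝ)) = fun i =>
        1 - canonicalZ nH (δ : ℝ) s.toReal.z (fun a b => (yH a b : ℝ)) parH i := by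
      funext i
      simp only [LPPoint.toReal, canonicalZ_cast]
      push_cast
      rfl
    have acH' := acH.cast
    have acL' := acL.cast
    rw [hu] at acH'
    rw [hu'] at acL'
    have hδ' : 0.6 * (δ : ℝ) < 0.2 := by
      have : ((0.6 * δ : ℚ) : ℝ) < ((0.2 : ℚ) : ℝ) := by exact_mod_cast hδ
      push_cast at this
      norm_num at this ⊢
      exact this
    obtain ⟨C, c1, c2, c3, c4⟩ := exists_canonicalReduction hm
      (I := I.toReal) (δ := (δ : ℝ)) (s := s.toReal)
      (by simp only [Instance.toReal]; exact_mod_cast hε)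
      (by simp only [Instance.toReal]; exact_mod_cast hε1) (by exact_mod_cast hδ0) hδ' hfeas
      acH' acL'
    refine ⟨C, ⟨o6, fun j i => ?_, fun h l => ?_, fun i => ?_⟩, c4⟩
    · rw [o7]
      refine if_congr ?_ rfl rfl
      rw [c1, ← heavyMem_cast]
      rfl
    · rw [o8, c2]
      simp only [Instance.toReal, typeCount_cast]
      push_cast
      rfl
    · rw [o9, c3]
      exact canonicalZ_cast.symm
  · have h3 := bitSize_le_of_mem_multiples (denominator_ne_zero s) hq h0 h2
    have h4 := size_denominator_le (I := I) (δ := δ) (s := s)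
    simp [bitBound]
    omega
  · have h3 := bitSize_mul_le I.eps k
    have h4 := bitSize_natCast_le k
    simp [bitBound]
    omega
  · have hVS : V ≤ S := by omega
    simp only [iterationBound, Polynomial.eval_add, Polynomial.eval_mul, Polynomial.eval_X,
      Polynomial.eval_one]
    gcongr
  · have h4 := bitSize_natCast_le k
    simp [bitBound]
    omega

end

end RestrictedAssignment

end

theorem mainTheorem5 :
    -- real data: a canonical instance as required exists
    (∀ (m nH nL : ℕ) (I : RestrictedAssignment.Instance ℝ m nH nL) (δ : ℝ)
      (s : RestrictedAssignment.LPPoint ℝ m nH nL),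
      0 < m → 0 < I.eps → I.eps ≤ 1 → 0 < δ → 0.6 * δ < 0.2 →
      RestrictedAssignment.LPFeasible I 0.6 δ s →
      ∃ (k : ℕ) (C : RestrictedAssignment.CanonicalInstance m k),
        RestrictedAssignment.IsCanonicalReduction I 0.6 δ C) ∧
    -- rational data: one program computes such an instance in polynomial time
    (∃ (P : RestrictedAssignment.Program) (T : Polynomial ℕ),
      ∀ (m nH nL : ℕ) (I : RestrictedAssignment.Instance ℚ m nH nL) (δ : ℚ)
        (s : RestrictedAssignment.LPPoint ℚ m nH nL),
        0 < m → 0 < I.eps → I.eps ≤ 1 → 0 < δ → 0.6 * δ < 0.2 →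
        RestrictedAssignment.LPFeasible I.toReal 0.6 (δ : ℝ) s.toReal →
        ∃ (μ : RestrictedAssignment.Store) (t : ℕ),
          RestrictedAssignment.Runs P (RestrictedAssignment.encodeInput I δ s) μ t ∧
          t ≤ T.eval (RestrictedAssignment.inputSize I δ s) ∧
          ∃ (k : ℕ) (C : RestrictedAssignment.CanonicalInstance m k),
            RestrictedAssignment.HoldsOutput μ C ∧
            RestrictedAssignment.IsCanonicalReduction I.toReal 0.6 (δ : ℝ) C) := by
  refine ⟨fun m nH nL I δ s hm hε hε1 hδ0 hδ hfeas =>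
      RestrictedAssignment.exists_canonicalInstance hm hε hε1 hδ0 hδ hfeas,
    RestrictedAssignment.canonicalProgram, RestrictedAssignment.timeBound,
    fun m nH nL I δ s hm hε hε1 hδ0 hδ hfeas =>
      RestrictedAssignment.exists_runs_canonicalProgram hm hε hε1 hδ0 hδ hfeas⟩
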